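/- Let $n\ge 1$ and $\tau\in\mathbb C$ with $\mathrm{Im}\,\tau>0$; put $\Lambda_\tau=\mathbb Z+\mathbb Z\tau$, $E_\tau=\mathbb C/\Lambda_\tau$, let $\mathrm{Diag}\subset\mathbb C^n$ be the set of $\mathbf z$ with $z_{ij}:=z_i-z_j\in\Lambda_\tau$ for some $i\ne j$, let $C(E_\tau,n)=(\mathbb C^n\setminus\mathrm{Diag})/\Lambda_\tau^n$ be the configuration space of $n$ distinct ordered points of $E_\tau$, and $\bar C(E_\tau,n)=C(E_\tau,n)/E_\tau$ its quotient by the diagonal translations. Let $\delta_1,\dots,\delta_n$ be the canonical basis of $\mathbb C^n$ and $\mathrm i=\sqrt{-1}$. Let $\mathfrak t_{1,n}$ be the complex Lie algebra with generators $x_i,y_i$ $(1\le i\le n)$, $t_{ij}$ $(i\ne j)$ and relations (distinct letters denoting distinct indices, except that $i=j$ is allowed in $[x_i,x_j]=[y_i,y_j]=0$): $t_{ij}=t_{ji}$, $[t_{ij},t_{ik}+t_{jk}]=0$, $[t_{ij},t_{kl}]=0$, $[x_i,y_j]=t_{ij}$, $[x_i,x_j]=[y_i,y_j]=0$, $[x_i,y_i]=-\sum_{j\ne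 i}t_{ij}$, $[x_i,t_{jk}]=[y_i,t_{jk}]=0$, $[x_i+x_j,t_{ij}]=[y_i+y_j,t_{ij}]=0$. Let $\bar{\mathfrak t}_{1,n}=\mathfrak t_{1,n}/(\sum_i x_i,\sum_i y_i)$, with projection $a\mapsto\bar a$. Both are positively graded with $\deg x_i=\deg y_i=1$; hats denote degree completions. $S_n$ acts on both by permuting indices, and on $\mathbb C^n$ by permuting coordinates. Let $\theta(z|\tau)=\frac{\sin\pi z}{\pi}\prod_{m\ge1}\frac{(1-q^me^{2\pi\mathrm i z})(1-q^me^{-2\pi\mathrm i z})}{(1-q^m)^2}$, $q=e^{2\pi\mathrm i\tau}$ (the entire function with zero set $\Lambda_\tau$, $\theta(z+1)=-\theta(z)=\theta(-z)$, $\theta(z+\tau)=-e^{-\pi\mathrm i\tau}e^{-2\pi\mathrm i z}\theta(z)$, $\theta'(0)=1$), let $$k(z,x|\tau)=\frac{\theta(z+x|\tau)}{\theta(z|\tau)\theta(x|\tau)}-\frac1x,$$ viewed as a power series in $x$ with coefficients holomorphic in $z\in\mathbb C\setminus\Lambda_\tau$, and $$K_i(\mathbf z|\tau)=-y_i+\sum_{j\ne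 i}k(z_{ij},\mathrm{ad}\,x_i|\tau)(t_{ij})\in\hat{\mathfrak t}_{1,n}.$$ Let $P_{\tau,n}$ be the principal $\exp(\hat{\mathfrak t}_{1,n})$-bundle on $C(E_\tau,n)$ whose sections over an open set $U$ are the holomorphic maps $f$ from the preimage of $U$ in $\mathbb C^n$ to $\exp(\hat{\mathfrak t}_{1,n})$ with $f(\mathbf z+\delta_i)=f(\mathbf z)$, $f(\mathbf z+\tau\delta_i)=e^{-2\pi\mathrm i x_i}f(\mathbf z)$ (the group acting by right multiplication); let $\tilde P_{\tau,n}$ be the associated $\exp(\hat{\bar{\mathfrak t}}_{1,n})$-bundle (the same conditions with $\bar x_i$), and $\bar P_{\tau,n}$ the $\exp(\hat{\bar{\mathfrak t}}_{1,n})$-bundle on $\bar C(E_\tau,n)$ whose sections satisfy in addition $f(\mathbf z+u\sum_i\delta_i)=f(\mathbf z)$ for $u\in\mathbb C$ (so $\tilde P_{\tau,n}$ is the pull-back of $\bar P_{\tau,n}$). **Theorem.** The maps $K_i(-|\tau)$ are holomorphic on $\mathbb C^n\setminus\mathrm{Diag}$, and for all $i,j$ $$K_i(\mathbf z+\delta_j|\tau)=K_i(\mathbf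 z|\tau),\qquad K_i(\mathbf z+\tau\delta_j|\tau)=e^{-2\pi\mathrm i\,\mathrm{ad}\,x_j}(K_i(\mathbf z|\tau)),\qquad \Big[\frac{\partial}{\partial z_i}-K_i,\frac{\partial}{\partial z_j}-K_j\Big]=0 .$$ Consequently there is a unique holomorphic connection $\nabla_{\tau,n}$ on $P_{\tau,n}$ given by $\mathrm d-\sum_iK_i(\mathbf z|\tau)\,\mathrm dz_i$; it is flat and $S_n$-invariant. The connection $\tilde\nabla_{\tau,n}=\mathrm d-\sum_i\bar K_i(\mathbf z|\tau)\,\mathrm dz_i$ induced by it on $\tilde P_{\tau,n}$ is flat and $S_n$-invariant, and it is the pull-back, under $C(E_\tau,n)\to\bar C(E_\tau,n)$, of a unique connection $\bar\nabla_{\tau,n}$ on $\bar P_{\tau,n}$; moreover $\bar\nabla_{\tau,n}$ is flat and $S_n$-invariant. -/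

import Mathlib

noncomputable section

namespace KZB

/-! ## The Lie algebras `𝔱_{1,n}` and `𝔱̄_{1,n}` -/

section LieAlgebras

/-- Generators `x_i`, `y_i`, `t_{ij}`.  For convenience `t i i` is allowed as a symbol;
it is killed by the relation `t_self` below. -/
inductive Gen (n : ℕ) : Type
  | x (i : Fin n)
  | y (i : Fin n)
  | t (i j : Fin n)

abbrev FreeT (n : ℕ) : Type := FreeLieAlgebra ℂ (Gen n)

def fx {n : ℕ} (i : Fin n) : FreeT n := FreeLieAlgebra.of ℂ (Gen.x i)
def fy {n : ℕ} (i : Fin n) : FreeT n := FreeLieAlgebra.of ℂ (Gen.y i)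
def ft {n : ℕ} (i j : Fin n) : FreeT n := FreeLieAlgebra.of ℂ (Gen.t i j)

/-- The defining relators of `𝔱_{1,n}` (`Relator a` stands for the relation `a = 0`). -/
inductive Relator (n : ℕ) : FreeT n → Prop
  | t_self (i : Fin n) : Relator n (ft i i)
  | t_symm (i j : Fin n) (hij : i ≠ j) : Relator n (ft i j - ft j i)
  | t_add (i j k : Fin n) (hij : i ≠ j) (hik : i ≠ k) (hjk : j ≠ k) :
      Relator n ⁅ft i j, ft i k + ft j k⁆
  | t_t (i j k l : Fin n) (hij : i ≠ j) (hik : i ≠ k) (hil : i ≠ l)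
      (hjk : j ≠ k) (hjl : j ≠ l) (hkl : k ≠ l) : Relator n ⁅ft i j, ft k l⁆
  | x_y (i j : Fin n) (hij : i ≠ j) : Relator n (⁅fx i, fy j⁆ - ft i j)
  | x_x (i j : Fin n) : Relator n ⁅fx i, fx j⁆
  | y_y (i j : Fin n) : Relator n ⁅fy i, fy j⁆
  | x_y_self (i : Fin n) :
      Relator n (⁅fx i, fy i⁆ + ∑ j ∈ Finset.univ.filter (fun j => j ≠ i), ft i j)
  | x_t (i j k : Fin n) (hij : i ≠ j) (hik : i ≠ k) (hjk : j ≠ k) : Relator n ⁅fx i, ft j k⁆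
  | y_t (i j k : Fin n) (hij : i ≠ j) (hik : i ≠ k) (hjk : j ≠ k) : Relator n ⁅fy i, ft j k⁆
  | xx_t (i j : Fin n) (hij : i ≠ j) : Relator n ⁅fx i + fx j, ft i j⁆
  | yy_t (i j : Fin n) (hij : i ≠ j) : Relator n ⁅fy i + fy j, ft i j⁆

def relIdeal (n : ℕ) : LieIdeal ℂ (FreeT n) :=
  LieSubmodule.lieSpan ℂ (FreeT n) {a | Relator n a}

/-- The Lie algebra `𝔱_{1,n}` over `ℂ`. -/
abbrev T (n : ℕ) : Type := FreeT n ⧸ relIdeal n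

def tx {n : ℕ} (i : Fin n) : T n := LieSubmodule.Quotient.mk (fx i)
def ty {n : ℕ} (i : Fin n) : T n := LieSubmodule.Quotient.mk (fy i)
def tt {n : ℕ} (i j : Fin n) : T n := LieSubmodule.Quotient.mk (ft i j)

/-- `Homog d a`: `a` is homogeneous of degree `d`, where `deg x_i = deg y_i = 1`,
hence `deg t_{ij} = 2`. -/
inductive Homog (n : ℕ) : ℕ → T n → Prop
  | x (i : Fin n) : Homog n 1 (tx i)
  | y (i : Fin n) : Homog n 1 (ty i)
  | t (i j : Fin n) : Homog n 2 (tt i j)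
  | zero (d : ℕ) : Homog n d 0
  | add {d : ℕ} {a b : T n} : Homog n d a → Homog n d b → Homog n d (a + b)
  | smul {d : ℕ} (c : ℂ) {a : T n} : Homog n d a → Homog n d (c • a)
  | lie {p q : ℕ} {a b : T n} : Homog n p a → Homog n q b → Homog n (p + q) ⁅a, b⁆

/-- The degree `d` component of `𝔱_{1,n}`. -/
def tGr (n : ℕ) (d : ℕ) : Submodule ℂ (T n) where
  carrier := {a | Homog n d a}
  add_mem' := Homog.add
  zero_mem' := Homog.zero d
  smul_mem' c _ := Homog.smul c

instance (n : ℕ) : SetLike.GradedBracket (tGr n) where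
  bracket_mem := fun _ _ _ _ ha hb => Homog.lie ha hb

/-- The grading is positive. -/
theorem tGr_zero (n : ℕ) : tGr n 0 = ⊥ := by
  have key : ∀ (d : ℕ) (a : T n), Homog n d a → d = 0 → a = 0 := by
    intro d a h
    induction h with
    | x i => intro h; omega
    | y i => intro h; omega
    | t i j => intro h; omega
    | zero d => intro _; rfl
    | add _ _ iha ihb => intro h; rw [iha h, ihb h, add_zero]
    | smul c _ ih => intro h; rw [ih h, smul_zero]
    | lie _ _ iha ihb => intro h; rw [iha (by omega), zero_lie]
  rw [eq_bot_iff]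
  intro a ha
  exact (Submodule.mem_bot ℂ).2 (key 0 a ha rfl)

/-- The ideal `(∑ x_i, ∑ y_i)` of `𝔱_{1,n}`. -/
def centralIdeal (n : ℕ) : LieIdeal ℂ (T n) :=
  LieSubmodule.lieSpan ℂ (T n) {∑ i, tx i, ∑ i, ty i}

/-- The Lie algebra `𝔱̄_{1,n} = 𝔱_{1,n} / (∑ x_i, ∑ y_i)`. -/
abbrev TBar (n : ℕ) : Type := T n ⧸ centralIdeal n

/-- The projection `𝔱_{1,n} → 𝔱̄_{1,n}`, `a ↦ ā`. -/
def toBar (n : ℕ) : T n →ₗ⁅ℂ⁆ TBar n where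
  toLinearMap := (centralIdeal n).toSubmodule.mkQ
  map_lie' := by
    intro a b
    exact LieSubmodule.Quotient.mk_bracket (centralIdeal n) a b

/-- The degree `d` component of `𝔱̄_{1,n}`. -/
def barGr (n : ℕ) (d : ℕ) : Submodule ℂ (TBar n) := (tGr n d).map (toBar n : T n →ₗ[ℂ] TBar n)

instance (n : ℕ) : SetLike.GradedBracket (barGr n) where
  bracket_mem := by
    rintro p q _ _ ⟨a, ha, rfl⟩ ⟨b, hb, rfl⟩
    exact ⟨⁅a, b⁆, Homog.lie ha hb, (toBar n).map_lie a b⟩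

/-- The map induced on quotients by a Lie algebra morphism. -/
def quotMap {L L' : Type*} [LieRing L] [LieAlgebra ℂ L] [LieRing L'] [LieAlgebra ℂ L']
    (f : L →ₗ⁅ℂ⁆ L') (I : LieIdeal ℂ L) (J : LieIdeal ℂ L') (h : I ≤ J.comap f) :
    L ⧸ I →ₗ⁅ℂ⁆ L' ⧸ J where
  toLinearMap := Submodule.mapQ I.toSubmodule J.toSubmodule (f : L →ₗ[ℂ] L')
    (fun a ha => LieIdeal.mem_comap.1 (h ha))
  map_lie' := by
    intro a b
    induction a using Submodule.Quotient.induction_on with | _ a => ?_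
    induction b using Submodule.Quotient.induction_on with | _ b => ?_
    change (LieSubmodule.Quotient.mk (f ⁅a, b⁆) : L' ⧸ J) =
      ⁅(LieSubmodule.Quotient.mk (f a) : L' ⧸ J), (LieSubmodule.Quotient.mk (f b) : L' ⧸ J)⁆
    rw [LieHom.map_lie, LieSubmodule.Quotient.mk_bracket]

/-- `σ ∈ S_n` acting on the generators: `x_i ↦ x_{σ i}`, `y_i ↦ y_{σ i}`,
`t_{ij} ↦ t_{σ i, σ j}`. -/
def freePerm (n : ℕ) (σ : Equiv.Perm (Fin n)) : FreeT n →ₗ⁅ℂ⁆ FreeT n :=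
  FreeLieAlgebra.lift ℂ fun g => match g with
    | Gen.x i => fx (σ i)
    | Gen.y i => fy (σ i)
    | Gen.t i j => ft (σ i) (σ j)

theorem freePerm_fx {n : ℕ} (σ : Equiv.Perm (Fin n)) (i : Fin n) :
    freePerm n σ (fx i) = fx (σ i) := by
  simp [freePerm, fx]

theorem freePerm_fy {n : ℕ} (σ : Equiv.Perm (Fin n)) (i : Fin n) :
    freePerm n σ (fy i) = fy (σ i) := by
  simp [freePerm, fy]

theorem freePerm_ft {n : ℕ} (σ : Equiv.Perm (Fin n)) (i j : Fin n) :
    freePerm n σ (ft i j) = ft (σ i) (σ j) := by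
  simp [freePerm, ft]

theorem freePerm_relator {n : ℕ} (σ : Equiv.Perm (Fin n)) {a : FreeT n} (h : Relator n a) :
    Relator n (freePerm n σ a) := by
  have inj : ∀ {i j : Fin n}, i ≠ j → σ i ≠ σ j := fun h => σ.injective.ne h
  cases h with
  | x_y_self i =>
    have := Relator.x_y_self (σ i)
    convert this using 1
    simp only [map_add, LieHom.map_lie, map_sum, freePerm_fx, freePerm_fy, freePerm_ft]
    congr 1
    refine Finset.sum_bij (fun j _ => σ j) ?_ ?_ ?_ ?_
    · intro j hj
      simpa using hj
    · intro j _ k _ h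
      exact σ.injective h
    · intro j hj
      exact ⟨σ.symm j, by simpa [Equiv.symm_apply_eq] using hj, by simp⟩
    · intro j _
      rfl
  | t_self i =>
    simp only [freePerm_ft]; exact Relator.t_self _
  | t_symm i j h =>
    simp only [map_sub, freePerm_ft]; exact Relator.t_symm _ _ (inj h)
  | t_add i j k h1 h2 h3 =>
    simp only [LieHom.map_lie, map_add, freePerm_ft]
    exact Relator.t_add _ _ _ (inj h1) (inj h2) (inj h3)
  | t_t i j k l h1 h2 h3 h4 h5 h6 =>
    simp only [LieHom.map_lie, freePerm_ft]
    exact Relator.t_t _ _ _ _ (inj h1) (inj h2) (inj h3) (inj h4) (inj h5) (inj h6)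
  | x_y i j h =>
    simp only [LieHom.map_lie, map_sub, freePerm_ft, freePerm_fx, freePerm_fy]
    exact Relator.x_y _ _ (inj h)
  | x_x i j =>
    simp only [LieHom.map_lie, freePerm_fx]; exact Relator.x_x _ _
  | y_y i j =>
    simp only [LieHom.map_lie, freePerm_fy]; exact Relator.y_y _ _
  | x_t i j k h1 h2 h3 =>
    simp only [LieHom.map_lie, freePerm_ft, freePerm_fx]
    exact Relator.x_t _ _ _ (inj h1) (inj h2) (inj h3)
  | y_t i j k h1 h2 h3 =>
    simp only [LieHom.map_lie, freePerm_ft, freePerm_fy]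
    exact Relator.y_t _ _ _ (inj h1) (inj h2) (inj h3)
  | xx_t i j h =>
    simp only [LieHom.map_lie, map_add, freePerm_ft, freePerm_fx]
    exact Relator.xx_t _ _ (inj h)
  | yy_t i j h =>
    simp only [LieHom.map_lie, map_add, freePerm_ft, freePerm_fy]
    exact Relator.yy_t _ _ (inj h)

/-- The action of `S_n` on `𝔱_{1,n}`. -/
def permT (n : ℕ) (σ : Equiv.Perm (Fin n)) : T n →ₗ⁅ℂ⁆ T n :=
  quotMap (freePerm n σ) (relIdeal n) (relIdeal n)
    (LieSubmodule.lieSpan_le.2 fun _ ha => LieIdeal.mem_comap.2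
      (LieSubmodule.subset_lieSpan (freePerm_relator σ ha)))

theorem permT_tx {n : ℕ} (σ : Equiv.Perm (Fin n)) (i : Fin n) : permT n σ (tx i) = tx (σ i) :=
  congrArg (fun a => (LieSubmodule.Quotient.mk a : T n)) (freePerm_fx σ i)

theorem permT_ty {n : ℕ} (σ : Equiv.Perm (Fin n)) (i : Fin n) : permT n σ (ty i) = ty (σ i) :=
  congrArg (fun a => (LieSubmodule.Quotient.mk a : T n)) (freePerm_fy σ i)

/-- The action of `S_n` on `𝔱̄_{1,n}`. -/
def permTBar (n : ℕ) (σ : Equiv.Perm (Fin n)) : TBar n →ₗ⁅ℂ⁆ TBar n :=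
  quotMap (permT n σ) (centralIdeal n) (centralIdeal n) (by
    refine LieSubmodule.lieSpan_le.2 ?_
    rintro a (rfl | rfl)
    · refine LieIdeal.mem_comap.2 (LieSubmodule.subset_lieSpan (Or.inl ?_))
      simp only [map_sum, permT_tx]
      exact Equiv.sum_comp σ (fun i => (tx i : T n))
    · refine LieIdeal.mem_comap.2 (LieSubmodule.subset_lieSpan (Or.inr ?_))
      simp only [map_sum, permT_ty]
      exact Equiv.sum_comp σ (fun i => (ty i : T n)))

end LieAlgebras

/-! ## Degree completions -/

section Completion

variable {L : Type*} [LieRing L] [LieAlgebra ℂ L]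

/-- The degree completion `∏_d L[d]` of a graded Lie algebra `L = ⊕_d L[d]`. -/
def Compl (gr : ℕ → Submodule ℂ L) : Type _ := ∀ d, gr d

namespace Compl

variable (gr : ℕ → Submodule ℂ L)

instance : AddCommGroup (Compl gr) := inferInstanceAs (AddCommGroup (∀ d, gr d))
instance : Module ℂ (Compl gr) := inferInstanceAs (Module ℂ (∀ d, gr d))

variable {gr}

/-- The sequence of homogeneous components. -/
def seq (a : Compl gr) (d : ℕ) : L := (a d : L)

theorem seq_add (a b : Compl gr) (d : ℕ) : (a + b).seq d = a.seq d + b.seq d := rfl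
theorem seq_smul (c : ℂ) (a : Compl gr) (d : ℕ) : (c • a).seq d = c • a.seq d := rfl

theorem ext_seq {a b : Compl gr} (h : ∀ d, a.seq d = b.seq d) : a = b :=
  funext fun d => Subtype.ext (h d)

/-- A homogeneous element, viewed in the completion. -/
def of (d : ℕ) (a : L) (ha : a ∈ gr d) : Compl gr := Pi.single d (⟨a, ha⟩ : gr d)

variable [SetLike.GradedBracket gr]

/-- `[a, b]_d = ∑_{p + q = d} [a_p, b_q]`. -/
instance : Bracket (Compl gr) (Compl gr) where
  bracket a b := fun d => ⟨∑ p ∈ Finset.HasAntidiagonal.antidiagonal d, ⁅a.seq p.1, b.seq p.2⁆,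
    Submodule.sum_mem _ fun p hp => by
      rw [← Finset.HasAntidiagonal.mem_antidiagonal.1 hp]
      exact SetLike.GradedBracket.bracket_mem (a p.1).2 (b p.2).2⟩

theorem seq_lie (a b : Compl gr) (d : ℕ) :
    ⁅a, b⁆.seq d = ∑ p ∈ Finset.HasAntidiagonal.antidiagonal d, ⁅a.seq p.1, b.seq p.2⁆ := rfl

instance : LieRing (Compl gr) where
  add_lie a b c := ext_seq fun d => by
    simp only [seq_lie, seq_add, add_lie, Finset.sum_add_distrib]
  lie_add a b c := ext_seq fun d => by
    simp only [seq_lie, seq_add, lie_add, Finset.sum_add_distrib]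
  lie_self a := ext_seq fun d => by
    change ⁅a, a⁆.seq d = 0
    have h : ⁅a, a⁆.seq d = -⁅a, a⁆.seq d := by
      conv_lhs => rw [seq_lie, ← Finset.Nat.sum_antidiagonal_swap]
      rw [seq_lie, ← Finset.sum_neg_distrib]
      exact Finset.sum_congr rfl fun p _ => (lie_skew _ _).symm
    have h2 : (2 : ℂ) • ⁅a, a⁆.seq d = 0 := by
      rw [two_smul]; nth_rewrite 1 [h]; exact neg_add_cancel _
    exact (smul_eq_zero.1 h2).resolve_left two_ne_zero
  leibniz_lie a b c := ext_seq fun d => by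
    simp only [seq_lie, seq_add, lie_sum, sum_lie, Finset.sum_sigma']
    simp only [leibniz_lie (a.seq _) (b.seq _), Finset.sum_add_distrib]
    congr 1
    · refine Finset.sum_nbij' (fun x => ⟨(x.1.1 + x.2.1, x.2.2), (x.1.1, x.2.1)⟩)
        (fun x => ⟨(x.2.1, x.2.2 + x.1.2), (x.2.2, x.1.2)⟩) ?_ ?_ ?_ ?_ ?_
      all_goals
        rintro ⟨⟨p, q⟩, ⟨r, s⟩⟩ h
        simp only [Finset.mem_sigma, Finset.HasAntidiagonal.mem_antidiagonal] at h ⊢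
        try
          obtain ⟨h1, rfl⟩ := h
          try subst h1
          first | rfl | exact ⟨by omega, trivial⟩
    · refine Finset.sum_nbij' (fun x => ⟨(x.2.1, x.1.1 + x.2.2), (x.1.1, x.2.2)⟩)
        (fun x => ⟨(x.2.1, x.1.1 + x.2.2), (x.1.1, x.2.2)⟩) ?_ ?_ ?_ ?_ ?_
      all_goals
        rintro ⟨⟨p, q⟩, ⟨r, s⟩⟩ h
        simp only [Finset.mem_sigma, Finset.HasAntidiagonal.mem_antidiagonal] at h ⊢
        try
          obtain ⟨h1, rfl⟩ := h
          try subst h1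
          first | rfl | exact ⟨by omega, trivial⟩

instance : LieAlgebra ℂ (Compl gr) where
  lie_smul c a b := ext_seq fun d => by
    simp only [seq_lie, seq_smul, lie_smul, Finset.smul_sum]

/-- `F(ad ξ)(η)` for a formal power series `F`; as the grading is positive, the sum in degree `d`
stops at the `d`-th power. -/
def evalAd (F : PowerSeries ℂ) (ξ η : Compl gr) : Compl gr := fun d =>
  ∑ m ∈ Finset.range (d + 1), PowerSeries.coeff m F • ((LieAlgebra.ad ℂ (Compl gr) ξ ^ m) η) d

end Compl

/-- The completed enveloping algebra `∏_d U(L)[d]` is realised inside `U(L)⟦X⟧`, the sequence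
`(u_d)` of homogeneous elements being the series `∑_d u_d X^d`. -/
abbrev UHat (L : Type*) [LieRing L] [LieAlgebra ℂ L] : Type _ :=
  PowerSeries (UniversalEnvelopingAlgebra ℂ L)

/-- The image in the completed enveloping algebra of a sequence of elements of `L`, the `d`-th one
being placed in degree `d`. -/
def toU (a : ℕ → L) : UHat L := PowerSeries.mk fun d => UniversalEnvelopingAlgebra.ι ℂ (a d)

/-- `exp(a) = ∑_m a^m / m!`, for `a` without component of degree `0`; the sum in degree `d` stops
at the `d`-th power. -/
def expU (a : ℕ → L) : UHat L := PowerSeries.mk fun d =>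
  ∑ m ∈ Finset.range (d + 1), ((m.factorial : ℂ)⁻¹) • PowerSeries.coeff d (toU a ^ m)

/-- The group `exp(L^)`: the exponentials of elements of the degree completion of `L`, multiplied
in the completed enveloping algebra. -/
def ExpGroup (gr : ℕ → Submodule ℂ L) : Set (UHat L) := {g | ∃ a : Compl gr, g = expU a.seq}

attribute [local instance] LieRing.ofAssociativeRing

/-- The morphism of completed enveloping algebras induced by a Lie algebra morphism. -/
def mapU {L L' : Type*} [LieRing L] [LieAlgebra ℂ L] [LieRing L'] [LieAlgebra ℂ L']
    (f : L →ₗ⁅ℂ⁆ L') : UHat L →+* UHat L' :=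
  PowerSeries.map (UniversalEnvelopingAlgebra.lift ℂ
    ((UniversalEnvelopingAlgebra.ι ℂ (L := L')).comp f)).toRingHom

end Completion

/-! ## Holomorphic maps with values in completions

A map with values in a degree completion is a sequence of maps, each with values in a
finite-dimensional space; holomorphy and derivatives are tested on linear functionals. -/

section Holomorphy

variable {n : ℕ} {V : Type*} [AddCommGroup V] [Module ℂ V]

/-- Every component of `f : S → V^ℕ` is holomorphic on (the open set) `S ⊆ ℂ^n`. -/
def IsHol (S : Set (Fin n → ℂ)) (f : S → ℕ → V) : Prop :=
  ∀ (d : ℕ) (φ : V →ₗ[ℂ] ℂ),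
    DifferentiableOn ℂ (Function.extend Subtype.val (fun w : S => φ (f w d)) 0) S

/-- `∂f/∂z_i = f'` on (the open set) `S ⊆ ℂ^n`. -/
def HasPartial (S : Set (Fin n → ℂ)) (i : Fin n) (f f' : S → ℕ → V) : Prop :=
  ∀ (d : ℕ) (φ : V →ₗ[ℂ] ℂ) (z : S),
    HasDerivAt (fun h : ℂ => Function.extend Subtype.val (fun w : S => φ (f w d)) 0
      (z.1 + Pi.single i h)) (φ (f' z d)) 0

end Holomorphy

/-- The sequence of homogeneous components of an element of the completed enveloping algebra. -/
def useq {L : Type*} [LieRing L] [LieAlgebra ℂ L] (u : UHat L) (d : ℕ) :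
    UniversalEnvelopingAlgebra ℂ L := PowerSeries.coeff d u

/-! ## Configuration spaces of an elliptic curve -/

section Configurations

variable (n : ℕ) (τ : UpperHalfPlane)

/-- `Λ_τ = ℤ + ℤτ`. -/
def lattice : AddSubgroup ℂ := AddSubgroup.closure {1, (τ : ℂ)}

/-- `E_τ = ℂ / Λ_τ`, with the quotient topology. -/
abbrev EllCurve : Type := ℂ ⧸ lattice τ

/-- `ℂ^n - Diag_{n,τ}`. -/
def dom : Set (Fin n → ℂ) := {z | ∀ i j, i ≠ j → z i - z j ∉ lattice τ}

/-- `C(E_τ, n) = E_τ^n - {diagonals}`. -/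
abbrev Conf : Type := {p : Fin n → EllCurve τ // Function.Injective p}

/-- The diagonal translation action of `E_τ` on `C(E_τ, n)`. -/
instance : AddAction (EllCurve τ) (Conf n τ) where
  vadd e p := ⟨fun i => e + p.1 i, fun _ _ h => p.2 (add_left_cancel h)⟩
  zero_vadd p := Subtype.ext (funext fun i => zero_add (p.1 i))
  add_vadd e e' p := Subtype.ext (funext fun i => add_assoc e e' (p.1 i))

/-- The reduced configuration space `C̄(E_τ, n) = C(E_τ, n) / E_τ`. -/
abbrev RedConf : Type := Quotient (AddAction.orbitRel (EllCurve τ) (Conf n τ))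

/-- The projection `ℂ^n - Diag_{n,τ} → C(E_τ, n)`. -/
def toConf (z : dom n τ) : Conf n τ :=
  ⟨fun i => (QuotientAddGroup.mk (z.1 i) : EllCurve τ), fun i j h => by
    by_contra hij
    have h' := (QuotientAddGroup.eq).1 h
    refine z.2 j i (Ne.symm hij) ?_
    rwa [sub_eq_neg_add]⟩

/-- The projection `C(E_τ, n) → C̄(E_τ, n)`. -/
def confToRed (p : Conf n τ) : RedConf n τ := Quotient.mk _ p

/-- The projection `ℂ^n - Diag_{n,τ} → C̄(E_τ, n)`. -/
def toRedConf (z : dom n τ) : RedConf n τ := confToRed n τ (toConf n τ z)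

end Configurations

/-! ## Bundles and connections

Let `p : ℂ^n - Diag_{n,τ} → B` be one of the two projections above.  Functions and forms
on open subsets of `B` are described through their pull-backs under `p`. -/

section Bundles

variable {n : ℕ} {τ : UpperHalfPlane} {B : Type} [TopologicalSpace B]

/-- The preimage of `U` in `ℂ^n`. -/
def preim (p : dom n τ → B) (U : TopologicalSpace.Opens B) : Set (Fin n → ℂ) :=
  {z | ∃ h : z ∈ dom n τ, p ⟨z, h⟩ ∈ U}

/-- The projection `p : preim p U → U`. -/
def pt (p : dom n τ → B) (U : TopologicalSpace.Opens B) (z : preim p U) : U :=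
  ⟨p ⟨z.1, z.2.choose⟩, z.2.choose_spec⟩

/-- The constant vector field `v` on `ℂ^n` is tangent to the fibres of `p`. -/
def TangentToFibres (p : dom n τ → B) (v : Fin n → ℂ) : Prop :=
  ∀ (z : dom n τ) (u : ℂ), ∃ h : z.1 + u • v ∈ dom n τ, p ⟨z.1 + u • v, h⟩ = p z

variable {L : Type} [LieRing L] [LieAlgebra ℂ L]

/-- A holomorphic 1-form on `U ⊆ B` with values in the completion of `L`: its pull-back to `ℂ^n` is
`∑ i, α_i dz_i`, where the `α_i` are holomorphic and constant on the fibres of `p`, and it vanishes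
on the vectors tangent to the fibres of `p`. -/
@[ext]
structure Form (gr : ℕ → Submodule ℂ L) (p : dom n τ → B) (U : TopologicalSpace.Opens B) where
  coeff : Fin n → U → Compl gr
  hol : ∀ i, IsHol (preim p U) (fun z => (coeff i (pt p U z)).seq)
  horizontal : ∀ v, TangentToFibres p v → ∀ b, ∑ i, v i • coeff i b = 0

/-- Factors of automorphy: `m v g` prescribes `f(z + v) = g f(z)`. -/
abbrev Automorphy (n : ℕ) (L : Type) [LieRing L] [LieAlgebra ℂ L] : Type :=
  (Fin n → ℂ) → UHat L → Prop

/-- A section over `U` of the principal `exp(L^)`-bundle on `B` with factors of automorphy `m`: a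
holomorphic map `f : p⁻¹(U) → exp(L^)` with `f(z + v) = g f(z)` whenever `m v g`.
The group acts on sections by right multiplication. -/
structure BundleSection (gr : ℕ → Submodule ℂ L) (p : dom n τ → B) (m : Automorphy n L)
    (U : TopologicalSpace.Opens B) where
  val : preim p U → UHat L
  mem_exp : ∀ z, val z ∈ ExpGroup gr
  hol : IsHol (preim p U) (fun z => useq (val z))
  equivariant : ∀ v g, m v g → ∀ z z' : preim p U, z'.1 = z.1 + v → val z' = g * val z

/-- A holomorphic connection on the principal `exp(L^)`-bundle on `B` with factors of automorphy
`m`.  It assigns to every local section `s` the 1-form `ω(s) = s⁻¹ ∇s` (the pull-back under `s` of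
the connection form), compatibly with restrictions, and such that
`ω(s g) = g⁻¹ ω(s) g + g⁻¹ dg`. -/
@[ext]
structure Connection (gr : ℕ → Submodule ℂ L) (p : dom n τ → B) (m : Automorphy n L) where
  form : ∀ U : TopologicalSpace.Opens B, BundleSection gr p m U → Form gr p U
  restrict : ∀ (U V : TopologicalSpace.Opens B) (hVU : ∀ b ∈ V, b ∈ U)
    (s : BundleSection gr p m U) (s' : BundleSection gr p m V),
    (∀ (z : preim p U) (z' : preim p V), z.1 = z'.1 → s'.val z' = s.val z) →
    ∀ (i : Fin n) (b : V), (form V s').coeff i b = (form U s).coeff i ⟨b.1, hVU b.1 b.2⟩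
  gauge : ∀ (U : TopologicalSpace.Opens B) (s s' : BundleSection gr p m U) (g : U → UHat L),
    (∀ b, g b ∈ ExpGroup gr) → IsHol (preim p U) (fun z => useq (g (pt p U z))) →
    (∀ z, s'.val z = s.val z * g (pt p U z)) →
    ∀ i, HasPartial (preim p U) i (fun z => useq (g (pt p U z)))
      (fun z => useq (g (pt p U z) * toU ((form U s').coeff i (pt p U z)).seq
        - toU ((form U s).coeff i (pt p U z)).seq * g (pt p U z)))

variable {gr : ℕ → Submodule ℂ L} {p : dom n τ → B} {m : Automorphy n L}

/-- `∇` is flat: `∂_i α_j - ∂_j α_i + [α_i, α_j] = 0` for `∑ i, α_i dz_i = ω(s)`, for every local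
section `s`. -/
def Connection.IsFlat [SetLike.GradedBracket gr] (D : Connection gr p m) : Prop :=
  ∀ (U : TopologicalSpace.Opens B) (s : BundleSection gr p m U),
    ∃ dα : Fin n → Fin n → preim p U → Compl gr,
      (∀ i j, HasPartial (preim p U) i (fun z => ((D.form U s).coeff j (pt p U z)).seq)
        (fun z => (dα i j z).seq)) ∧
      ∀ i j z, dα i j z - dα j i z +
        ⁅(D.form U s).coeff i (pt p U z), (D.form U s).coeff j (pt p U z)⁆ = 0

/-- `∇ = d - ∑ i, K_i dz_i`, that is `∂_i s - K_i s = s ω(s)_i` for every local section `s`. -/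
def Connection.IsGivenBy (D : Connection gr p m) (K : Fin n → dom n τ → ℕ → L) : Prop :=
  ∀ (U : TopologicalSpace.Opens B) (s : BundleSection gr p m U) (i : Fin n),
    HasPartial (preim p U) i (fun z => useq (s.val z))
      (fun z => useq (toU (K i ⟨z.1, z.2.choose⟩) * s.val z
        + s.val z * toU ((D.form U s).coeff i (pt p U z)).seq))

/-- `∇` is `S_n`-invariant, where `σ ∈ S_n` acts on `ℂ^n` by `(σ z)_i = z_{σ⁻¹ i}`, on `L` by
`act σ`, and on sections `s` and forms by transport of structure: `(σ s)(σ z) = σ (s z)`, and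
`σ (∑ α_i dz_i)` has coefficient `σ (α_i z)` of `dz_{σ i}` at `σ z`. -/
def Connection.IsSymmInvariant (D : Connection gr p m)
    (act : Equiv.Perm (Fin n) → L →ₗ⁅ℂ⁆ L) : Prop :=
  ∀ (σ : Equiv.Perm (Fin n)) (U V : TopologicalSpace.Opens B)
    (s : BundleSection gr p m U) (s' : BundleSection gr p m V),
    (∀ (z : preim p U) (z' : preim p V), z'.1 = z.1 ∘ σ.symm →
      s'.val z' = mapU (act σ) (s.val z)) →
    ∀ (z : preim p U) (z' : preim p V), z'.1 = z.1 ∘ σ.symm → ∀ (i : Fin n) (d : ℕ),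
      ((D.form V s').coeff (σ i) (pt p V z')).seq d =
        act σ (((D.form U s).coeff i (pt p U z)).seq d)

/-- `∇'` is induced from `∇` by the change of structure group `exp(L^) → exp(L'^)`. -/
def IsInduced {L' : Type} [LieRing L'] [LieAlgebra ℂ L'] {gr' : ℕ → Submodule ℂ L'}
    {m' : Automorphy n L'} (f : L →ₗ⁅ℂ⁆ L') (D : Connection gr p m) (D' : Connection gr' p m') :
    Prop :=
  ∀ (U : TopologicalSpace.Opens B) (s : BundleSection gr p m U) (s' : BundleSection gr' p m' U),
    (∀ z, s'.val z = mapU f (s.val z)) →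
    ∀ (i : Fin n) (b : U) (d : ℕ),
      ((D'.form U s').coeff i b).seq d = f (((D.form U s).coeff i b).seq d)

/-- `∇` is the pull-back of `∇'` under `q : B → B'`: if `s` is the pull-back of `s'`, then
`ω(s)` is the pull-back of `ω'(s')`. -/
def IsPullback {B' : Type} [TopologicalSpace B'] {p' : dom n τ → B'} {m' : Automorphy n L}
    (q : B → B') (D : Connection gr p m) (D' : Connection gr p' m') : Prop :=
  ∀ (U : TopologicalSpace.Opens B) (V : TopologicalSpace.Opens B') (hUV : ∀ b ∈ U, q b ∈ V)
    (s : BundleSection gr p m U) (s' : BundleSection gr p' m' V),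
    (∀ (z : preim p U) (z' : preim p' V), z.1 = z'.1 → s.val z = s'.val z') →
    ∀ (i : Fin n) (b : U), (D.form U s).coeff i b = (D'.form V s').coeff i ⟨q b.1, hUV b.1 b.2⟩

end Bundles

/-! ## The universal KZB connection -/

section KZBConnection

variable {n : ℕ} (τ : UpperHalfPlane)

/-- The theta function `θ(z|τ)`, normalised by `θ'(0|τ) = 1`:
`θ(z|τ) = (sin πz / π) ∏_{m ≥ 1} (1 - q^m e^{2πiz}) (1 - q^m e^{-2πiz}) / (1 - q^m)^2`,
`q = e^{2πiτ}`.  It is the holomorphic function with zero set `Λ_τ`,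
`θ(z+1) = -θ(z) = θ(-z)`, `θ(z+τ) = -e^{-πiτ} e^{-2πiz} θ(z)`, `θ'(0) = 1`. -/
def theta (z : ℂ) : ℂ :=
  Complex.sin (Real.pi * z) / Real.pi *
    ∏' m : ℕ,
      (1 - Complex.exp (2 * Real.pi * Complex.I * τ) ^ (m + 1) *
        Complex.exp (2 * Real.pi * Complex.I * z)) *
      (1 - Complex.exp (2 * Real.pi * Complex.I * τ) ^ (m + 1) *
        Complex.exp (-(2 * Real.pi * Complex.I * z))) /
      (1 - Complex.exp (2 * Real.pi * Complex.I * τ) ^ (m + 1)) ^ 2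

/-- The expansion of `θ(z + x|τ)` in powers of `x`. -/
def thetaTaylor (z : ℂ) : PowerSeries ℂ :=
  PowerSeries.mk fun m => iteratedDeriv m (theta τ) z / (m.factorial : ℂ)

/-- The expansion of `θ(x|τ) / x` in powers of `x`. -/
def thetaDivX : PowerSeries ℂ :=
  PowerSeries.mk fun m => PowerSeries.coeff (m + 1) (thetaTaylor τ 0)

/-- The expansion in powers of `x`, for `z ∉ Λ_τ`, of
`k(z, x|τ) = θ(z + x|τ) / (θ(z|τ) θ(x|τ)) - 1 / x`.
As `x k(z, x|τ) = θ(z|τ)⁻¹ θ(z + x|τ) (θ(x|τ) / x)⁻¹ - 1`, its coefficients are the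
coefficients of positive degree of `θ(z|τ)⁻¹ θ(z + x|τ) (θ(x|τ) / x)⁻¹`, shifted by one. -/
def kernelK (z : ℂ) : PowerSeries ℂ :=
  PowerSeries.mk fun m =>
    PowerSeries.coeff (m + 1) ((theta τ z)⁻¹ • (thetaTaylor τ z * (thetaDivX τ)⁻¹))

/-- `x_i`, `y_i`, `t_{ij}` in the degree completion of `𝔱_{1,n}`. -/
def X (i : Fin n) : Compl (tGr n) := Compl.of 1 (tx i) (Homog.x i)
def Y (i : Fin n) : Compl (tGr n) := Compl.of 1 (ty i) (Homog.y i)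
def Tij (i j : Fin n) : Compl (tGr n) := Compl.of 2 (tt i j) (Homog.t i j)

/-- `K_{ij}(z|τ) = k(z, ad x_i|τ)(t_{ij})`. -/
def Kij (i j : Fin n) (z : ℂ) : Compl (tGr n) := Compl.evalAd (kernelK τ z) (X i) (Tij i j)

/-- `K_i(z|τ) = -y_i + ∑_{j ≠ i} K_{ij}(z_i - z_j|τ)`. -/
def K (i : Fin n) (z : dom n τ) : Compl (tGr n) :=
  -Y i + ∑ j ∈ Finset.univ.filter (fun j => j ≠ i), Kij τ i j (z.1 i - z.1 j)

/-- The image `K̄_i(z|τ)` of `K_i(z|τ)` in the degree completion of `𝔱̄_{1,n}`. -/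
def KBar (i : Fin n) (z : dom n τ) (d : ℕ) : TBar n := toBar n ((K τ i z).seq d)

variable (n)

/-- `P_{τ,n}`: `f(z + δ_i) = f(z)` and `f(z + τ δ_i) = e^{-2πi x_i} f(z)`. -/
def mP : Automorphy n (T n) := fun v g => ∃ i : Fin n,
  (v = Pi.single i 1 ∧ g = 1) ∨
  (v = Pi.single i (τ : ℂ) ∧ g = expU ((-(2 * Real.pi * Complex.I : ℂ)) • (X i).seq))

/-- `P̃_{τ,n}`: `f(z + δ_i) = f(z)` and `f(z + τ δ_i) = e^{-2πi x̄_i} f(z)`. -/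
def mPTilde : Automorphy n (TBar n) := fun v g => ∃ i : Fin n,
  (v = Pi.single i 1 ∧ g = 1) ∨
  (v = Pi.single i (τ : ℂ) ∧
    g = expU ((-(2 * Real.pi * Complex.I : ℂ)) • fun d => toBar n ((X i).seq d)))

/-- `P̄_{τ,n}`: the same conditions as for `P̃_{τ,n}`, and `f(z + u ∑_i δ_i) = f(z)`. -/
def mPBar : Automorphy n (TBar n) := fun v g =>
  mPTilde n τ v g ∨ ∃ u : ℂ, v = (fun _ => u) ∧ g = 1

end KZBConnection

end KZB

end

set_option linter.unusedSectionVars false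
noncomputable section

/-! The curvature of `d - ∑ K_i dz_i` vanishes for two separate reasons. The symmetry `k(-z, -x) =
-k(z, x)` and the relation `[x_i + x_j, t_ij] = 0` give `K_ij(z) = -K_ji(-z)`, which makes
`∂K_j/∂z_i` symmetric in `i, j` (`dK_symm`). The bracket `[K_i, K_j]` is zero by itself (`lie_K_K`).
From degree 4 on, the terms of `[K_ij, K_ji]` cancel by antisymmetry, and all others can be written
as a sum over a third index `k` of a polynomial in the commuting derivations `ad x_i`, `ad x_j`,
applied to the single element `[t_ij, t_jk]`. That polynomial is `fayTerm`, and it vanishes because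
of Fay's trisecant identity for `θ` (`fay_identity`), rewritten as an identity of power series in
`kernelG_fay`.

Equivariance comes from `x k(z, x) + 1` being multiplied by `e^{-2πix}` when `z` moves by `τ`. Thus
`k` picks up an extra `(e^{-2πix} - 1)/x`, and this is what `e^{-2πi ad x_j}` produces from `-y_i`,
since `[x_j, y_i]` is `t_ij`, or `-∑ t_il` when `i = j`.

The connection sends a section `s` to `s⁻¹(∂_i - K_i)s`. This lies in the completed Lie algebra,
since for `s = e^a` it is a combination of power series in `ad a` (`exists_form`). It descends to
the base by equivariance of `s` and `K`. Uniqueness, flatness, invariance, and compatibility with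
change of group and pull-back all follow from the equation `∂_i s = K_i s + s ω_i`, which determines
`ω_i`; for this, homogeneous elements of the Lie algebra must inject into the enveloping algebra,
which an explicit representation shows (`goodGrading_tGr`, `goodGrading_barGr`). The three bundles
are treated together through `DescentData`. On the reduced configuration space two more facts enter:
`K_i` depends only on differences of coordinates, and `∑ K_i = -∑ y_i` dies in the quotient. -/

namespace KZB

/-! ### Homogeneous elements inject into the enveloping algebra. -/

section FaithfulRepresentation

attribute [local instance] LieRing.ofAssociativeRing

variable {n : ℕ} {M : Type} [LieRing M] [LieAlgebra ℂ M]

/-- The degree of a generator. -/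
def Gen.deg : Gen n → ℕ
  | .x _ => 1
  | .y _ => 1
  | .t _ _ => 2

/-- The endomorphism `(v, c) ↦ (⁅a, v⁆ + c • b, 0)` of `M × ℂ`. -/
def affineEnd (a b : M) : Module.End ℂ (M × ℂ) :=
  LinearMap.inl ℂ M ℂ ∘ₗ
    ((LieAlgebra.ad ℂ M a : M →ₗ[ℂ] M) ∘ₗ LinearMap.fst ℂ M ℂ +
      (LinearMap.toSpanSingleton ℂ M b) ∘ₗ LinearMap.snd ℂ M ℂ)

theorem affineEnd_apply (a b : M) (w : M × ℂ) : affineEnd a b w = (⁅a, w.1⁆ + w.2 • b, 0) := by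
  simp [affineEnd]

/-- The adjoint representation of a free Lie algebra on a graded quotient extended by the
degree derivation. -/
def degreeRep (π : FreeT n →ₗ⁅ℂ⁆ M) : FreeT n →ₗ⁅ℂ⁆ Module.End ℂ (M × ℂ) :=
  FreeLieAlgebra.lift ℂ fun g =>
    affineEnd (π (FreeLieAlgebra.of ℂ g)) ((g.deg : ℂ) • π (FreeLieAlgebra.of ℂ g))

/-- `degreeRep` acts on `a` as on an element of degree `d`. -/
def ActsInDegree (π : FreeT n →ₗ⁅ℂ⁆ M) (d : ℕ) (a : FreeT n) : Prop :=
  degreeRep π a = affineEnd (π a) ((d : ℂ) • π a)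

namespace ActsInDegree

variable {π : FreeT n →ₗ⁅ℂ⁆ M} {d e : ℕ} {a b : FreeT n}

theorem of_gen (g : Gen n) : ActsInDegree π g.deg (FreeLieAlgebra.of ℂ g) := by
  simp [ActsInDegree, degreeRep]

theorem fx (i : Fin n) : ActsInDegree π 1 (fx i) := of_gen (Gen.x i)
theorem fy (i : Fin n) : ActsInDegree π 1 (fy i) := of_gen (Gen.y i)
theorem ft (i j : Fin n) : ActsInDegree π 2 (ft i j) := of_gen (Gen.t i j)

theorem zero : ActsInDegree π d 0 := by
  refine LinearMap.ext fun w => ?_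
  simp [affineEnd_apply, Prod.zero_eq_mk]

theorem add (ha : ActsInDegree π d a) (hb : ActsInDegree π d b) : ActsInDegree π d (a + b) := by
  refine LinearMap.ext fun w => ?_
  rw [map_add, ha, hb, LinearMap.add_apply]
  simp only [affineEnd_apply, map_add, add_lie, smul_add, Prod.mk_add_mk, add_zero]
  congr 1
  abel

theorem smul (c : ℂ) (ha : ActsInDegree π d a) : ActsInDegree π d (c • a) := by
  refine LinearMap.ext fun w => ?_
  rw [map_smul, ha, LinearMap.smul_apply]
  simp only [affineEnd_apply, map_smul, smul_lie, Prod.smul_mk, smul_add, smul_zero]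
  congr 2
  simp only [smul_smul]
  congr 1
  ring

theorem sub (ha : ActsInDegree π d a) (hb : ActsInDegree π d b) : ActsInDegree π d (a - b) := by
  rw [sub_eq_add_neg, ← neg_one_smul ℂ b]
  exact ha.add (hb.smul _)

theorem sum {ι : Type*} (s : Finset ι) (f : ι → FreeT n) (h : ∀ i ∈ s, ActsInDegree π d (f i)) :
    ActsInDegree π d (∑ i ∈ s, f i) :=
  Finset.sum_induction f _ (fun _ _ => add) zero h

/-- Leibniz rule of the degree derivation: on the vector `(0, 1)` the commutator gives `e[a, b] -
d[b, a] = (d + e)[a, b]`. -/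
theorem lie (ha : ActsInDegree π d a) (hb : ActsInDegree π e b) :
    ActsInDegree π (d + e) ⁅a, b⁆ := by
  refine LinearMap.ext fun w => ?_
  rw [LieHom.map_lie, ha, hb, LieRing.of_associative_ring_bracket]
  simp only [LinearMap.sub_apply, Module.End.mul_apply, affineEnd_apply, LieHom.map_lie, zero_smul,
    add_zero, Prod.mk_sub_mk, sub_self, lie_add, lie_smul, lie_lie, Nat.cast_add]
  congr 1
  rw [← lie_skew (π a) (π b)]
  module

/-- The defining relations are homogeneous, so the representation kills every relator that `π`
kills. -/
theorem relator {a : FreeT n} (h : Relator n a) : ∃ d, ActsInDegree π d a := by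
  cases h with
  | t_self i => exact ⟨2, ft _ _⟩
  | t_symm i j h => exact ⟨2, (ft _ _).sub (ft _ _)⟩
  | t_add i j k => exact ⟨_, (ft _ _).lie ((ft _ _).add (ft _ _))⟩
  | t_t i j k l => exact ⟨_, (ft _ _).lie (ft _ _)⟩
  | x_y i j => exact ⟨2, ((fx _).lie (fy _)).sub (ft _ _)⟩
  | x_x i j => exact ⟨_, (fx _).lie (fx _)⟩
  | y_y i j => exact ⟨_, (fy _).lie (fy _)⟩
  | x_y_self i => exact ⟨2, ((fx _).lie (fy _)).add (sum _ _ fun _ _ => ft _ _)⟩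
  | x_t i j k => exact ⟨_, (fx _).lie (ft _ _)⟩
  | y_t i j k => exact ⟨_, (fy _).lie (ft _ _)⟩
  | xx_t i j => exact ⟨_, ((fx _).add (fx _)).lie (ft _ _)⟩
  | yy_t i j => exact ⟨_, ((fy _).add (fy _)).lie (ft _ _)⟩

theorem map_eq_zero (ha : ActsInDegree π d a) (h : π a = 0) : degreeRep π a = 0 := by
  rw [ha, h]
  refine LinearMap.ext fun w => ?_
  simp [affineEnd_apply]

end ActsInDegree

/-- The map induced on a quotient by a Lie algebra morphism that vanishes on the ideal. -/
def quotLift {L L' : Type*} [LieRing L] [LieAlgebra ℂ L] [LieRing L'] [LieAlgebra ℂ L']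
    (f : L →ₗ⁅ℂ⁆ L') (I : LieIdeal ℂ L) (h : ∀ a ∈ I, f a = 0) : L ⧸ I →ₗ⁅ℂ⁆ L' where
  toLinearMap := Submodule.liftQ I.toSubmodule (f : L →ₗ[ℂ] L') h
  map_lie' := by
    intro a b
    induction a using Submodule.Quotient.induction_on with | _ a => ?_
    induction b using Submodule.Quotient.induction_on with | _ b => ?_
    exact f.map_lie a b

/-- The projection `FreeT n → 𝔱_{1,n}`. -/
def toT (n : ℕ) : FreeT n →ₗ⁅ℂ⁆ T n where
  toLinearMap := (relIdeal n).toSubmodule.mkQ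
  map_lie' := by
    intro a b
    exact LieSubmodule.Quotient.mk_bracket (relIdeal n) a b

theorem toT_eq_zero {a : FreeT n} : toT n a = 0 ↔ a ∈ relIdeal n :=
  Submodule.Quotient.mk_eq_zero (relIdeal n).toSubmodule

theorem toT_relator {a : FreeT n} (h : Relator n a) : toT n a = 0 :=
  toT_eq_zero.2 (LieSubmodule.subset_lieSpan h)

theorem toBar_eq_zero {a : T n} : toBar n a = 0 ↔ a ∈ centralIdeal n :=
  Submodule.Quotient.mk_eq_zero (centralIdeal n).toSubmodule

variable (π : T n →ₗ⁅ℂ⁆ M)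

theorem degreeRep_relIdeal (a : FreeT n) (ha : a ∈ relIdeal n) :
    degreeRep (π.comp (toT n)) a = 0 := by
  have : relIdeal n ≤ (degreeRep (π.comp (toT n))).ker := by
    refine LieSubmodule.lieSpan_le.2 fun a ha => ?_
    obtain ⟨d, hd⟩ := ActsInDegree.relator (π := π.comp (toT n)) ha
    refine LieHom.mem_ker.2 (hd.map_eq_zero ?_)
    rw [LieHom.comp_apply, toT_relator ha, map_zero]
  exact LieHom.mem_ker.1 (this ha)

/-- The representation of `𝔱_{1,n}` on `M × ℂ` induced by `degreeRep`. -/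
def degreeRepT : T n →ₗ⁅ℂ⁆ Module.End ℂ (M × ℂ) :=
  quotLift (degreeRep (π.comp (toT n))) (relIdeal n) (degreeRep_relIdeal π)

theorem degreeRepT_homog {d : ℕ} {a : T n} (h : Homog n d a) :
    degreeRepT π a = affineEnd (π a) ((d : ℂ) • π a) := by
  -- Homogeneity is defined inductively in the quotient; each constructor lifts to the free Lie
  -- algebra.
  have key : ∃ b, toT n b = a ∧ ActsInDegree (π.comp (toT n)) d b := by
    induction h with
    | x i => exact ⟨fx i, rfl, .fx i⟩
    | y i => exact ⟨fy i, rfl, .fy i⟩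
    | t i j => exact ⟨ft i j, rfl, .ft i j⟩
    | zero d => exact ⟨0, map_zero _, .zero⟩
    | add _ _ h h' =>
      obtain ⟨b, rfl, hb⟩ := h
      obtain ⟨b', rfl, hb'⟩ := h'
      exact ⟨b + b', map_add _ _ _, hb.add hb'⟩
    | smul c _ h =>
      obtain ⟨b, rfl, hb⟩ := h
      exact ⟨c • b, map_smul _ _ _, hb.smul c⟩
    | lie _ _ h h' =>
      obtain ⟨b, rfl, hb⟩ := h
      obtain ⟨b', rfl, hb'⟩ := h'
      exact ⟨⁅b, b'⁆, LieHom.map_lie _ _ _, hb.lie hb'⟩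
  obtain ⟨b, rfl, hb⟩ := key
  exact hb

/-- `gr` is a grading by finite-dimensional subspaces in positive degrees, and homogeneous elements
inject into the enveloping algebra. -/
structure GoodGrading {L : Type*} [LieRing L] [LieAlgebra ℂ L] (gr : ℕ → Submodule ℂ L) :
    Prop where
  finite : ∀ d, Module.Finite ℂ (gr d)
  zero : gr 0 = ⊥
  ι_injective : ∀ d, ∀ a ∈ gr d, UniversalEnvelopingAlgebra.ι ℂ a = 0 → a = 0

/-- Strong induction on the degree: the component `d` lies in the span of the generators and of
brackets of components of degree `< d`. A bracket with a factor of degree 0 vanishes because the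
grading is positive. -/
theorem finite_tGr (n d : ℕ) : Module.Finite ℂ (tGr n d) := by
  induction d using Nat.strong_induction_on with | _ d ih => ?_
  set W : Submodule ℂ (T n) := Submodule.span ℂ (Set.range tx) ⊔ Submodule.span ℂ (Set.range ty) ⊔
    Submodule.span ℂ (Set.range fun p : Fin n × Fin n => tt p.1 p.2) ⊔
    ⨆ p : Fin d × Fin d, Submodule.map₂ (LieModule.toEnd ℂ (T n) (T n)).toLinearMap
      (tGr n p.1) (tGr n p.2) with hW
  have hfin : Module.Finite ℂ W := by
    have : ∀ p : Fin d × Fin d, Module.Finite ℂ (Submodule.map₂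
        (LieModule.toEnd ℂ (T n) (T n)).toLinearMap (tGr n p.1) (tGr n p.2)) := fun p => by
      have h1 := ih p.1 p.1.2
      have h2 := ih p.2 p.2.2
      exact Module.Finite.iff_fg.2
        (Submodule.FG.map₂ _ (Module.Finite.iff_fg.1 h1) (Module.Finite.iff_fg.1 h2))
    have h1 : Module.Finite ℂ (Submodule.span ℂ (Set.range (tx : Fin n → T n))) :=
      .span_of_finite ℂ (Set.finite_range _)
    have h2 : Module.Finite ℂ (Submodule.span ℂ (Set.range (ty : Fin n → T n))) :=
      .span_of_finite ℂ (Set.finite_range _)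
    have h3 : Module.Finite ℂ (Submodule.span ℂ
        (Set.range fun p : Fin n × Fin n => (tt p.1 p.2 : T n))) :=
      .span_of_finite ℂ (Set.finite_range _)
    infer_instance
  have key : ∀ e a, Homog n e a → e = d → a ∈ W := by
    intro e a h
    induction h with
    | x i =>
      exact fun _ => Submodule.mem_sup_left (Submodule.mem_sup_left (Submodule.mem_sup_left
        (Submodule.subset_span ⟨i, rfl⟩)))
    | y i =>
      exact fun _ => Submodule.mem_sup_left (Submodule.mem_sup_left (Submodule.mem_sup_right
        (Submodule.subset_span ⟨i, rfl⟩)))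
    | t i j =>
      exact fun _ => Submodule.mem_sup_left (Submodule.mem_sup_right
        (Submodule.subset_span ⟨(i, j), rfl⟩))
    | zero => exact fun _ => W.zero_mem
    | add _ _ h h' => exact fun e => W.add_mem (h e) (h' e)
    | smul c _ h => exact fun e => W.smul_mem c (h e)
    | @lie p q a b ha hb _ _ =>
      intro e
      have hz : ∀ a, Homog n 0 a → a = 0 := fun a h => by
        have : a ∈ tGr n 0 := h
        rwa [tGr_zero, Submodule.mem_bot] at this
      rcases Nat.eq_zero_or_pos p with rfl | hp
      · rw [hz a ha, zero_lie]; exact W.zero_mem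
      rcases Nat.eq_zero_or_pos q with rfl | hq
      · rw [hz b hb, lie_zero]; exact W.zero_mem
      refine Submodule.mem_sup_right (Submodule.mem_iSup_of_mem
        ((⟨p, by omega⟩ : Fin d), (⟨q, by omega⟩ : Fin d)) ?_)
      exact Submodule.apply_mem_map₂ _ ha hb
  exact Submodule.finiteDimensional_of_le (S₂ := W) fun a ha => key d a ha rfl

/-- An element killed by `ι` is killed by every representation. In `degreeRepT`, an element `a` of
degree `d` sends `(0, 1)` to `(d a, 0)`, and `d ≠ 0`; so no Poincaré–Birkhoff–Witt theorem is
needed. -/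
theorem goodGrading_tGr (n : ℕ) : GoodGrading (tGr n) where
  finite := finite_tGr n
  zero := tGr_zero n
  ι_injective d a ha h := by
    rcases Nat.eq_zero_or_pos d with rfl | hd
    · rwa [tGr_zero, Submodule.mem_bot] at ha
    have h1 := UniversalEnvelopingAlgebra.lift_ι_apply ℂ (degreeRepT (LieHom.id : T n →ₗ⁅ℂ⁆ T n)) a
    rw [h, map_zero, degreeRepT_homog _ ha] at h1
    have h2 := congrArg (fun F : Module.End ℂ (T n × ℂ) => (F (0, 1)).1) h1
    simp only [LinearMap.zero_apply, affineEnd_apply, lie_zero, zero_add, one_smul, Prod.fst_zero,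
      LieHom.id_apply] at h2
    exact (smul_eq_zero.1 h2.symm).resolve_left (Nat.cast_ne_zero.2 hd.ne')

/-- The generators `∑ x_i`, `∑ y_i` are homogeneous and vanish in `𝔱̄_{1,n}`, so with `M = 𝔱̄_{1,n}`
they act by zero and the representation factors through the quotient. -/
theorem degreeRepT_centralIdeal (a : T n) (ha : a ∈ centralIdeal n) :
    degreeRepT (toBar n) a = 0 := by
  have : centralIdeal n ≤ (degreeRepT (toBar n)).ker := by
    refine LieSubmodule.lieSpan_le.2 fun a ha => LieHom.mem_ker.2 ?_
    have h0 : toBar n a = 0 := toBar_eq_zero.2 (LieSubmodule.subset_lieSpan ha)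
    have h1 : Homog n 1 a := by
      rcases ha with rfl | rfl
      · exact Submodule.sum_mem (tGr n 1) fun i _ => Homog.x i
      · exact Submodule.sum_mem (tGr n 1) fun i _ => Homog.y i
    rw [degreeRepT_homog _ h1, h0]
    refine LinearMap.ext fun w => ?_
    simp [affineEnd_apply]
  exact LieHom.mem_ker.1 (this ha)

theorem goodGrading_barGr (n : ℕ) : GoodGrading (barGr n) where
  finite d := by
    have := finite_tGr n d
    exact Module.Finite.map _ _
  zero := by rw [barGr, tGr_zero, Submodule.map_bot]
  ι_injective d a ha h := by
    obtain ⟨a, ha, rfl⟩ := ha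
    rcases Nat.eq_zero_or_pos d with rfl | hd
    · rw [tGr_zero] at ha
      rw [(Submodule.mem_bot ℂ).1 ha, map_zero]
    have h1 := UniversalEnvelopingAlgebra.lift_ι_apply ℂ
      (quotLift (degreeRepT (toBar n)) (centralIdeal n) degreeRepT_centralIdeal) (toBar n a)
    have h3 : quotLift (degreeRepT (toBar n)) (centralIdeal n) degreeRepT_centralIdeal (toBar n a) =
      degreeRepT (toBar n) a := rfl
    rw [h3, show UniversalEnvelopingAlgebra.ι ℂ (toBar n a) = 0 from h, map_zero,
      degreeRepT_homog _ ha] at h1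
    have h2 := congrArg (fun F : Module.End ℂ (TBar n × ℂ) => (F (0, 1)).1) h1
    simp only [LinearMap.zero_apply, affineEnd_apply, lie_zero, zero_add, one_smul,
      Prod.fst_zero] at h2
    exact (smul_eq_zero.1 h2.symm).resolve_left (Nat.cast_ne_zero.2 hd.ne')

end FaithfulRepresentation

/-! ### Derivatives of holomorphic functions of several variables. -/

section ScalarHolomorphy

open Complex Metric Filter Topology

variable {E : Type*} [NormedAddCommGroup E] [NormedSpace ℂ E] [MeasurableSpace E] [BorelSpace E]
  [SecondCountableTopologyEither ℂ (E →L[ℂ] ℂ)]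

/-- Directional derivatives of a holomorphic function are holomorphic. -/
theorem differentiableOn_fderiv_apply [FiniteDimensional ℂ E] {f : E → ℂ} {S : Set E}
    (hS : IsOpen S) (hf : DifferentiableOn ℂ f S) (v : E) :
    DifferentiableOn ℂ (fun z => fderiv ℂ f z v) S := by
  intro z₀ hz₀
  refine DifferentiableAt.differentiableWithinAt ?_
  have hc : ContinuousAt f z₀ := (hf.differentiableAt (hS.mem_nhds hz₀)).continuousAt
  obtain ⟨ρ, hρ, hball⟩ : ∃ ρ > 0, ∀ w ∈ ball z₀ ρ, w ∈ S ∧ dist (f w) (f z₀) < 1 := by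
    have h : S ∩ f ⁻¹' ball (f z₀) 1 ∈ 𝓝 z₀ :=
      inter_mem (hS.mem_nhds hz₀) (hc (ball_mem_nhds (f z₀) one_pos))
    exact Metric.mem_nhds_iff.1 h
  -- The radius `ρ` is split into thirds: one for the base point, one for the displacement `ζ v`
  -- with `|ζ| ≤ r`, one for the ball on which the derivative is estimated. The `+ 1` covers `v =
  -- 0`.
  set r : ℝ := ρ / (3 * (‖v‖ + 1)) with hr
  have hv : 0 < ‖v‖ + 1 := by positivity
  have hr0 : 0 < r := by positivity
  have hrv : r * ‖v‖ ≤ ρ / 3 := by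
    rw [hr, div_mul_eq_mul_div, div_le_iff₀ (by positivity)]
    nlinarith [norm_nonneg v]
  have hmem : ∀ x ∈ ball z₀ (ρ / 3), ∀ ζ : ℂ, ‖ζ‖ ≤ r → dist (x + ζ • v) z₀ < 2 * (ρ / 3) := by
    intro x hx ζ hζ
    have h1 : dist (x + ζ • v) x ≤ ρ / 3 := by
      rw [dist_eq_norm, add_sub_cancel_left, norm_smul]
      exact (mul_le_mul_of_nonneg_right hζ (norm_nonneg v)).trans hrv
    have h2 : dist x z₀ < ρ / 3 := hx
    linarith [dist_triangle (x + ζ • v) x z₀]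
  have hmemS : ∀ x ∈ ball z₀ (ρ / 3), ∀ ζ : ℂ, ‖ζ‖ ≤ r → x + ζ • v ∈ S := fun x hx ζ hζ =>
    (hball _ (mem_ball.2 (by linarith [hmem x hx ζ hζ]))).1
  have hbound : ∀ x ∈ ball z₀ (ρ / 3), ∀ ζ : ℂ, ‖ζ‖ ≤ r →
      ‖fderiv ℂ f (x + ζ • v)‖ ≤ 2 / (ρ / 3) := by
    intro x hx ζ hζ
    have h0 := hmem x hx ζ hζ
    have hsub : ball (x + ζ • v) (ρ / 3) ⊆ ball z₀ ρ := ball_subset_ball' (by linarith)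
    refine norm_fderiv_le_div_of_mapsTo_ball
      (hf.mono fun w hw => (hball w (hsub hw)).1) (fun w hw => ?_) (by positivity)
    have h1 := (hball w (hsub hw)).2
    have h2 := (hball _ (hsub (mem_ball_self (by positivity)))).2
    rw [mem_closedBall]
    linarith [dist_triangle_right (f w) (f (x + ζ • v)) (f z₀)]
  have hcirc : ∀ t : ℝ, ‖circleMap 0 r t‖ ≤ r := fun t => by simp [abs_of_pos hr0]
  have hline : ∀ x : E, ∀ ζ : ℂ, HasDerivAt (fun ζ : ℂ => x + ζ • v) v ζ := fun x ζ => by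
    simpa using ((hasDerivAt_id ζ).smul_const v).const_add x
  -- Cauchy's formula on the complex line through `x` in direction `v` expresses the directional
  -- derivative through values of `f`. Differentiating under the integral then only requires a bound
  -- on the first derivative of `f`.
  have hcauchy : ∀ x ∈ ball z₀ (ρ / 3), fderiv ℂ f x v =
      (2 * Real.pi * I)⁻¹ • ∮ ζ in C(0, r), (1 / (ζ - 0) ^ 2) • f (x + ζ • v) := by
    intro x hx
    have hd : DifferentiableOn ℂ (fun ζ : ℂ => f (x + ζ • v)) (closedBall 0 r) := by
      intro ζ hζ
      have hζ' : ‖ζ‖ ≤ r := by simpa using hζ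
      exact ((hf.differentiableAt (hS.mem_nhds (hmemS x hx ζ hζ'))).hasFDerivAt.comp_hasDerivAt ζ
        (hline x ζ)).differentiableAt.differentiableWithinAt
    rw [hd.deriv_eq_smul_circleIntegral hr0, smul_smul,
      inv_mul_cancel₀ two_pi_I_ne_zero, one_smul]
    have h0 : HasFDerivAt f (fderiv ℂ f x) (x + (0 : ℂ) • v) := by
      rw [zero_smul, add_zero]
      have := hmemS x hx 0 (by simpa using hr0.le)
      rw [zero_smul, add_zero] at this
      exact (hf.differentiableAt (hS.mem_nhds this)).hasFDerivAt
    exact (h0.comp_hasDerivAt 0 (hline x 0)).deriv.symm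
  have hcontF : ∀ x ∈ ball z₀ (ρ / 3), Continuous fun t : ℝ =>
      deriv (circleMap 0 r) t • (1 / (circleMap 0 r t - 0) ^ 2) • f (x + circleMap 0 r t • v) := by
    intro x hx
    have hne : ∀ t : ℝ, circleMap 0 r t ≠ 0 := fun t => circleMap_ne_center hr0.ne'
    have h1 : Continuous fun t : ℝ => f (x + circleMap 0 r t • v) := by
      refine hf.continuousOn.comp_continuous (by fun_prop) fun t => hmemS x hx _ (hcirc t)
    simp only [deriv_circleMap, sub_zero, smul_eq_mul]
    refine Continuous.mul (by fun_prop) (Continuous.mul ?_ h1)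
    exact continuous_const.div (by fun_prop) fun t => pow_ne_zero 2 (hne t)
  have key := intervalIntegral.hasFDerivAt_integral_of_dominated_of_fderiv_le (𝕜 := ℂ)
    (μ := MeasureTheory.volume) (a := 0) (b := 2 * Real.pi) (x₀ := z₀) (s := ball z₀ (ρ / 3))
    (F := fun x t => deriv (circleMap 0 r) t •
      (1 / (circleMap 0 r t - 0) ^ 2) • f (x + circleMap 0 r t • v))
    (F' := fun x t => deriv (circleMap 0 r) t •
      (1 / (circleMap 0 r t - 0) ^ 2) • fderiv ℂ f (x + circleMap 0 r t • v))
    (bound := fun _ => r * (1 / r ^ 2 * (2 / (ρ / 3))))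
    (ball_mem_nhds _ (by positivity)) ?_ ?_ ?_ ?_ ?_ ?_
  · have h2 := key.const_smul ((2 * Real.pi * I)⁻¹ : ℂ)
    refine (h2.congr_of_eventuallyEq ?_).differentiableAt
    filter_upwards [ball_mem_nhds z₀ (show 0 < ρ / 3 by positivity)] with x hx
    exact hcauchy x hx
  · filter_upwards [ball_mem_nhds z₀ (show 0 < ρ / 3 by positivity)] with x hx
    exact (hcontF x hx).aestronglyMeasurable
  · exact (hcontF z₀ (mem_ball_self (by positivity))).intervalIntegrable _ _
  · refine Measurable.aestronglyMeasurable ?_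
    have h1 : Measurable fun t : ℝ => fderiv ℂ f (z₀ + circleMap 0 r t • v) :=
      (measurable_fderiv ℂ f).comp
        (show Continuous fun t : ℝ => z₀ + circleMap 0 r t • v by fun_prop).measurable
    simp only [deriv_circleMap]
    have h2 : Measurable (circleMap 0 r) := (continuous_circleMap 0 r).measurable
    fun_prop
  · refine .of_forall fun t _ x hx => ?_
    have h1 := hbound x hx (circleMap 0 r t) (hcirc t)
    simp only [norm_smul, deriv_circleMap, norm_mul, norm_circleMap_zero, norm_I, mul_one, norm_div,
      norm_one, norm_pow, sub_zero, abs_of_pos hr0]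
    gcongr
  · exact intervalIntegrable_const
  · refine .of_forall fun t _ x hx => ?_
    have h1 : HasFDerivAt (fun x => f (x + circleMap 0 r t • v))
        (fderiv ℂ f (x + circleMap 0 r t • v)) x := by
      have := (hf.differentiableAt
        (hS.mem_nhds (hmemS x hx (circleMap 0 r t) (hcirc t)))).hasFDerivAt.comp x
        ((hasFDerivAt_id x).add_const (circleMap 0 r t • v))
      simpa [Function.comp_def] using this
    simpa only [Pi.smul_def] using (h1.const_smul (1 / (circleMap 0 r t - 0) ^ 2)).const_smul
      (deriv (circleMap 0 r) t)

variable {n : ℕ}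

theorem differentiableOn_fderiv {f : (Fin n → ℂ) → ℂ} {S : Set (Fin n → ℂ)}
    (hS : IsOpen S) (hf : DifferentiableOn ℂ f S) : DifferentiableOn ℂ (fderiv ℂ f) S := by
  have h : fderiv ℂ f = fun z => ∑ i, fderiv ℂ f z (Pi.single i 1) •
      (ContinuousLinearMap.proj i : (Fin n → ℂ) →L[ℂ] ℂ) := by
    funext z
    refine ContinuousLinearMap.ext fun v => ?_
    conv_lhs => rw [pi_eq_sum_univ' v, map_sum]
    simp only [map_smul, sum_apply, smul_apply,
      ContinuousLinearMap.proj_apply, smul_eq_mul]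
    refine Finset.sum_congr rfl fun i _ => ?_
    rw [mul_comm]
  rw [h]
  exact DifferentiableOn.fun_sum fun i _ =>
    (differentiableOn_fderiv_apply hS hf _).smul_const _

theorem fderiv_fderiv_symm {f : (Fin n → ℂ) → ℂ} {S : Set (Fin n → ℂ)}
    (hS : IsOpen S) (hf : DifferentiableOn ℂ f S) {z : Fin n → ℂ} (hz : z ∈ S)
    (v w : Fin n → ℂ) : fderiv ℂ (fderiv ℂ f) z v w = fderiv ℂ (fderiv ℂ f) z w v := by
  refine second_derivative_symmetric_of_eventually (𝕜 := ℂ) (f := f) (f' := fderiv ℂ f) (x := z)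
    ?_ ((differentiableOn_fderiv hS hf).differentiableAt (hS.mem_nhds hz)).hasFDerivAt v w
  filter_upwards [hS.mem_nhds hz] with y hy
  exact (hf.differentiableAt (hS.mem_nhds hy)).hasFDerivAt

end ScalarHolomorphy

/-! ### Derivatives and holomorphy tested on linear functionals. -/

section WeakDerivatives

open Filter Topology

variable {n : ℕ} {V V₁ V₂ V₃ : Type*} [AddCommGroup V] [Module ℂ V] [AddCommGroup V₁] [Module ℂ V₁]
  [AddCommGroup V₂] [Module ℂ V₂] [AddCommGroup V₃] [Module ℂ V₃]

/-- `v` is the derivative at `0` of the curve `c`, tested on linear functionals. -/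
def HasDerivW (c : ℂ → V) (v : V) : Prop :=
  ∀ φ : V →ₗ[ℂ] ℂ, HasDerivAt (fun h => φ (c h)) (φ v) 0

namespace HasDerivW

theorem unique {c : ℂ → V} {v w : V} (h : HasDerivW c v) (h' : HasDerivW c w) : v = w := by
  rw [← sub_eq_zero, ← Module.forall_dual_apply_eq_zero_iff ℂ]
  intro φ
  rw [map_sub, sub_eq_zero]
  exact (h φ).unique (h' φ)

theorem map {c : ℂ → V₁} {v : V₁} (h : HasDerivW c v) (F : V₁ →ₗ[ℂ] V₂) :
    HasDerivW (fun t => F (c t)) (F v) := fun φ => h (φ ∘ₗ F)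

theorem add {c c' : ℂ → V} {v v' : V} (h : HasDerivW c v) (h' : HasDerivW c' v') :
    HasDerivW (fun t => c t + c' t) (v + v') := fun φ => by
  simpa only [map_add] using! (h φ).add (h' φ)

theorem sum {ι : Type*} (s : Finset ι) {c : ι → ℂ → V} {v : ι → V}
    (h : ∀ i ∈ s, HasDerivW (c i) (v i)) :
    HasDerivW (fun t => ∑ i ∈ s, c i t) (∑ i ∈ s, v i) := fun φ => by
  simpa only [map_sum] using HasDerivAt.fun_sum fun i hi => h i hi φ

theorem congr {c c' : ℂ → V} {v : V} (h : HasDerivW c v) (hc : c' =ᶠ[𝓝 0] c) :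
    HasDerivW c' v := fun φ =>
  (h φ).congr_of_eventuallyEq (hc.mono fun _ ht => congrArg φ ht)

theorem const (a : V) : HasDerivW (fun _ : ℂ => a) 0 := fun φ => by
  simpa only [map_zero] using hasDerivAt_const (0 : ℂ) (φ a)

end HasDerivW

/-- Coordinates on a finite-dimensional subspace, extended to the whole space. -/
theorem exists_coordinates (W : Submodule ℂ V) [Module.Finite ℂ W] :
    ∃ (N : ℕ) (w : Fin N → V) (ξ : Fin N → V →ₗ[ℂ] ℂ),
      (∀ k, w k ∈ W) ∧ ∀ v ∈ W, v = ∑ k, ξ k v • w k := by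
  let b := Module.finBasis ℂ W
  choose ξ hξ using fun k => (b.coord k).exists_extend
  refine ⟨_, fun k => (b k : V), ξ, fun k => (b k).2, fun v hv => ?_⟩
  have h1 : ∀ k, ξ k v = b.repr ⟨v, hv⟩ k := fun k => LinearMap.congr_fun (hξ k) ⟨v, hv⟩
  have h2 := congrArg W.subtype (b.sum_repr ⟨v, hv⟩)
  simp only [map_sum, map_smul, Submodule.subtype_apply] at h2
  simp only [h1]
  exact h2.symm

/-- A product rule cannot be read off from functionals on both factors alone. Finite-dimensionality
of `W` reduces it to the scalar rule: expand the first factor in coordinates, so that each summand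
is a scalar function times a linear image of the second factor. -/
theorem HasDerivW.bilin {c : ℂ → V₁} {c' : ℂ → V₂} {v : V₁} {v' : V₂} (h : HasDerivW c v)
    (h' : HasDerivW c' v') (W : Submodule ℂ V₁) [Module.Finite ℂ W] (hW : ∀ t, c t ∈ W)
    (B : V₁ →ₗ[ℂ] V₂ →ₗ[ℂ] V₃) :
    HasDerivW (fun t => B (c t) (c' t)) (B v (c' 0) + B (c 0) v') := by
  obtain ⟨N, w, ξ, hw, hξ⟩ := exists_coordinates W
  -- The derivative stays in `W`: the coordinate expansion has a derivative in `W`, and weak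
  -- derivatives are unique.
  have hv : v = ∑ k, ξ k v • w k := by
    refine h.unique ?_
    have h1 : c = fun t => ∑ k, ξ k (c t) • w k := funext fun t => hξ _ (hW t)
    rw [h1]
    refine HasDerivW.sum _ fun k _ φ => ?_
    simpa only [map_smul, smul_eq_mul] using (h (ξ k)).mul_const (φ (w k))
  have h2 : ∀ t, B (c t) (c' t) = ∑ k, ξ k (c t) • B (w k) (c' t) := fun t => by
    conv_lhs => rw [hξ _ (hW t)]
    simp only [map_sum, map_smul, LinearMap.sum_apply, LinearMap.smul_apply]
  have h3 : B v (c' 0) + B (c 0) v' = ∑ k, (ξ k v • B (w k) (c' 0) + ξ k (c 0) • B (w k) v') := by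
    have h4 : ∀ a ∈ W, ∀ b, B a b = ∑ k, ξ k a • B (w k) b := fun a ha b => by
      conv_lhs => rw [hξ a ha]
      simp only [map_sum, map_smul, LinearMap.sum_apply, LinearMap.smul_apply]
    have hvW : v ∈ W := by
      rw [hv]
      exact W.sum_mem fun k _ => W.smul_mem _ (hw k)
    rw [h4 v hvW, h4 _ (hW 0), Finset.sum_add_distrib]
  simp only [h2]
  rw [h3]
  refine HasDerivW.sum _ fun k _ φ => ?_
  simp only [map_smul, map_add, smul_eq_mul]
  exact (h (ξ k)).mul (h' (φ ∘ₗ B (w k)))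

variable {S : Set (Fin n → ℂ)}

/-- The extension by zero of a map defined on `S`. -/
def zeroExt (f : S → V) : (Fin n → ℂ) → V := Function.extend Subtype.val f 0

theorem zeroExt_apply (f : S → V) {z : Fin n → ℂ} (hz : z ∈ S) : zeroExt f z = f ⟨z, hz⟩ :=
  Subtype.val_injective.extend_apply f 0 ⟨z, hz⟩

theorem zeroExt_of_notMem (f : S → V) {z : Fin n → ℂ} (hz : z ∉ S) : zeroExt f z = 0 :=
  Function.extend_apply' f (0 : (Fin n → ℂ) → V) z fun ⟨a, ha⟩ => hz (ha ▸ a.2)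

theorem zeroExt_induction (P : V → Prop) (f : S → V) (h0 : P 0) (h : ∀ z, P (f z)) (z) :
    P (zeroExt f z) := by
  by_cases hz : z ∈ S
  · rw [zeroExt_apply f hz]; exact h _
  · rw [zeroExt_of_notMem f hz]; exact h0

theorem zeroExt_map (F : V₁ →ₗ[ℂ] V₂) (f : S → V₁) (z) :
    zeroExt (fun w => F (f w)) z = F (zeroExt f z) := by
  by_cases hz : z ∈ S
  · simp only [zeroExt_apply _ hz]
  · simp only [zeroExt_of_notMem _ hz, map_zero]

theorem zeroExt_bilin (B : V₁ →ₗ[ℂ] V₂ →ₗ[ℂ] V₃) (f : S → V₁) (g : S → V₂) (z) :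
    zeroExt (fun w => B (f w) (g w)) z = B (zeroExt f z) (zeroExt g z) := by
  by_cases hz : z ∈ S
  · simp only [zeroExt_apply _ hz]
  · simp only [zeroExt_of_notMem _ hz, map_zero]

theorem zeroExt_sum {ι : Type*} (s : Finset ι) (f : ι → S → V) (z) :
    zeroExt (fun w => ∑ i ∈ s, f i w) z = ∑ i ∈ s, zeroExt (f i) z := by
  by_cases hz : z ∈ S
  · simp only [zeroExt_apply _ hz]
  · simp only [zeroExt_of_notMem _ hz, Finset.sum_const_zero]

theorem zeroExt_add (f g : S → V) (z) :
    zeroExt (fun w => f w + g w) z = zeroExt f z + zeroExt g z := by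
  by_cases hz : z ∈ S
  · simp only [zeroExt_apply _ hz]
  · simp only [zeroExt_of_notMem _ hz, add_zero]

/-- `∂f/∂z_i = v` at the point `z`. -/
def HasPartialAt (i : Fin n) (f : S → V) (v : V) (z : S) : Prop :=
  HasDerivW (fun h => zeroExt f (z.1 + Pi.single i h)) v

theorem hasPartial_iff {i : Fin n} {f f' : S → ℕ → V} :
    HasPartial S i f f' ↔ ∀ d z, HasPartialAt i (fun w => f w d) (f' z d) z := by
  simp only [HasPartial, HasPartialAt, HasDerivW, ← zeroExt_map]
  exact ⟨fun h d z φ => h d φ z, fun h d φ z => h d z φ⟩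

namespace HasPartialAt

variable {i : Fin n} {z : S}

theorem unique {f : S → V} {v w : V} (h : HasPartialAt i f v z) (h' : HasPartialAt i f w z) :
    v = w := HasDerivW.unique h h'

theorem map {f : S → V₁} {v : V₁} (h : HasPartialAt i f v z) (F : V₁ →ₗ[ℂ] V₂) :
    HasPartialAt i (fun w => F (f w)) (F v) z := by
  simp only [HasPartialAt, zeroExt_map]
  exact HasDerivW.map h F

theorem add {f g : S → V} {v w : V} (h : HasPartialAt i f v z) (h' : HasPartialAt i g w z) :
    HasPartialAt i (fun w => f w + g w) (v + w) z := by
  simp only [HasPartialAt, zeroExt_add]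
  exact HasDerivW.add h h'

theorem sum {ι : Type*} (s : Finset ι) {f : ι → S → V} {v : ι → V}
    (h : ∀ k ∈ s, HasPartialAt i (f k) (v k) z) :
    HasPartialAt i (fun w => ∑ k ∈ s, f k w) (∑ k ∈ s, v k) z := by
  simp only [HasPartialAt, zeroExt_sum]
  exact HasDerivW.sum s h

theorem bilin {f : S → V₁} {g : S → V₂} {v : V₁} {w : V₂} (h : HasPartialAt i f v z)
    (h' : HasPartialAt i g w z) (W : Submodule ℂ V₁) [Module.Finite ℂ W] (hW : ∀ z, f z ∈ W)
    (B : V₁ →ₗ[ℂ] V₂ →ₗ[ℂ] V₃) :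
    HasPartialAt i (fun w => B (f w) (g w)) (B v (g z) + B (f z) w) z := by
  simp only [HasPartialAt, zeroExt_bilin]
  have := HasDerivW.bilin h h' W (fun t => zeroExt_induction (· ∈ W) f W.zero_mem hW _) B
  simpa only [Pi.single_zero, add_zero, zeroExt_apply _ z.2] using this

end HasPartialAt

theorem eventually_add_single_mem (hS : IsOpen S) (z : S) (i : Fin n) :
    ∀ᶠ h : ℂ in 𝓝 0, z.1 + Pi.single i h ∈ S := by
  have hc : Continuous fun h : ℂ => z.1 + Pi.single i h :=
    continuous_const.add (continuous_single (A := fun _ : Fin n => ℂ) i)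
  refine hc.continuousAt.eventually_mem (hS.mem_nhds ?_)
  simp

theorem hasPartialAt_const (hS : IsOpen S) (i : Fin n) (z : S) (a : V) :
    HasPartialAt i (fun _ : S => a) 0 z := by
  refine (HasDerivW.const a).congr ?_
  filter_upwards [eventually_add_single_mem hS z i] with h hh
  rw [zeroExt_apply _ hh]

/-- Partial derivatives only depend on the values near the point, up to a transport of the
variable. -/
theorem HasPartialAt.transport {S' : Set (Fin n → ℂ)} (hS : IsOpen S) (hS' : IsOpen S')
    {i j : Fin n} {f : S → V} {g : S' → V} {z : S} {z' : S'} {v : V} (h : HasPartialAt i f v z)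
    (hfg : ∀ (t : ℂ) (w : S) (w' : S'), w.1 = z.1 + Pi.single i t → w'.1 = z'.1 + Pi.single j t →
      g w' = f w) : HasPartialAt j g v z' := by
  refine HasDerivW.congr h ?_
  filter_upwards [eventually_add_single_mem hS z i, eventually_add_single_mem hS' z' j] with t h1 h2
  rw [zeroExt_apply _ h1, zeroExt_apply _ h2]
  exact hfg t ⟨_, h1⟩ ⟨_, h2⟩ rfl rfl

/-- Holomorphy, tested on linear functionals. -/
def IsHolW (f : S → V) : Prop :=
  ∀ φ : V →ₗ[ℂ] ℂ, DifferentiableOn ℂ (fun z => φ (zeroExt f z)) S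

theorem isHol_iff {f : S → ℕ → V} : IsHol S f ↔ ∀ d, IsHolW (fun z => f z d) := by
  simp only [IsHol, IsHolW, ← zeroExt_map]
  rfl

/-- `f` is holomorphic with values in the finite-dimensional subspace `W`. -/
structure FinHolIn (W : Submodule ℂ V) (f : S → V) : Prop where
  finite : Module.Finite ℂ W
  mem : ∀ z, f z ∈ W
  hol : IsHolW f

namespace IsHolW

theorem map {f : S → V₁} (h : IsHolW f) (F : V₁ →ₗ[ℂ] V₂) : IsHolW (fun z => F (f z)) :=
  fun φ => by simpa only [zeroExt_map, LinearMap.comp_apply] using h (φ ∘ₗ F)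

theorem add {f g : S → V} (h : IsHolW f) (h' : IsHolW g) : IsHolW (fun z => f z + g z) :=
  fun φ => by simpa only [zeroExt_add, map_add] using! (h φ).add (h' φ)

theorem sum {ι : Type*} (s : Finset ι) {f : ι → S → V} (h : ∀ k ∈ s, IsHolW (f k)) :
    IsHolW (fun z => ∑ k ∈ s, f k z) :=
  fun φ => by simpa only [zeroExt_sum, map_sum] using DifferentiableOn.fun_sum fun k hk => h k hk φ

theorem const (a : V) : IsHolW (fun _ : S => a) := fun φ =>
  (differentiableOn_const (φ a)).congr fun z hz => by rw [zeroExt_apply _ hz]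

theorem smul_const {g : (Fin n → ℂ) → ℂ} (hg : DifferentiableOn ℂ g S) (a : V) :
    IsHolW (fun z : S => g z.1 • a) := fun φ =>
  (hg.mul_const (φ a)).congr fun z hz => by rw [zeroExt_apply _ hz, map_smul, smul_eq_mul]

theorem bilin {f : S → V₁} {g : S → V₂} (h : IsHolW f) (h' : IsHolW g) (W : Submodule ℂ V₁)
    [Module.Finite ℂ W] (hW : ∀ z, f z ∈ W) (B : V₁ →ₗ[ℂ] V₂ →ₗ[ℂ] V₃) :
    IsHolW (fun z => B (f z) (g z)) := by
  obtain ⟨N, w, ξ, hw, hξ⟩ := exists_coordinates W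
  intro φ
  have h2 : ∀ z, φ (zeroExt (fun z => B (f z) (g z)) z) =
      ∑ k, ξ k (zeroExt f z) * (φ ∘ₗ B (w k)) (zeroExt g z) := fun z => by
    rw [zeroExt_bilin]
    conv_lhs => rw [hξ _ (zeroExt_induction (· ∈ W) f W.zero_mem hW z)]
    simp only [map_sum, map_smul, LinearMap.sum_apply, LinearMap.smul_apply,
      smul_eq_mul, LinearMap.comp_apply]
  simp only [h2]
  exact DifferentiableOn.fun_sum fun k _ => (h (ξ k)).mul (h' (φ ∘ₗ B (w k)))

theorem hasPartialAt_apply (hS : IsOpen S) {f : S → V} (h : IsHolW f) (φ : V →ₗ[ℂ] ℂ) (i : Fin n)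
    (z : S) : HasDerivAt (fun t : ℂ => φ (zeroExt f (z.1 + Pi.single i t)))
      (fderiv ℂ (fun z => φ (zeroExt f z)) z.1 (Pi.single i 1)) 0 := by
  have h1 := ((h φ).differentiableAt (hS.mem_nhds z.2)).hasFDerivAt
  have h2 : HasDerivAt (fun t : ℂ => z.1 + Pi.single i t) (Pi.single i (1 : ℂ)) 0 :=
    (hasDerivAt_pi.2 fun j => by
      by_cases hj : j = i
      · subst hj; simpa using hasDerivAt_id' (0 : ℂ)
      · simpa [hj] using hasDerivAt_const (0 : ℂ) (0 : ℂ)).const_add z.1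
  exact HasFDerivAt.comp_hasDerivAt (x := (0 : ℂ)) (f := fun t : ℂ => z.1 + Pi.single i t)
    (by simpa using h1) h2

/-- Mixed partial derivatives commute. -/
theorem partial_comm (hS : IsOpen S) {f fi fj : S → V} (h : IsHolW f) {i j : Fin n} {z : S}
    {fij fji : V} (hi : ∀ z, HasPartialAt i f (fi z) z) (hj : ∀ z, HasPartialAt j f (fj z) z)
    (hij : HasPartialAt j fi fij z) (hji : HasPartialAt i fj fji z) : fij = fji := by
  rw [← sub_eq_zero, ← Module.forall_dual_apply_eq_zero_iff ℂ]
  intro φ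
  rw [map_sub, sub_eq_zero]
  set g := fun z => φ (zeroExt f z) with hg
  -- Tested on `φ`, both mixed partials are values of the second derivative of the scalar function
  -- `φ ∘ f`, which is symmetric.
  have key : ∀ (k l : Fin n) (fk : S → V) (fkl : V), (∀ z, HasPartialAt k f (fk z) z) →
      HasPartialAt l fk fkl z →
      φ fkl = fderiv ℂ (fderiv ℂ g) z.1 (Pi.single l 1) (Pi.single k 1) := by
    intro k l fk fkl hk hkl
    have h1 : ∀ w : S, φ (fk w) = fderiv ℂ g w.1 (Pi.single k 1) := fun w =>
      (hk w φ).unique (h.hasPartialAt_apply hS φ k w)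
    have h2 := ((differentiableOn_fderiv hS (h φ)).differentiableAt
      (hS.mem_nhds z.2)).hasFDerivAt
    have h3 : HasDerivAt (fun t : ℂ => z.1 + Pi.single l t) (Pi.single l (1 : ℂ)) 0 :=
      (hasDerivAt_pi.2 fun j => by
        by_cases hj : j = l
        · subst hj; simpa using hasDerivAt_id' (0 : ℂ)
        · simpa [hj] using hasDerivAt_const (0 : ℂ) (0 : ℂ)).const_add z.1
    have h4 := HasFDerivAt.comp_hasDerivAt (x := (0 : ℂ)) (f := fun t : ℂ => z.1 + Pi.single l t)
      (by simpa using h2) h3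
    have h5 := h4.clm_apply (hasDerivAt_const (0 : ℂ) (Pi.single k (1 : ℂ)))
    simp only [map_zero, add_zero] at h5
    refine (hkl φ).unique (h5.congr_of_eventuallyEq ?_)
    filter_upwards [eventually_add_single_mem hS z l] with t ht
    rw [zeroExt_apply _ ht, h1]
    rfl
  rw [key i j fi fij hi hij, key j i fj fji hj hji]
  exact fderiv_fderiv_symm hS (h φ) z.2 _ _

/-- The sum of all partial derivatives is the derivative along the diagonal. -/
theorem sum_partial (hS : IsOpen S) {f : S → V} (h : IsHolW f) {f' : Fin n → V} {z : S}
    (h' : ∀ i, HasPartialAt i f (f' i) z)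
    (hconst : ∀ (u : ℂ) (w : S), w.1 = z.1 + (fun _ => u) → f w = f z) : ∑ i, f' i = 0 := by
  rw [← Module.forall_dual_apply_eq_zero_iff ℂ]
  intro φ
  set g := fun z => φ (zeroExt f z) with hg
  have h1 : ∀ i, φ (f' i) = fderiv ℂ g z.1 (Pi.single i 1) := fun i =>
    (h' i φ).unique (h.hasPartialAt_apply hS φ i z)
  rw [map_sum, Finset.sum_congr rfl fun i _ => h1 i, ← map_sum]
  have h2 := ((h φ).differentiableAt (hS.mem_nhds z.2)).hasFDerivAt
  have h3 : HasDerivAt (fun t : ℂ => z.1 + (fun _ : Fin n => t)) (fun _ => 1) 0 :=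
    (hasDerivAt_pi.2 fun j => hasDerivAt_id (0 : ℂ)).const_add z.1
  have h0 : z.1 + (fun _ : Fin n => (0 : ℂ)) = z.1 := add_zero z.1
  have h4 := HasFDerivAt.comp_hasDerivAt (x := (0 : ℂ))
    (f := fun t : ℂ => z.1 + (fun _ : Fin n => t)) (by rw [h0]; exact h2) h3
  have h5 : (∑ i : Fin n, Pi.single i (1 : ℂ)) = fun _ => 1 := by
    ext j
    simp [Finset.sum_apply]
  rw [h5]
  refine h4.unique ((hasDerivAt_const (0 : ℂ) (φ (f z))).congr_of_eventuallyEq ?_)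
  have hc : ContinuousAt (fun t : ℂ => z.1 + (fun _ : Fin n => t)) 0 := h3.continuousAt
  filter_upwards [hc.eventually_mem (hS.mem_nhds (by rw [h0]; exact z.2))] with t ht
  simp only [Function.comp_apply]
  rw [zeroExt_apply _ ht, hconst t ⟨_, ht⟩ rfl]

end IsHolW

namespace FinHolIn

variable {W W' : Submodule ℂ V}

/-- In coordinates of `W` each component is a scalar holomorphic function; its partial derivative is
again holomorphic, and these reassemble to a map into `W`. -/
theorem exists_partial (hS : IsOpen S) {f : S → V} (h : FinHolIn W f) (i : Fin n) :
    ∃ f' : S → V, FinHolIn W f' ∧ ∀ z, HasPartialAt i f (f' z) z := by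
  have := h.finite
  obtain ⟨N, w, ξ, hw, hξ⟩ := exists_coordinates W
  refine ⟨fun z => ∑ k, fderiv ℂ (fun z => ξ k (zeroExt f z)) z.1 (Pi.single i 1) • w k,
    ⟨h.finite, fun z => W.sum_mem fun k _ => W.smul_mem _ (hw k), IsHolW.sum _ fun k _ =>
      IsHolW.smul_const (differentiableOn_fderiv_apply hS (h.hol (ξ k)) (Pi.single i 1)) _⟩,
    fun z => ?_⟩
  refine HasDerivW.congr (HasDerivW.sum Finset.univ fun k _ φ => ?_) (.of_forall fun t =>
    hξ _ (zeroExt_induction (· ∈ W) f W.zero_mem h.mem (z.1 + Pi.single i t)))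
  simpa only [map_smul, smul_eq_mul] using
    (h.hol.hasPartialAt_apply hS (ξ k) i z).mul_const (φ (w k))

end FinHolIn

end WeakDerivatives

/-! ### Exponentials and their derivatives in noncommutative power series. -/

section FormalExponential

open PowerSeries

variable {R : Type*} [Ring R] [Algebra ℂ R]

theorem coeff_complex_smul (d : ℕ) (c : ℂ) (A : R⟦X⟧) : coeff d (c • A) = c • coeff d A := rfl

/-- The coefficients of `A` vanish in degrees `< m`. -/
def VanishesBelow (m : ℕ) (A : R⟦X⟧) : Prop := ∀ d < m, coeff d A = 0

namespace VanishesBelow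

variable {m k : ℕ} {A B : R⟦X⟧}

theorem zero_left (A : R⟦X⟧) : VanishesBelow 0 A := fun d hd => absurd hd (Nat.not_lt_zero d)

theorem mono (h : VanishesBelow m A) (hk : k ≤ m) : VanishesBelow k A :=
  fun d hd => h d (hd.trans_le hk)

theorem mul (hA : VanishesBelow m A) (hB : VanishesBelow k B) : VanishesBelow (m + k) (A * B) := by
  intro d hd
  rw [coeff_mul]
  refine Finset.sum_eq_zero fun p hp => ?_
  rw [Finset.HasAntidiagonal.mem_antidiagonal] at hp
  rcases lt_or_ge p.1 m with h | h
  · rw [hA _ h, zero_mul]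
  · rw [hB p.2 (by omega), mul_zero]

theorem sub (hA : VanishesBelow m A) (hB : VanishesBelow m B) : VanishesBelow m (A - B) :=
  fun d hd => by rw [map_sub, hA d hd, hB d hd, sub_zero]

theorem smul (c : ℂ) (hA : VanishesBelow m A) : VanishesBelow m (c • A) :=
  fun d hd => by rw [coeff_complex_smul, hA d hd, smul_zero]

theorem pow (hA : VanishesBelow 1 A) (m : ℕ) : VanishesBelow m (A ^ m) := by
  induction m with
  | zero => exact zero_left _
  | succ m ih => rw [pow_succ]; exact ih.mul hA

end VanishesBelow

/-- The sum of a sequence of power series of increasing order. -/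
def sumP (P : ℕ → R⟦X⟧) : R⟦X⟧ := mk fun d => ∑ m ∈ Finset.range (d + 1), coeff d (P m)

/-- The cut-off in `sumP` is immaterial: every longer partial sum has the same coefficient. -/
theorem coeff_sumP_eq {P : ℕ → R⟦X⟧} (hP : ∀ m, VanishesBelow m (P m)) {d N : ℕ} (h : d < N) :
    coeff d (sumP P) = coeff d (∑ m ∈ Finset.range N, P m) := by
  rw [sumP, coeff_mk, map_sum]
  refine Finset.sum_subset (Finset.range_subset_range.2 (by omega)) fun m _ hm => ?_
  rw [Finset.mem_range, not_lt] at hm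
  exact hP m d (by omega)

theorem coeff_mul_congr {A A' B B' : R⟦X⟧} {d : ℕ} (hA : ∀ e ≤ d, coeff e A = coeff e A')
    (hB : ∀ e ≤ d, coeff e B = coeff e B') : coeff d (A * B) = coeff d (A' * B') := by
  rw [coeff_mul, coeff_mul]
  refine Finset.sum_congr rfl fun p hp => ?_
  rw [Finset.HasAntidiagonal.mem_antidiagonal] at hp
  rw [hA p.1 (by omega), hB p.2 (by omega)]

/-- Cauchy product: in degree `d` the square `a, b ≤ d` and the triangle `a + b ≤ d` give the same
sum, as the other products have order `> d`. -/
theorem sumP_mul_sumP {P Q : ℕ → R⟦X⟧} (hP : ∀ m, VanishesBelow m (P m))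
    (hQ : ∀ m, VanishesBelow m (Q m)) :
    sumP P * sumP Q = sumP fun n => ∑ p ∈ Finset.HasAntidiagonal.antidiagonal n, P p.1 * Q p.2 := by
  ext d
  rw [coeff_mul_congr (fun e he => coeff_sumP_eq hP (Nat.lt_succ_of_le he))
    (fun e he => coeff_sumP_eq hQ (Nat.lt_succ_of_le he)), sumP, coeff_mk,
    Finset.sum_mul_sum, ← Finset.sum_product', map_sum]
  simp only [map_sum]
  rw [Finset.sum_sigma']
  symm
  refine Finset.sum_of_injOn (fun x => x.2) ?_ ?_ ?_ ?_
  · rintro ⟨a, b⟩ h ⟨c, e⟩ h' heq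
    simp only [Finset.coe_sigma, Set.mem_sigma_iff, Finset.mem_coe, Finset.HasAntidiagonal.mem_antidiagonal] at h h'
    obtain ⟨-, rfl⟩ := h
    obtain ⟨-, rfl⟩ := h'
    simp only at heq
    subst heq
    rfl
  · rintro ⟨a, b⟩ h
    simp only [Finset.coe_sigma, Set.mem_sigma_iff, Finset.mem_coe, Finset.HasAntidiagonal.mem_antidiagonal,
      Finset.mem_range, Finset.mem_product] at h ⊢
    omega
  · rintro ⟨a, b⟩ _ h
    refine (hP a).mul (hQ b) d ?_
    by_contra hd
    refine h ⟨⟨a + b, (a, b)⟩, ?_, rfl⟩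
    simp only [Finset.coe_sigma, Set.mem_sigma_iff, Finset.mem_coe, Finset.HasAntidiagonal.mem_antidiagonal,
      Finset.mem_range, and_true]
    omega
  · intro x _
    rfl

theorem mul_sumP (B : R⟦X⟧) {P : ℕ → R⟦X⟧} (hP : ∀ m, VanishesBelow m (P m)) :
    B * sumP P = sumP fun n => B * P n := by
  ext d
  rw [coeff_mul_congr (fun e _ => rfl) (fun e he => coeff_sumP_eq hP (Nat.lt_succ_of_le he)), sumP,
    coeff_mk, Finset.mul_sum, map_sum]

theorem sumP_mul (B : R⟦X⟧) {P : ℕ → R⟦X⟧} (hP : ∀ m, VanishesBelow m (P m)) :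
    sumP P * B = sumP fun n => P n * B := by
  ext d
  rw [coeff_mul_congr (fun e he => coeff_sumP_eq hP (Nat.lt_succ_of_le he)) (fun e _ => rfl), sumP,
    coeff_mk, Finset.sum_mul, map_sum]

theorem mul_left_cancel_of_coeff_zero {s u v : R⟦X⟧} (hs : coeff 0 s = 1) (h : s * u = s * v) :
    u = v := by
  ext d
  induction d using Nat.strong_induction_on with | _ d ih => ?_
  have h1 := congrArg (coeff d) h
  rw [coeff_mul, coeff_mul, ← Finset.Nat.sum_antidiagonal_swap,
    ← Finset.Nat.sum_antidiagonal_swap (f := fun p => coeff p.1 s * coeff p.2 v),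
    Finset.Nat.sum_antidiagonal_eq_sum_range_succ_mk,
    Finset.Nat.sum_antidiagonal_eq_sum_range_succ_mk, Finset.sum_range_succ,
    Finset.sum_range_succ] at h1
  simp only [Prod.swap, Nat.sub_self, hs, one_mul] at h1
  rwa [Finset.sum_congr rfl fun e he => by rw [ih e (Finset.mem_range.1 he)], add_right_inj] at h1

/-- The iterated commutator `(ad A)^k B`. -/
def adPow (A : R⟦X⟧) (k : ℕ) (B : R⟦X⟧) : R⟦X⟧ := (fun C => A * C - C * A)^[k] B

theorem adPow_succ (A : R⟦X⟧) (k : ℕ) (B : R⟦X⟧) :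
    adPow A (k + 1) B = A * adPow A k B - adPow A k B * A :=
  Function.iterate_succ_apply' _ _ _

theorem VanishesBelow.adPow {A B : R⟦X⟧} {e : ℕ} (hA : VanishesBelow 1 A)
    (hB : VanishesBelow e B) (k : ℕ) : VanishesBelow (k + e) (adPow A k B) := by
  induction k with
  | zero => rw [zero_add]; exact hB
  | succ k ih =>
    rw [adPow_succ]
    exact ((hA.mul ih).mono (by omega)).sub ((ih.mul hA).mono (by omega))

/-- The terms of the exponential series. -/
def expTerm (A : R⟦X⟧) (m : ℕ) : R⟦X⟧ := ((m.factorial : ℂ)⁻¹) • A ^ m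

theorem mul_expTerm (A : R⟦X⟧) (m : ℕ) :
    A * expTerm A m = ((m + 1 : ℕ) : ℂ) • expTerm A (m + 1) := by
  rw [expTerm, expTerm, mul_smul_comm, smul_smul, ← pow_succ', Nat.factorial_succ]
  congr 1
  have := Nat.factorial_ne_zero m
  push_cast
  field_simp

theorem expTerm_mul (A : R⟦X⟧) (m : ℕ) :
    expTerm A m * A = ((m + 1 : ℕ) : ℂ) • expTerm A (m + 1) := by
  rw [← mul_expTerm, expTerm, smul_mul_assoc, mul_smul_comm, pow_mul_comm']

theorem VanishesBelow.expTerm {A : R⟦X⟧} (hA : VanishesBelow 1 A) (m : ℕ) :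
    VanishesBelow m (expTerm A m) := (hA.pow m).smul _

/-- `Y A^n / n! = ∑_{j + k = n} (A^j / j!) ((-ad A)^k Y / k!)`. -/
theorem mul_expTerm_eq_sum (A B : R⟦X⟧) (n : ℕ) :
    B * expTerm A n = ∑ p ∈ Finset.HasAntidiagonal.antidiagonal n,
      expTerm A p.1 * (((-1) ^ p.2 * (p.2.factorial : ℂ)⁻¹) • adPow A p.2 B) := by
  induction n with
  | zero => simp [expTerm, adPow]
  | succ n ih =>
    -- After multiplication by `n + 1`, the step is a Pascal-type recursion: right multiplication by
    -- `A` sends the term `u j k` to `(j + 1) u (j + 1) k + (k + 1) u j (k + 1)`.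
    have hn : ((n + 1 : ℕ) : ℂ) ≠ 0 := Nat.cast_ne_zero.2 n.succ_ne_zero
    refine smul_right_injective _ hn ?_
    change ((n + 1 : ℕ) : ℂ) • (B * expTerm A (n + 1)) = ((n + 1 : ℕ) : ℂ) • _
    set u : ℕ → ℕ → R⟦X⟧ := fun j k =>
      expTerm A j * (((-1) ^ k * (k.factorial : ℂ)⁻¹) • adPow A k B) with hu
    have h1 : ∀ j k, u j k * A =
        ((j + 1 : ℕ) : ℂ) • u (j + 1) k + ((k + 1 : ℕ) : ℂ) • u j (k + 1) := by
      intro j k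
      simp only [hu, adPow_succ, mul_smul_comm, smul_mul_assoc, smul_smul, mul_sub]
      rw [← mul_assoc (expTerm A j) A, expTerm_mul, smul_mul_assoc, smul_sub, smul_smul, mul_assoc]
      have hk : ((k + 1 : ℕ) : ℂ) * ((-1) ^ (k + 1) * ((k + 1).factorial : ℂ)⁻¹) =
          -((-1) ^ k * (k.factorial : ℂ)⁻¹) := by
        have := Nat.factorial_ne_zero k
        rw [Nat.factorial_succ, pow_succ]
        push_cast
        have h3 : (k : ℂ) + 1 ≠ 0 := by exact_mod_cast k.succ_ne_zero
        field_simp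
      rw [hk]
      simp only [neg_mul, neg_smul]
      rw [mul_comm ((j + 1 : ℕ) : ℂ)]
      abel
    have h2 : ((n + 1 : ℕ) : ℂ) • (B * expTerm A (n + 1)) =
        ∑ p ∈ Finset.HasAntidiagonal.antidiagonal n, u p.1 p.2 * A := by
      rw [← mul_smul_comm, ← expTerm_mul, ← mul_assoc, ih, Finset.sum_mul]
    rw [h2, Finset.sum_congr rfl fun p _ => h1 p.1 p.2, Finset.sum_add_distrib]
    have h3 : ((n + 1 : ℕ) : ℂ) • ∑ p ∈ Finset.HasAntidiagonal.antidiagonal (n + 1), u p.1 p.2 =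
        ∑ p ∈ Finset.HasAntidiagonal.antidiagonal (n + 1), ((p.1 : ℂ) • u p.1 p.2 + (p.2 : ℂ) • u p.1 p.2) := by
      rw [Finset.smul_sum]
      refine Finset.sum_congr rfl fun p hp => ?_
      rw [Finset.HasAntidiagonal.mem_antidiagonal] at hp
      rw [← add_smul, ← Nat.cast_add, hp]
    rw [h3, Finset.sum_add_distrib, Finset.Nat.sum_antidiagonal_succ,
      Finset.Nat.sum_antidiagonal_succ']
    simp

/-- `A^n Y / n! = ∑_{j + k = n} ((ad A)^k Y / k!) (A^j / j!)`. -/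
theorem expTerm_mul_eq_sum (A B : R⟦X⟧) (n : ℕ) :
    expTerm A n * B = ∑ p ∈ Finset.HasAntidiagonal.antidiagonal n,
      ((p.1.factorial : ℂ)⁻¹ • adPow A p.1 B) * expTerm A p.2 := by
  induction n with
  | zero => simp [expTerm, adPow]
  | succ n ih =>
    have hn : ((n + 1 : ℕ) : ℂ) ≠ 0 := Nat.cast_ne_zero.2 n.succ_ne_zero
    refine smul_right_injective _ hn ?_
    change ((n + 1 : ℕ) : ℂ) • (expTerm A (n + 1) * B) = ((n + 1 : ℕ) : ℂ) • _
    set u : ℕ → ℕ → R⟦X⟧ := fun k j =>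
      ((k.factorial : ℂ)⁻¹ • adPow A k B) * expTerm A j with hu
    have h1 : ∀ k j, A * u k j =
        ((k + 1 : ℕ) : ℂ) • u (k + 1) j + ((j + 1 : ℕ) : ℂ) • u k (j + 1) := by
      intro k j
      have hk : ((k + 1 : ℕ) : ℂ) * ((k + 1).factorial : ℂ)⁻¹ = (k.factorial : ℂ)⁻¹ := by
        have := Nat.factorial_ne_zero k
        rw [Nat.factorial_succ]
        push_cast
        have h3 : (k : ℂ) + 1 ≠ 0 := by exact_mod_cast k.succ_ne_zero
        field_simp
      have h4 : ((j + 1 : ℕ) : ℂ) • u k (j + 1) =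
          (k.factorial : ℂ)⁻¹ • (adPow A k B * A * expTerm A j) := by
        simp only [hu]
        rw [← mul_smul_comm, ← mul_expTerm, smul_mul_assoc, mul_assoc]
      rw [h4]
      simp only [hu, adPow_succ, mul_smul_comm, smul_mul_assoc, smul_smul, sub_mul, hk]
      rw [smul_sub, sub_add_cancel, mul_assoc]
    have h2 : ((n + 1 : ℕ) : ℂ) • (expTerm A (n + 1) * B) =
        ∑ p ∈ Finset.HasAntidiagonal.antidiagonal n, A * u p.1 p.2 := by
      rw [← smul_mul_assoc, ← mul_expTerm, mul_assoc, ih, Finset.mul_sum]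
    rw [h2, Finset.sum_congr rfl fun p _ => h1 p.1 p.2, Finset.sum_add_distrib]
    have h3 : ((n + 1 : ℕ) : ℂ) • ∑ p ∈ Finset.HasAntidiagonal.antidiagonal (n + 1), u p.1 p.2 =
        ∑ p ∈ Finset.HasAntidiagonal.antidiagonal (n + 1), ((p.1 : ℂ) • u p.1 p.2 + (p.2 : ℂ) • u p.1 p.2) := by
      rw [Finset.smul_sum]
      refine Finset.sum_congr rfl fun p hp => ?_
      rw [Finset.HasAntidiagonal.mem_antidiagonal] at hp
      rw [← add_smul, ← Nat.cast_add, hp]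
    rw [h3, Finset.sum_add_distrib, Finset.Nat.sum_antidiagonal_succ,
      Finset.Nat.sum_antidiagonal_succ']
    simp

/-- The derivative of `A^m` in the direction `B`. -/
def powDeriv (A B : R⟦X⟧) : ℕ → R⟦X⟧
  | 0 => 0
  | m + 1 => B * A ^ m + A * powDeriv A B m

theorem powDeriv_succ' (A B : R⟦X⟧) (m : ℕ) :
    powDeriv A B (m + 1) = powDeriv A B m * A + A ^ m * B := by
  induction m with
  | zero => simp [powDeriv]
  | succ m ih =>
    conv_lhs => rw [powDeriv, ih]
    rw [powDeriv, pow_succ A m, mul_add, add_mul, ← mul_assoc, ← mul_assoc, ← mul_assoc,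
      ← pow_succ', pow_succ]
    abel

/-- `(A^(n+1) / (n+1)!)' = ∑_{j + k = n} (A^j / j!) ((-ad A)^k A' / (k+1)!)`. -/
theorem powDeriv_eq_sum (A B : R⟦X⟧) (n : ℕ) :
    ((n + 1).factorial : ℂ)⁻¹ • powDeriv A B (n + 1) = ∑ p ∈ Finset.HasAntidiagonal.antidiagonal n,
      expTerm A p.1 * (((-1) ^ p.2 * ((p.2 + 1).factorial : ℂ)⁻¹) • adPow A p.2 B) := by
  induction n with
  | zero => simp [expTerm, adPow, powDeriv]
  | succ n ih =>
    -- The same recursion with `(k + 1)!` in place of `k!`, so the weights are `j + 1` and `k + 2`.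
    -- The missing unit of weight at `k = 0` is the new term `A^(n+1) B / (n+1)!` of the Leibniz
    -- rule.
    have hn : ((n + 2 : ℕ) : ℂ) ≠ 0 := Nat.cast_ne_zero.2 (by omega)
    refine smul_right_injective _ hn ?_
    change ((n + 2 : ℕ) : ℂ) • (((n + 2).factorial : ℂ)⁻¹ • powDeriv A B (n + 2)) =
      ((n + 2 : ℕ) : ℂ) • _
    set u : ℕ → ℕ → R⟦X⟧ := fun j k =>
      expTerm A j * (((-1) ^ k * ((k + 1).factorial : ℂ)⁻¹) • adPow A k B) with hu
    have h1 : ∀ j k, u j k * A =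
        ((j + 1 : ℕ) : ℂ) • u (j + 1) k + ((k + 2 : ℕ) : ℂ) • u j (k + 1) := by
      intro j k
      simp only [hu, adPow_succ, mul_smul_comm, smul_mul_assoc, smul_smul, mul_sub]
      rw [← mul_assoc (expTerm A j) A, expTerm_mul, smul_mul_assoc, smul_sub, smul_smul, mul_assoc]
      have hk : ((k + 2 : ℕ) : ℂ) * ((-1) ^ (k + 1) * ((k + 1 + 1).factorial : ℂ)⁻¹) =
          -((-1) ^ k * ((k + 1).factorial : ℂ)⁻¹) := by
        have := Nat.factorial_ne_zero (k + 1)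
        rw [Nat.factorial_succ (k + 1), pow_succ]
        push_cast
        have h3 : (k : ℂ) + 1 + 1 ≠ 0 := by exact_mod_cast (show k + 1 + 1 ≠ 0 by omega)
        have h4 : (k : ℂ) + 2 ≠ 0 := by exact_mod_cast (show k + 2 ≠ 0 by omega)
        field_simp
        ring
      rw [hk]
      simp only [neg_mul, neg_smul]
      rw [mul_comm ((j + 1 : ℕ) : ℂ)]
      abel
    have h2 : ((n + 2 : ℕ) : ℂ) • (((n + 2).factorial : ℂ)⁻¹ • powDeriv A B (n + 2)) =
        ∑ p ∈ Finset.HasAntidiagonal.antidiagonal n, u p.1 p.2 * A + u (n + 1) 0 := by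
      have h5 : ((n + 2 : ℕ) : ℂ) * ((n + 2).factorial : ℂ)⁻¹ = ((n + 1).factorial : ℂ)⁻¹ := by
        have := Nat.factorial_ne_zero (n + 1)
        rw [Nat.factorial_succ (n + 1)]
        push_cast
        have h3 : (n : ℂ) + 1 + 1 ≠ 0 := by exact_mod_cast (show n + 1 + 1 ≠ 0 by omega)
        have h4 : (n : ℂ) + 2 ≠ 0 := by exact_mod_cast (show n + 2 ≠ 0 by omega)
        field_simp
        ring
      rw [smul_smul, h5, powDeriv_succ', smul_add, ← smul_mul_assoc, ih, Finset.sum_mul]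
      congr 1
      simp [hu, expTerm, adPow]
    rw [h2, Finset.sum_congr rfl fun p _ => h1 p.1 p.2, Finset.sum_add_distrib]
    have h3 : ((n + 2 : ℕ) : ℂ) • ∑ p ∈ Finset.HasAntidiagonal.antidiagonal (n + 1), u p.1 p.2 =
        ∑ p ∈ Finset.HasAntidiagonal.antidiagonal (n + 1),
          ((p.1 : ℂ) • u p.1 p.2 + ((p.2 + 1 : ℕ) : ℂ) • u p.1 p.2) := by
      rw [Finset.smul_sum]
      refine Finset.sum_congr rfl fun p hp => ?_
      rw [Finset.HasAntidiagonal.mem_antidiagonal] at hp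
      rw [← add_smul, ← Nat.cast_add]
      congr 2
      omega
    rw [h3, Finset.sum_add_distrib, Finset.Nat.sum_antidiagonal_succ,
      Finset.Nat.sum_antidiagonal_succ']
    simp [add_assoc, one_add_one_eq_two]
    exact add_comm _ _

/-- The exponential of a power series without constant term. -/
def expP (A : R⟦X⟧) : R⟦X⟧ := sumP (expTerm A)

/-- `F(ad A)(B)` for the formal power series `F` with coefficients `c`. -/
def adP (c : ℕ → ℂ) (A B : R⟦X⟧) : R⟦X⟧ := sumP fun k => c k • adPow A k B

theorem VanishesBelow.adTerm {A : R⟦X⟧} (hA : VanishesBelow 1 A) (c : ℕ → ℂ) (B : R⟦X⟧) (k : ℕ) :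
    VanishesBelow k (c k • KZB.adPow A k B) :=
  (hA.adPow (VanishesBelow.zero_left B) k).smul _

/-- This is `e^{-A} B e^A = e^{-ad A} B`, written without inverses. -/
theorem mul_expP {A : R⟦X⟧} (hA : VanishesBelow 1 A) (B : R⟦X⟧) :
    B * expP A = expP A * adP (fun k => (-1) ^ k * (k.factorial : ℂ)⁻¹) A B := by
  rw [expP, adP, mul_sumP _ hA.expTerm, sumP_mul_sumP hA.expTerm (hA.adTerm _ _)]
  exact congrArg sumP (funext fun n => mul_expTerm_eq_sum A B n)

/-- This is `e^A B e^{-A} = e^{ad A} B`; it turns the equivariance of `K_i`, stated with `ad x_j`,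
into conjugation by the factor of automorphy. -/
theorem adP_mul_expP {A : R⟦X⟧} (hA : VanishesBelow 1 A) (B : R⟦X⟧) :
    adP (fun k => (k.factorial : ℂ)⁻¹) A B * expP A = expP A * B := by
  rw [expP, adP, sumP_mul _ hA.expTerm, sumP_mul_sumP (hA.adTerm _ _) hA.expTerm]
  exact (congrArg sumP (funext fun n => expTerm_mul_eq_sum A B n)).symm

/-- Derivative of the exponential map: `e^{-A} d(e^A) = ((1 - e^{-ad A}) / ad A)(dA)`. -/
theorem sumP_powDeriv {A B : R⟦X⟧} (hA : VanishesBelow 1 A) (hB : VanishesBelow 1 B) :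
    sumP (fun m => ((m.factorial : ℂ)⁻¹) • powDeriv A B m) =
      expP A * adP (fun k => (-1) ^ k * ((k + 1).factorial : ℂ)⁻¹) A B := by
  rw [expP, adP, sumP_mul_sumP hA.expTerm (hA.adTerm _ _)]
  simp only [← powDeriv_eq_sum A B]
  ext d
  rw [sumP, coeff_mk, sumP, coeff_mk, Finset.sum_range_succ', Finset.sum_range_succ,
    powDeriv_eq_sum]
  simp only [powDeriv, smul_zero, map_zero]
  congr 1
  rw [map_sum]
  -- The index shift leaves one extra term on the right. It has order at least `d + 1`, because `B`
  -- has no constant term, and so does not contribute in degree `d`.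
  symm
  refine Finset.sum_eq_zero fun p hp => ?_
  rw [Finset.HasAntidiagonal.mem_antidiagonal] at hp
  exact (hA.expTerm p.1).mul ((hA.adPow hB p.2).smul _) d (by omega)

end FormalExponential

/-! ### Holomorphic maps to the group `exp(L^)`. -/

section HolomorphicExponentials

open PowerSeries Finset.HasAntidiagonal

attribute [local instance] LieRing.ofAssociativeRing

variable {n : ℕ} {S : Set (Fin n → ℂ)} {R : Type*} [Ring R] [Algebra ℂ R]

/-- All coefficients are holomorphic. -/
def HolU (s : S → R⟦X⟧) : Prop := ∀ d, IsHolW fun z => coeff d (s z)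

/-- All coefficients are holomorphic with values in finite-dimensional subspaces. -/
def FinHolU (s : S → R⟦X⟧) : Prop := ∀ d, ∃ W, FinHolIn W fun z => coeff d (s z)

/-- `∂s/∂z_i = v` at the point `z`. -/
def PartialU (i : Fin n) (s : S → R⟦X⟧) (v : R⟦X⟧) (z : S) : Prop :=
  ∀ d, HasPartialAt i (fun z => coeff d (s z)) (coeff d v) z

theorem IsHolW.sub {V : Type*} [AddCommGroup V] [Module ℂ V] {f g : S → V} (hf : IsHolW f)
    (hg : IsHolW g) : IsHolW fun z => f z - g z := by
  simpa [sub_eq_add_neg] using hf.add (hg.map (LinearMap.lsmul ℂ V (-1 : ℂ)))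

theorem IsHolW.mul {f g : S → R} (h : IsHolW g) {W : Submodule ℂ R} (hf : FinHolIn W f) :
    IsHolW fun z => f z * g z := by
  have := hf.finite
  exact hf.hol.bilin h W hf.mem (LinearMap.mul ℂ R)

theorem FinHolIn.const {V : Type*} [AddCommGroup V] [Module ℂ V] (a : V) :
    FinHolIn (ℂ ∙ a) fun _ : S => a :=
  ⟨inferInstance, fun _ => Submodule.mem_span_singleton_self a, IsHolW.const a⟩

theorem FinHolIn.add {V : Type*} [AddCommGroup V] [Module ℂ V] {W W' : Submodule ℂ V}
    {f g : S → V} (hf : FinHolIn W f) (hg : FinHolIn W' g) :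
    FinHolIn (W ⊔ W') fun z => f z + g z := by
  have := hf.finite
  have := hg.finite
  exact ⟨inferInstance, fun z => Submodule.add_mem_sup (hf.mem z) (hg.mem z), hf.hol.add hg.hol⟩

theorem FinHolIn.exists_sum {V : Type*} [AddCommGroup V] [Module ℂ V] {ι : Type*} (t : Finset ι)
    {f : ι → S → V} (h : ∀ k, ∃ W, FinHolIn W (f k)) :
    ∃ W, FinHolIn W fun z => ∑ k ∈ t, f k z := by
  induction t using Finset.cons_induction with
  | empty => exact ⟨_, FinHolIn.const 0⟩
  | cons k t hk ih =>
    obtain ⟨W, hW⟩ := ih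
    obtain ⟨W', hW'⟩ := h k
    simp only [Finset.sum_cons]
    exact ⟨_, hW'.add hW⟩

theorem FinHolU.mul {s t : S → R⟦X⟧} (hs : FinHolU s) (ht : FinHolU t) :
    FinHolU fun z => s z * t z := by
  intro d
  simp only [coeff_mul]
  refine FinHolIn.exists_sum _ fun p => ?_
  obtain ⟨W, hW⟩ := hs p.1
  obtain ⟨W', hW'⟩ := ht p.2
  have h1 := hW.finite
  have h2 := hW'.finite
  exact ⟨Submodule.map₂ (LinearMap.mul ℂ R) W W', Module.Finite.iff_fg.2
      (Submodule.FG.map₂ _ (Module.Finite.iff_fg.1 h1) (Module.Finite.iff_fg.1 h2)),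
    fun z => Submodule.apply_mem_map₂ _ (hW.mem z) (hW'.mem z), hW'.hol.mul hW⟩

theorem FinHolU.exp {A : S → R⟦X⟧} (hA : FinHolU A) : FinHolU fun z => expP (A z) := by
  have hpow : ∀ m, FinHolU fun z => A z ^ m := by
    intro m
    induction m with
    | zero =>
      intro d
      simp only [pow_zero]
      exact ⟨_, FinHolIn.const _⟩
    | succ m ih =>
      simp only [pow_succ']
      exact hA.mul ih
  intro d
  simp only [expP, sumP, coeff_mk, expTerm, coeff_complex_smul]
  refine FinHolIn.exists_sum _ fun m => ?_
  obtain ⟨W, hW⟩ := hpow m d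
  exact ⟨W, hW.finite, fun z => W.smul_mem _ (hW.mem z), hW.hol.map (LinearMap.lsmul ℂ R _)⟩

namespace PartialU

variable {i : Fin n} {z : S}

theorem unique {s : S → R⟦X⟧} {v w : R⟦X⟧} (h : PartialU i s v z) (h' : PartialU i s w z) :
    v = w := PowerSeries.ext fun d => (h d).unique (h' d)

theorem add {s t : S → R⟦X⟧} {v w : R⟦X⟧} (h : PartialU i s v z) (h' : PartialU i t w z) :
    PartialU i (fun z => s z + t z) (v + w) z := fun d => by
  simpa only [map_add] using (h d).add (h' d)

theorem smul (c : ℂ) {s : S → R⟦X⟧} {v : R⟦X⟧} (h : PartialU i s v z) :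
    PartialU i (fun z => c • s z) (c • v) z := fun d =>
  (h d).map (LinearMap.lsmul ℂ R c)

theorem mul {s t : S → R⟦X⟧} {v w : R⟦X⟧} (hs : FinHolU s) (h : PartialU i s v z)
    (h' : PartialU i t w z) : PartialU i (fun z => s z * t z) (v * t z + s z * w) z := by
  intro d
  simp only [coeff_mul, map_add, ← Finset.sum_add_distrib]
  refine HasPartialAt.sum _ fun p _ => ?_
  obtain ⟨W, hW⟩ := hs p.1
  have := hW.finite
  exact (h p.1).bilin (h' p.2) W hW.mem (LinearMap.mul ℂ R)

/-- The version of the product rule in which the right factor is the one with finite-dimensional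
values. -/
theorem mul' {s t : S → R⟦X⟧} {v w : R⟦X⟧} (ht : FinHolU t) (h : PartialU i s v z)
    (h' : PartialU i t w z) : PartialU i (fun z => s z * t z) (v * t z + s z * w) z := by
  intro d
  simp only [coeff_mul, map_add, ← Finset.sum_add_distrib]
  refine HasPartialAt.sum _ fun p _ => ?_
  obtain ⟨W, hW⟩ := ht p.2
  have := hW.finite
  rw [add_comm]
  exact (h' p.2).bilin (h p.1) W hW.mem (LinearMap.mul ℂ R).flip

theorem const_mul (A : R⟦X⟧) {s : S → R⟦X⟧} {v : R⟦X⟧} (h : PartialU i s v z) :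
    PartialU i (fun z => A * s z) (A * v) z := by
  intro d
  simp only [coeff_mul]
  exact HasPartialAt.sum _ fun p _ => (h p.2).map (LinearMap.mulLeft ℂ (coeff p.1 A))

theorem map {R' : Type*} [Ring R'] [Algebra ℂ R'] (F : R →ₐ[ℂ] R') {s : S → R⟦X⟧} {v : R⟦X⟧}
    (h : PartialU i s v z) :
    PartialU i (fun z => PowerSeries.map F.toRingHom (s z)) (PowerSeries.map F.toRingHom v) z := by
  intro d
  exact (h d).map F.toLinearMap

theorem transport {S' : Set (Fin n → ℂ)} (hS : IsOpen S) (hS' : IsOpen S')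
    {j : Fin n} {s : S → R⟦X⟧} {t : S' → R⟦X⟧} {z' : S'} {v : R⟦X⟧} (h : PartialU i s v z)
    (hst : ∀ (u : ℂ) (w : S) (w' : S'), w.1 = z.1 + Pi.single i u → w'.1 = z'.1 + Pi.single j u →
      t w' = s w) : PartialU j t v z' := fun d =>
  (h d).transport hS hS' fun u w w' hw hw' => congrArg (coeff d) (hst u w w' hw hw')

theorem pow (hS : IsOpen S) {A : S → R⟦X⟧} {B : R⟦X⟧} (hA : FinHolU A) (h : PartialU i A B z)
    (m : ℕ) : PartialU i (fun z => A z ^ m) (powDeriv (A z) B m) z := by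
  induction m with
  | zero =>
    intro d
    simp only [pow_zero, powDeriv, map_zero]
    exact hasPartialAt_const hS i z _
  | succ m ih =>
    simp only [pow_succ', powDeriv]
    exact mul hA h ih

theorem sumP {P : ℕ → S → R⟦X⟧} {Q : ℕ → R⟦X⟧} (h : ∀ m, PartialU i (P m) (Q m) z) :
    PartialU i (fun z => sumP fun m => P m z) (sumP Q) z := by
  intro d
  simp only [KZB.sumP, coeff_mk]
  exact HasPartialAt.sum _ fun m _ => h m d

theorem exp (hS : IsOpen S) {A : S → R⟦X⟧} {B : R⟦X⟧} (hA : FinHolU A)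
    (hA1 : VanishesBelow 1 (A z)) (hB : VanishesBelow 1 B) (h : PartialU i A B z) :
    PartialU i (fun z => expP (A z))
      (expP (A z) * adP (fun k => (-1) ^ k * ((k + 1).factorial : ℂ)⁻¹) (A z) B) z := by
  rw [← sumP_powDeriv hA1 hB]
  exact sumP fun m => (pow hS hA h m).smul _

end PartialU

variable {L : Type} [LieRing L] [LieAlgebra ℂ L] {gr : ℕ → Submodule ℂ L}

theorem expU_eq (a : ℕ → L) : expU a = expP (toU a) := rfl

theorem coeff_toU (a : ℕ → L) (d : ℕ) :
    coeff d (toU a) = UniversalEnvelopingAlgebra.ι ℂ (a d) := coeff_mk _ _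

theorem Compl.seq_mem (a : Compl gr) (d : ℕ) : a.seq d ∈ gr d := (a d).2

theorem Compl.seq_zero (d : ℕ) : (0 : Compl gr).seq d = 0 := rfl

theorem Compl.seq_neg (a : Compl gr) (d : ℕ) : (-a).seq d = -a.seq d := rfl

theorem Compl.seq_sub (a b : Compl gr) (d : ℕ) : (a - b).seq d = a.seq d - b.seq d := by
  rw [sub_eq_add_neg, Compl.seq_add, Compl.seq_neg, sub_eq_add_neg]

theorem Compl.seq_sum {ι : Type*} (s : Finset ι) (f : ι → Compl gr) (d : ℕ) :
    (∑ i ∈ s, f i).seq d = ∑ i ∈ s, (f i).seq d :=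
  map_sum (⟨⟨fun a => a.seq d, rfl⟩, fun _ _ => rfl⟩ : Compl gr →+ L) f s

theorem toU_zero : toU (0 : Compl gr).seq = 0 := by
  ext d
  rw [coeff_toU, Compl.seq_zero, map_zero, map_zero]

theorem toU_add (a b : Compl gr) : toU (a + b).seq = toU a.seq + toU b.seq := by
  ext d
  simp only [map_add, coeff_toU, Compl.seq_add]

theorem toU_neg (a : Compl gr) : toU (-a).seq = -toU a.seq := by
  ext d
  simp only [map_neg, coeff_toU, Compl.seq_neg]

theorem toU_sub (a b : Compl gr) : toU (a - b).seq = toU a.seq - toU b.seq := by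
  ext d
  simp only [map_sub, coeff_toU, Compl.seq_sub]

theorem toU_sum {ι : Type*} (s : Finset ι) (f : ι → Compl gr) :
    toU (∑ i ∈ s, f i).seq = ∑ i ∈ s, toU (f i).seq := by
  ext d
  simp only [map_sum, coeff_toU, Compl.seq_sum]

variable (hgr : GoodGrading gr)
include hgr

theorem GoodGrading.seq_zero (a : Compl gr) : a.seq 0 = 0 := by
  have := a.seq_mem 0
  rwa [hgr.zero, Submodule.mem_bot] at this

theorem GoodGrading.vanishesBelow (a : Compl gr) : VanishesBelow 1 (toU a.seq) := by
  intro d hd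
  obtain rfl : d = 0 := by omega
  rw [coeff_toU, hgr.seq_zero, map_zero]

theorem GoodGrading.toU_injective {a b : Compl gr} (h : toU a.seq = toU b.seq) : a = b := by
  refine Compl.ext_seq fun d => sub_eq_zero.1
    (hgr.ι_injective d _ ((gr d).sub_mem (a.seq_mem d) (b.seq_mem d)) ?_)
  rw [map_sub, ← coeff_toU, ← coeff_toU, h, sub_self]

omit hgr in
theorem coeff_zero_expP {A : R⟦X⟧} : coeff 0 (expP A) = 1 := by
  simp [expP, sumP, expTerm]

omit hgr in
theorem coeff_zero_of_mem_expGroup {s : UHat L} (h : s ∈ ExpGroup gr) : coeff 0 s = 1 := by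
  obtain ⟨a, rfl⟩ := h
  exact coeff_zero_expP

/-- A Lie algebra valued sequence is holomorphic if its image in the enveloping algebra is. -/
theorem GoodGrading.finHolIn_of_ι {f : S → L} {d : ℕ} (hf : ∀ z, f z ∈ gr d)
    (h : IsHolW fun z => UniversalEnvelopingAlgebra.ι ℂ (f z)) : FinHolIn (gr d) f := by
  refine ⟨hgr.finite d, hf, ?_⟩
  let F : gr d →ₗ[ℂ] UniversalEnvelopingAlgebra ℂ L :=
    (UniversalEnvelopingAlgebra.ι ℂ (L := L) : L →ₗ[ℂ] _) ∘ₗ (gr d).subtype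
  -- On `gr d` the map `ι` is injective, so it has a linear left inverse, through which holomorphy
  -- passes back to `f`.
  obtain ⟨G, hG⟩ := F.exists_leftInverse_of_injective (LinearMap.ker_eq_bot'.2 fun a ha =>
    Subtype.ext (hgr.ι_injective d a.1 a.2 ha))
  have h1 := h.map ((gr d).subtype ∘ₗ G)
  have h2 : ∀ z, ((gr d).subtype ∘ₗ G) (UniversalEnvelopingAlgebra.ι ℂ (f z)) = f z := fun z =>
    congrArg Subtype.val (LinearMap.congr_fun hG ⟨f z, hf z⟩)
  simpa only [h2] using h1

theorem GoodGrading.finHolIn_map_ι {f : S → L} {d : ℕ} (h : FinHolIn (gr d) f) :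
    FinHolIn ((gr d).map (UniversalEnvelopingAlgebra.ι ℂ (L := L) : L →ₗ[ℂ] _))
      (fun z => UniversalEnvelopingAlgebra.ι ℂ (f z)) := by
  have := hgr.finite d
  exact ⟨inferInstance, fun z => ⟨f z, h.mem z, rfl⟩, h.hol.map _⟩

theorem GoodGrading.finHolU {a : S → Compl gr} (h : ∀ d, IsHolW fun z => (a z).seq d) :
    FinHolU fun z => toU (a z).seq := by
  intro d
  simp only [coeff_toU]
  exact ⟨_, hgr.finHolIn_map_ι ⟨hgr.finite d, fun z => (a z).seq_mem d, h d⟩⟩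

/-- The logarithm of a holomorphic map is holomorphic. -/
theorem GoodGrading.hol_log {a : S → Compl gr} (h : HolU fun z => expU (a z).seq) (d : ℕ) :
    IsHolW fun z => (a z).seq d := by
  induction d using Nat.strong_induction_on with | _ d ih => ?_
  have hlow : ∀ m, ∀ e < d, IsHolW fun z => coeff e (toU (a z).seq ^ m) := by
    intro m
    induction m with
    | zero =>
      intro e _
      simp only [pow_zero]
      exact IsHolW.const _
    | succ m ihm =>
      intro e he
      simp only [pow_succ', coeff_mul]
      refine IsHolW.sum _ fun p hp => ?_
      rw [mem_antidiagonal] at hp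
      refine (ihm p.2 (by omega)).mul (W := (gr p.1).map
        (UniversalEnvelopingAlgebra.ι ℂ (L := L) : L →ₗ[ℂ] _)) ?_
      simp only [coeff_toU]
      exact hgr.finHolIn_map_ι ⟨hgr.finite p.1, fun z => (a z).seq_mem _, ih p.1 (by omega)⟩
  -- As `a` has no constant term, the degree `d` part of a power with exponent at least 2 involves
  -- only components of `a` of degree strictly between `0` and `d`.
  have hhigh : ∀ m, IsHolW fun z => coeff d (toU (a z).seq ^ (m + 2)) := by
    intro m
    simp only [pow_succ' _ (m + 1), coeff_mul]
    refine IsHolW.sum _ fun p hp => ?_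
    rw [mem_antidiagonal] at hp
    rcases Nat.eq_zero_or_pos p.1 with h0 | h0
    · have : ∀ z, coeff p.1 (toU (a z).seq) = 0 := fun z => hgr.vanishesBelow (a z) _ (by omega)
      simp only [this, zero_mul]
      exact IsHolW.const _
    rcases Nat.eq_zero_or_pos p.2 with h1 | h1
    · have : ∀ z, coeff p.2 (toU (a z).seq ^ (m + 1)) = 0 := fun z =>
        (hgr.vanishesBelow (a z)).pow (m + 1) _ (by omega)
      simp only [this, mul_zero]
      exact IsHolW.const _
    refine (hlow _ p.2 (by omega)).mul (W := (gr p.1).map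
      (UniversalEnvelopingAlgebra.ι ℂ (L := L) : L →ₗ[ℂ] _)) ?_
    simp only [coeff_toU]
    exact hgr.finHolIn_map_ι ⟨hgr.finite p.1, fun z => (a z).seq_mem _, ih p.1 (by omega)⟩
  rcases Nat.eq_zero_or_pos d with rfl | hd
  · simp only [hgr.seq_zero]
    exact IsHolW.const _
  refine (hgr.finHolIn_of_ι (fun z => (a z).seq_mem d) ?_).hol
  obtain ⟨e, rfl⟩ : ∃ e, d = e + 1 := ⟨d - 1, by omega⟩
  -- Solve the degree `d` part of the exponential series for its linear term: all other terms are
  -- holomorphic by induction.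
  have h1 : ∀ z, UniversalEnvelopingAlgebra.ι ℂ ((a z).seq (e + 1)) =
      coeff (e + 1) (expU (a z).seq) + (-1 : ℂ) • ∑ m ∈ Finset.range e,
        (((m + 2).factorial : ℂ)⁻¹) • coeff (e + 1) (toU (a z).seq ^ (m + 2)) := by
    intro z
    rw [expU, coeff_mk, Finset.sum_range_succ', Finset.sum_range_succ', pow_zero, coeff_one,
      if_neg (by omega), zero_add, pow_one, coeff_toU]
    simp
  simp only [h1]
  refine (h (e + 1)).add (IsHolW.map (IsHolW.sum _ fun m _ => ?_) (LinearMap.lsmul ℂ _ (-1 : ℂ)))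
  exact (hhigh m).map (LinearMap.lsmul ℂ _ _)

/-- The product rule needs finite-dimensional values. They are obtained by passing to the logarithm,
whose components lie in the finite-dimensional spaces `gr d`, and exponentiating back. -/
theorem GoodGrading.finHolU_exp {s : S → UHat L} (hs : ∀ z, s z ∈ ExpGroup gr) (hol : HolU s) :
    FinHolU s := by
  choose a ha using hs
  obtain rfl : s = fun z => expU (a z).seq := funext ha
  exact (hgr.finHolU (hgr.hol_log hol)).exp

variable [SetLike.GradedBracket gr]

omit hgr in
theorem toU_lie (a b : Compl gr) :
    toU ⁅a, b⁆.seq = toU a.seq * toU b.seq - toU b.seq * toU a.seq := by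
  ext d
  rw [coeff_toU, Compl.seq_lie, map_sub, coeff_mul, coeff_mul,
    ← Finset.Nat.sum_antidiagonal_swap (f := fun p => coeff p.1 (toU b.seq) * coeff p.2 (toU a.seq)),
    ← Finset.sum_sub_distrib, map_sum]
  refine Finset.sum_congr rfl fun p _ => ?_
  simp only [coeff_toU, LieHom.map_lie, LieRing.of_associative_ring_bracket, Prod.fst_swap,
    Prod.snd_swap]

omit hgr in
theorem toU_ad_pow (a b : Compl gr) (k : ℕ) :
    toU ((LieAlgebra.ad ℂ (Compl gr) a ^ k) b).seq = adPow (toU a.seq) k (toU b.seq) := by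
  induction k with
  | zero => rfl
  | succ k ih =>
    rw [pow_succ', Module.End.mul_apply, LieAlgebra.ad_apply, toU_lie, ih, adPow_succ]

omit hgr in
theorem Compl.seq_evalAd (F : PowerSeries ℂ) (a b : Compl gr) (d : ℕ) :
    (Compl.evalAd F a b).seq d = ∑ m ∈ Finset.range (d + 1),
      coeff m F • ((LieAlgebra.ad ℂ (Compl gr) a ^ m) b).seq d := by
  change ((∑ m ∈ Finset.range (d + 1),
    coeff m F • ((LieAlgebra.ad ℂ (Compl gr) a ^ m) b) d : gr d) : L) = _
  rw [AddSubmonoidClass.coe_finsetSum]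
  rfl

omit hgr in
theorem toU_evalAd (F : PowerSeries ℂ) (a b : Compl gr) :
    toU (Compl.evalAd F a b).seq = adP (fun k => coeff k F) (toU a.seq) (toU b.seq) := by
  ext d
  rw [coeff_toU, Compl.seq_evalAd, map_sum, adP, sumP, coeff_mk]
  refine Finset.sum_congr rfl fun m _ => ?_
  rw [map_smul, ← coeff_toU, toU_ad_pow]
  rfl

theorem GoodGrading.hol_lie {a b : S → Compl gr} (ha : ∀ d, IsHolW fun z => (a z).seq d)
    (hb : ∀ d, IsHolW fun z => (b z).seq d) (d : ℕ) : IsHolW fun z => ⁅a z, b z⁆.seq d := by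
  simp only [Compl.seq_lie]
  refine IsHolW.sum _ fun p _ => ?_
  have := hgr.finite p.1
  exact (ha p.1).bilin (hb p.2) (gr p.1) (fun z => (a z).seq_mem _)
    (LieModule.toEnd ℂ L L : L →ₗ[ℂ] Module.End ℂ L)

theorem GoodGrading.hol_evalAd (F : PowerSeries ℂ) {a b : S → Compl gr}
    (ha : ∀ d, IsHolW fun z => (a z).seq d) (hb : ∀ d, IsHolW fun z => (b z).seq d) (d : ℕ) :
    IsHolW fun z => (Compl.evalAd F (a z) (b z)).seq d := by
  simp only [Compl.seq_evalAd]
  refine IsHolW.sum _ fun m _ => IsHolW.map ?_ (LinearMap.lsmul ℂ L (coeff m F))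
  have : ∀ k d, IsHolW fun z => ((LieAlgebra.ad ℂ (Compl gr) (a z) ^ k) (b z)).seq d := by
    intro k
    induction k with
    | zero => exact hb
    | succ k ih =>
      intro d
      simp only [pow_succ', Module.End.mul_apply, LieAlgebra.ad_apply]
      exact hgr.hol_lie ha ih d
  exact this m d

theorem GoodGrading.exists_partial (hS : IsOpen S) {a : S → Compl gr}
    (ha : ∀ d, IsHolW fun z => (a z).seq d) (i : Fin n) :
    ∃ a' : S → Compl gr, (∀ d, IsHolW fun z => (a' z).seq d) ∧
      ∀ d z, HasPartialAt i (fun z => (a z).seq d) ((a' z).seq d) z := by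
  have h : ∀ d, FinHolIn (gr d) fun z => (a z).seq d := fun d =>
    ⟨hgr.finite d, fun z => (a z).seq_mem d, ha d⟩
  choose f' hf' hp using fun d => (h d).exists_partial hS i
  exact ⟨fun z d => ⟨f' d z, (hf' d).mem z⟩, fun d => (hf' d).hol, hp⟩

omit hgr [SetLike.GradedBracket gr] in
theorem partialU_toU {a : S → Compl gr} {a' : Compl gr} {i : Fin n} {z : S}
    (h : ∀ d, HasPartialAt i (fun z => (a z).seq d) (a'.seq d) z) :
    PartialU i (fun z => toU (a z).seq) (toU a'.seq) z := fun d => by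
  simp only [coeff_toU]
  exact (h d).map (UniversalEnvelopingAlgebra.ι ℂ (L := L) :
    L →ₗ[ℂ] UniversalEnvelopingAlgebra ℂ L)

/-- The covariant derivatives `s⁻¹ (∂_i - K_i) s` of a holomorphic map to `exp(L^)` are holomorphic
maps to the completion of `L`. -/
theorem GoodGrading.exists_form (hS : IsOpen S) {s : S → UHat L} (hs : ∀ z, s z ∈ ExpGroup gr)
    (hol : HolU s) {K : Fin n → S → Compl gr} (hK : ∀ i d, IsHolW fun z => (K i z).seq d) :
    ∃ α : Fin n → S → Compl gr, (∀ i d, IsHolW fun z => (α i z).seq d) ∧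
      ∀ i z, PartialU i s (toU (K i z).seq * s z + s z * toU (α i z).seq) z := by
  choose a ha using hs
  have hs' : s = fun z => expU (a z).seq := funext ha
  subst hs'
  have hahol := hgr.hol_log hol
  choose a' ha' hp using fun i => hgr.exists_partial hS hahol i
  -- For `s = e^a` one has `s⁻¹ ∂_i s = ((1 - e^{-ad a}) / ad a)(∂_i a)` and `s⁻¹ K_i s = e^{-ad a}
  -- K_i`. Both are series in `ad a`, hence stay in the completion of `L`.
  refine ⟨fun i z =>
    Compl.evalAd (PowerSeries.mk fun k => (-1) ^ k * ((k + 1).factorial : ℂ)⁻¹) (a z) (a' i z) -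
    Compl.evalAd (PowerSeries.mk fun k => (-1) ^ k * (k.factorial : ℂ)⁻¹) (a z) (K i z),
    fun i d => ?_, fun i z => ?_⟩
  · exact (hgr.hol_evalAd _ hahol (ha' i) d).sub (hgr.hol_evalAd _ hahol (hK i) d)
  · beta_reduce
    rw [toU_sub, toU_evalAd, toU_evalAd, expU_eq, mul_expP (hgr.vanishesBelow _), ← mul_add]
    simp only [coeff_mk, expU_eq, add_sub_cancel]
    exact PartialU.exp hS (hgr.finHolU hahol) (hgr.vanishesBelow _) (hgr.vanishesBelow _)
      (partialU_toU fun d => hp i d z)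

end HolomorphicExponentials

/-! ### Existence of the connection `d - ∑ K_i dz_i`. -/

section ConnectionsFromForms

open PowerSeries

attribute [local instance] LieRing.ofAssociativeRing

variable {n : ℕ} {τ : UpperHalfPlane} {B : Type} [TopologicalSpace B]
  {L : Type} [LieRing L] [LieAlgebra ℂ L] {gr : ℕ → Submodule ℂ L}

theorem IsHolW.restrict {V : Type*} [AddCommGroup V] [Module ℂ V] {S S' : Set (Fin n → ℂ)}
    (hS : S' ⊆ S) {f : S → V} (h : IsHolW f) : IsHolW fun z : S' => f ⟨z.1, hS z.2⟩ := fun φ =>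
  ((h φ).mono hS).congr fun z hz => by rw [zeroExt_apply _ hz, zeroExt_apply _ (hS hz)]

theorem preim_subset (p : dom n τ → B) (U : TopologicalSpace.Opens B) : preim p U ⊆ dom n τ :=
  fun _ hz => hz.choose

/-- The inclusion of the preimage of `U`. -/
def preimIncl (p : dom n τ → B) (U : TopologicalSpace.Opens B) (z : preim p U) : dom n τ :=
  ⟨z.1, z.2.choose⟩

/-- The hypotheses under which `d - ∑ K_i dz_i` defines a connection on a bundle on `B`. -/
structure DescentData (gr : ℕ → Submodule ℂ L) (p : dom n τ → B) (m : Automorphy n L)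
    (K : Fin n → dom n τ → Compl gr) : Prop where
  good : GoodGrading gr
  isOpen_dom : IsOpen (dom n τ)
  continuous : Continuous p
  surjective : Function.Surjective p
  hol : ∀ i d, IsHolW fun z => (K i z).seq d
  mem_dom : ∀ v g, m v g → ∀ z, z + v ∈ dom n τ ↔ z ∈ dom n τ
  invariant : ∀ v g, m v g → ∀ z z' : dom n τ, z'.1 = z.1 + v → p z' = p z
  equivariant : ∀ v g, m v g → ∀ z z' : dom n τ, z'.1 = z.1 + v → ∀ i,
    toU (K i z').seq * g = g * toU (K i z).seq
  fibre : ∀ z z', p z = p z' → z'.1 - z.1 ∈ AddSubgroup.closure {v | ∃ g, m v g}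
  tangent : ∀ v, TangentToFibres p v → v = 0 ∨
    ((∃ c : ℂ, v = fun _ => c) ∧ (∀ z, ∑ i, K i z = 0) ∧ ∀ u : ℂ, m (fun _ => u) 1)

/-- The value `s z` has constant term 1 and can be cancelled on the left; then the image in the
enveloping algebra determines the element of the completion. -/
theorem form_unique (hgr : GoodGrading gr) {S : Set (Fin n → ℂ)} {s : S → UHat L} {i : Fin n}
    {z : S} (hs : s z ∈ ExpGroup gr) {k : UHat L} {a b : Compl gr}
    (ha : PartialU i s (k * s z + s z * toU a.seq) z)
    (hb : PartialU i s (k * s z + s z * toU b.seq) z) : a = b :=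
  hgr.toU_injective (mul_left_cancel_of_coeff_zero (coeff_zero_of_mem_expGroup hs)
    (add_left_cancel (ha.unique hb)))

namespace DescentData

variable {p : dom n τ → B} {m : Automorphy n L} {K : Fin n → dom n τ → Compl gr}
  (hD : DescentData gr p m K)
include hD

theorem isOpen_preim (U : TopologicalSpace.Opens B) : IsOpen (preim p U) := by
  have h : preim p U = Subtype.val '' (p ⁻¹' U) := by
    ext z
    exact ⟨fun ⟨h, hz⟩ => ⟨⟨z, h⟩, hz, rfl⟩, by rintro ⟨⟨w, h⟩, hw, rfl⟩; exact ⟨h, hw⟩⟩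
  rw [h]
  exact hD.isOpen_dom.isOpenMap_subtype_val _ (U.2.preimage hD.continuous)

theorem pt_surjective (U : TopologicalSpace.Opens B) : Function.Surjective (pt p U) := by
  intro b
  obtain ⟨z, hz⟩ := hD.surjective b.1
  exact ⟨⟨z.1, z.2, by rw [hz]; exact b.2⟩, Subtype.ext hz⟩

theorem mem_preim (U : TopologicalSpace.Opens B) {v : Fin n → ℂ} {g : UHat L} (h : m v g)
    (z : Fin n → ℂ) : z + v ∈ preim p U ↔ z ∈ preim p U := by
  constructor
  · rintro ⟨h1, h2⟩
    have h3 := (hD.mem_dom v g h z).1 h1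
    refine ⟨h3, ?_⟩
    rwa [← hD.invariant v g h ⟨z, h3⟩ ⟨_, h1⟩ rfl]
  · rintro ⟨h1, h2⟩
    have h3 := (hD.mem_dom v g h z).2 h1
    refine ⟨h3, ?_⟩
    rwa [hD.invariant v g h ⟨z, h1⟩ ⟨_, h3⟩ rfl]

/-- A function on the preimage of `U` that is invariant under the translations occurring in the
factors of automorphy is constant on the fibres of `p`. -/
theorem eq_of_pt_eq {X : Type*} (U : TopologicalSpace.Opens B) (F : preim p U → X)
    (hF : ∀ v g, m v g → ∀ z z' : preim p U, z'.1 = z.1 + v → F z' = F z) {z z' : preim p U}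
    (h : pt p U z = pt p U z') : F z = F z' := by
  -- Invariance of the domain is carried through the induction, because the intermediate points of a
  -- chain of generators have to lie in it.
  have key : ∀ w ∈ AddSubgroup.closure {v | ∃ g, m v g}, ∀ z, (z + w ∈ preim p U ↔ z ∈ preim p U) ∧
      ∀ (h : z + w ∈ preim p U) (h' : z ∈ preim p U), F ⟨_, h⟩ = F ⟨z, h'⟩ := by
    intro w hw
    induction hw using AddSubgroup.closure_induction with
    | mem v hv =>
      obtain ⟨g, hg⟩ := hv
      exact fun z => ⟨hD.mem_preim U hg z, fun h h' => hF v g hg _ _ rfl⟩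
    | zero =>
      exact fun z => ⟨by rw [add_zero], fun h h' => congrArg F (Subtype.ext (add_zero _))⟩
    | add v w _ _ hv hw =>
      intro z
      rw [← add_assoc]
      refine ⟨(hw (z + v)).1.trans (hv z).1, fun h h' => ?_⟩
      exact ((hw (z + v)).2 h ((hv z).1.2 h')).trans ((hv z).2 _ h')
    | neg v _ hv =>
      intro z
      have h1 := hv (z + -v)
      rw [neg_add_cancel_right] at h1
      refine ⟨h1.1.symm, fun h h' => (h1.2 h' h).symm⟩
  have h1 : p (preimIncl p U z) = p (preimIncl p U z') := congrArg Subtype.val h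
  have h2 := key _ (hD.fibre _ _ h1) z.1
  have h3 : z.1 + ((preimIncl p U z').1 - (preimIncl p U z).1) = z'.1 := add_sub_cancel _ _
  rw [← h2.2 (by rw [h3]; exact z'.2) z.2]
  exact congrArg F (Subtype.ext h3)

theorem exists_section_form (U : TopologicalSpace.Opens B) (s : BundleSection gr p m U)
    [SetLike.GradedBracket gr] :
    ∃ F : Form gr p U, ∀ i z, PartialU i s.val
      (toU (K i (preimIncl p U z)).seq * s.val z + s.val z * toU (F.coeff i (pt p U z)).seq) z := by
  have hS := hD.isOpen_preim U
  have hol : HolU s.val := fun d => isHol_iff.1 s.hol d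
  obtain ⟨α, hα, hp⟩ := hD.good.exists_form hS s.mem_exp hol
    (K := fun i z => K i (preimIncl p U z)) (fun i d => (hD.hol i d).restrict (preim_subset p U))
  -- Translation multiplies `s` on the left by the constant `g` and conjugates `K_i` by `g`; thus `α
  -- i z` solves the equation that characterises `α i z'`.
  have hinv : ∀ i v g, m v g → ∀ z z' : preim p U, z'.1 = z.1 + v → α i z' = α i z := by
    intro i v g hg z z' hz
    refine form_unique hD.good (s.mem_exp z') (hp i z') ?_
    rw [s.equivariant v g hg z z' hz, ← mul_assoc,
      hD.equivariant v g hg (preimIncl p U z) (preimIncl p U z') hz, mul_assoc, mul_assoc, ← mul_add]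
    refine ((hp i z).const_mul g).transport hS hS fun u w w' hw hw' => ?_
    refine s.equivariant v g hg w w' ?_
    rw [hw, hw', hz, add_right_comm]
  choose lift hlift using hD.pt_surjective U
  have hcoeff : ∀ i z, α i (lift (pt p U z)) = α i z := fun i z =>
    hD.eq_of_pt_eq U (α i) (hinv i) (hlift _)
  refine ⟨⟨fun i b => α i (lift b), fun i => isHol_iff.2 fun d => ?_, fun v hv b => ?_⟩,
    fun i z => ?_⟩
  · simp only [hcoeff]
    exact hα i d
  · rcases hD.tangent v hv with rfl | ⟨⟨c, rfl⟩, hK, hm⟩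
    · simp
    · rw [← Finset.smul_sum]
      refine smul_eq_zero_of_right c ?_
      set z := lift b
      refine hD.good.toU_injective (mul_left_cancel_of_coeff_zero
        (coeff_zero_of_mem_expGroup (s.mem_exp z)) ?_)
      -- The left side is the derivative of `s` along the diagonal, on which `s` is constant. As `∑
      -- K_i = 0`, what remains is `s ∑ α_i = 0`.
      have h1 : ∑ i, (toU (K i (preimIncl p U z)).seq * s.val z + s.val z * toU (α i z).seq) = 0 := by
        ext d
        rw [map_sum]
        refine IsHolW.sum_partial hS (hol d) (fun i => hp i z d) fun u w hw => ?_
        rw [s.equivariant _ 1 (hm u) z w hw, one_mul]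
      rw [Finset.sum_add_distrib, ← Finset.sum_mul, ← Finset.mul_sum, ← toU_sum, ← toU_sum, hK,
        toU_zero, zero_mul, zero_add] at h1
      rw [h1, toU_zero, mul_zero]
  · simp only [hcoeff]
    exact hp i z

end DescentData

/-- The defining property of the connection `d - ∑ K_i dz_i`. -/
theorem isGivenBy_iff {p : dom n τ → B} {m : Automorphy n L} {K : Fin n → dom n τ → Compl gr}
    {D : Connection gr p m} : D.IsGivenBy (fun i z => (K i z).seq) ↔
      ∀ (U : TopologicalSpace.Opens B) (s : BundleSection gr p m U) i z, PartialU i s.val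
        (toU (K i (preimIncl p U z)).seq * s.val z +
          s.val z * toU ((D.form U s).coeff i (pt p U z)).seq) z := by
  refine forall_congr' fun U => forall_congr' fun s => forall_congr' fun i => ?_
  rw [hasPartial_iff]
  exact ⟨fun h z d => h d z, fun h d z => h z d⟩

namespace DescentData

variable {p : dom n τ → B} {m : Automorphy n L} {K : Fin n → dom n τ → Compl gr}
  (hD : DescentData gr p m K)
include hD

theorem form_coeff_eq {D : Connection gr p m} (hK : D.IsGivenBy (fun i z => (K i z).seq))
    {U : TopologicalSpace.Opens B} {s : BundleSection gr p m U} {i : Fin n} {z : preim p U}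
    {a : Compl gr} (ha : PartialU i s.val
      (toU (K i (preimIncl p U z)).seq * s.val z + s.val z * toU a.seq) z) :
    (D.form U s).coeff i (pt p U z) = a :=
  form_unique hD.good (s.mem_exp z) (isGivenBy_iff.1 hK U s i z) ha

theorem exists_connection [SetLike.GradedBracket gr] :
    ∃ D : Connection gr p m, D.IsGivenBy (fun i z => (K i z).seq) := by
  choose F hF using fun U s => hD.exists_section_form U s
  refine ⟨⟨fun U s => F U s, fun U V hVU s s' hss i b => ?_, fun U s s' g hg hol hs i => ?_⟩,
    isGivenBy_iff.2 hF⟩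
  · obtain ⟨z, rfl⟩ := hD.pt_surjective V b
    have hz : z.1 ∈ preim p U := ⟨z.2.choose, hVU _ z.2.choose_spec⟩
    refine form_unique hD.good (s'.mem_exp z) (hF V s' i z) ?_
    rw [hss ⟨z.1, hz⟩ z rfl]
    exact (hF U s i ⟨z.1, hz⟩).transport (hD.isOpen_preim U) (hD.isOpen_preim V)
      fun u w w' hw hw' => hss w w' (hw.trans hw'.symm)
  · rw [hasPartial_iff]
    intro d z
    have hS := hD.isOpen_preim U
    set k := toU (K i (preimIncl p U z)).seq
    set α := toU ((F U s).coeff i (pt p U z)).seq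
    set α' := toU ((F U s').coeff i (pt p U z)).seq
    -- Taking `K = 0` gives `β` with `∂_i g = g β`. Comparing the product rule for `s g` with the
    -- equation of `s'` yields `g β = g α' - α g`.
    obtain ⟨β, -, hβ⟩ := hD.good.exists_form (s := fun z : preim p U => g (pt p U z))
      (K := fun _ _ => 0) hS (fun z => hg _) (fun d => isHol_iff.1 hol d)
      (fun i d => IsHolW.const _)
    have hg' := hβ i z
    rw [toU_zero, zero_mul, zero_add] at hg'
    have h1 := PartialU.mul (hD.good.finHolU_exp s.mem_exp fun d => isHol_iff.1 s.hol d)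
      (hF U s i z) hg'
    simp only [← hs] at h1
    have h2 := h1.unique (hF U s' i z)
    have h3 : g (pt p U z) * toU (β i z).seq = g (pt p U z) * α' - α * g (pt p U z) := by
      refine mul_left_cancel_of_coeff_zero (coeff_zero_of_mem_expGroup (s.mem_exp z)) ?_
      rw [hs z] at h2
      rw [mul_sub, ← mul_assoc _ _ α', ← mul_assoc _ α, eq_sub_iff_add_eq]
      rw [add_mul, add_assoc, mul_assoc k, add_right_inj, add_comm] at h2
      exact h2
    rw [h3] at hg'
    exact hg' d

end DescentData
end ConnectionsFromForms

/-! ### Flatness, invariance, change of group and pull-back. -/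

section PropertiesOfConnections

open PowerSeries

attribute [local instance] LieRing.ofAssociativeRing

variable {n : ℕ} {τ : UpperHalfPlane} {B : Type} [TopologicalSpace B]
  {L : Type} [LieRing L] [LieAlgebra ℂ L] {gr : ℕ → Submodule ℂ L}
  {L' : Type} [LieRing L'] [LieAlgebra ℂ L'] {gr' : ℕ → Submodule ℂ L'}

/-- The map of completions induced by a graded Lie algebra morphism. -/
def Compl.map (f : L →ₗ⁅ℂ⁆ L') (hf : ∀ d, ∀ a ∈ gr d, f a ∈ gr' d) (a : Compl gr) : Compl gr' :=
  fun d => ⟨f (a.seq d), hf d _ (a.seq_mem d)⟩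

theorem Compl.seq_map (f : L →ₗ⁅ℂ⁆ L') (hf : ∀ d, ∀ a ∈ gr d, f a ∈ gr' d) (a : Compl gr) (d : ℕ) :
    (a.map f hf).seq d = f (a.seq d) := rfl

theorem Compl.map_lie [SetLike.GradedBracket gr] [SetLike.GradedBracket gr'] (f : L →ₗ⁅ℂ⁆ L')
    (hf : ∀ d, ∀ a ∈ gr d, f a ∈ gr' d) (a b : Compl gr) :
    ⁅a, b⁆.map f hf = ⁅a.map f hf, b.map f hf⁆ := by
  refine Compl.ext_seq fun d => ?_
  simp only [Compl.seq_map, Compl.seq_lie, map_sum, LieHom.map_lie]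

theorem mapU_toU (f : L →ₗ⁅ℂ⁆ L') (a : ℕ → L) : mapU f (toU a) = toU fun d => f (a d) := by
  ext d
  rw [coeff_toU, mapU, coeff_map, coeff_toU]
  exact UniversalEnvelopingAlgebra.lift_ι_apply ℂ _ _

theorem mapU_expU (f : L →ₗ⁅ℂ⁆ L') (a : ℕ → L) : mapU f (expU a) = expU fun d => f (a d) := by
  ext d
  rw [expU, expU, coeff_mk, mapU, coeff_map, coeff_mk, map_sum]
  refine Finset.sum_congr rfl fun m _ => ?_
  rw [← mapU_toU, ← map_pow, mapU, coeff_map]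
  exact map_smul (UniversalEnvelopingAlgebra.lift ℂ
    ((UniversalEnvelopingAlgebra.ι ℂ (L := L')).comp f)) _ _

theorem PartialU.mapU (f : L →ₗ⁅ℂ⁆ L') {S : Set (Fin n → ℂ)} {s : S → UHat L} {v : UHat L}
    {i : Fin n} {z : S} (h : PartialU i s v z) :
    PartialU i (fun z => KZB.mapU f (s z)) (KZB.mapU f v) z :=
  h.map (UniversalEnvelopingAlgebra.lift ℂ ((UniversalEnvelopingAlgebra.ι ℂ (L := L')).comp f))

namespace DescentData

variable {p : dom n τ → B} {m : Automorphy n L} {K : Fin n → dom n τ → Compl gr}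

theorem connection_unique (hD : DescentData gr p m K) {D D' : Connection gr p m}
    (h : D.IsGivenBy (fun i z => (K i z).seq))
    (h' : D'.IsGivenBy (fun i z => (K i z).seq)) : D' = D := by
  refine Connection.ext (funext fun U => funext fun s => Form.ext (funext fun i => funext fun b => ?_))
  obtain ⟨z, rfl⟩ := hD.pt_surjective U b
  exact hD.form_coeff_eq h' (isGivenBy_iff.1 h U s i z)

/-- Differentiate `∂_i s = K_i s + s α_i` once more. Equality of mixed partials gives `F_K s = s
F_α`, where `F_K = -∂_i K_j + ∂_j K_i + [K_i, K_j]` and `F_α = ∂_i α_j - ∂_j α_i + [α_i, α_j]`; then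
`s` is cancelled. -/
theorem isFlat [SetLike.GradedBracket gr] (hD : DescentData gr p m K) {D : Connection gr p m}
    (h : D.IsGivenBy (fun i z => (K i z).seq)) {dK : Fin n → Fin n → dom n τ → Compl gr}
    (hdK : ∀ i j, HasPartial (dom n τ) i (fun z => (K j z).seq) (fun z => (dK i j z).seq))
    (hflat : ∀ i j z, -dK i j z + dK j i z + ⁅K i z, K j z⁆ = 0) : D.IsFlat := by
  intro U s
  have hS := hD.isOpen_preim U
  have hα : ∀ i d, IsHolW fun z => ((D.form U s).coeff i (pt p U z)).seq d := fun i d =>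
    isHol_iff.1 ((D.form U s).hol i) d
  choose dα _ hdα using fun j i => hD.good.exists_partial hS (hα j) i
  refine ⟨fun i j => dα j i, fun i j => hasPartial_iff.2 (hdα j i), fun i j z => ?_⟩
  have hs : ∀ i z, PartialU i s.val _ z := fun i z => isGivenBy_iff.1 h U s i z
  have hk : ∀ i j, PartialU j (fun z => toU (K i (preimIncl p U z)).seq)
      (toU (dK j i (preimIncl p U z)).seq) z := fun i j => by
    refine partialU_toU fun d => ?_
    refine (hasPartial_iff.1 (hdK j i) d (preimIncl p U z)).transport hD.isOpen_dom hS
      fun u w w' hw hw' => ?_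
    have : preimIncl p U w' = w := Subtype.ext (hw'.trans hw.symm)
    rw [this]
  have h2 : ∀ i j, PartialU j (fun z => toU (K i (preimIncl p U z)).seq * s.val z +
      s.val z * toU ((D.form U s).coeff i (pt p U z)).seq) _ z := fun i j =>
    (PartialU.mul (hD.good.finHolU fun d => (hD.hol i d).restrict (preim_subset p U))
      (hk i j) (hs j z)).add
    (PartialU.mul' (hD.good.finHolU (hα i)) (hs j z) (partialU_toU fun d => hdα i j d z))
  have hcomm := PowerSeries.ext fun d => IsHolW.partial_comm hS (isHol_iff.1 s.hol d)
    (fun z => hs i z d) (fun z => hs j z d) (h2 i j d) (h2 j i d)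
  have hfl := congrArg (fun a : Compl gr => toU a.seq * s.val z) (hflat i j (preimIncl p U z))
  simp only [toU_add, toU_neg, toU_lie, toU_zero, zero_mul] at hfl
  refine hD.good.toU_injective (mul_left_cancel_of_coeff_zero
    (coeff_zero_of_mem_expGroup (s.mem_exp z)) ?_)
  rw [toU_add, toU_sub, toU_lie, toU_zero, mul_zero]
  rw [← sub_eq_zero, show (⟨z.1, preim_subset p U z.2⟩ : dom n τ) = preimIncl p U z from rfl]
    at hcomm
  rw [← sub_zero (0 : UHat L)]
  nth_rewrite 1 [← hfl]
  rw [← hcomm]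
  noncomm_ring

/-- Applying `σ` to the equation of `s` gives the equation of the transported section, since `K` is
equivariant; uniqueness of the form concludes. Change of group and pull-back follow the same
pattern. -/
theorem isSymmInvariant (hD : DescentData gr p m K) {D : Connection gr p m}
    (h : D.IsGivenBy (fun i z => (K i z).seq)) (act : Equiv.Perm (Fin n) → L →ₗ⁅ℂ⁆ L)
    (hact : ∀ σ d, ∀ a ∈ gr d, act σ a ∈ gr d)
    (hK : ∀ σ i (z z' : dom n τ), z'.1 = z.1 ∘ ⇑(Equiv.symm σ) →
      ∀ d, (K (σ i) z').seq d = act σ ((K i z).seq d)) : D.IsSymmInvariant act := by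
  intro σ U V s s' hs z z' hz i d
  have h1 := ((isGivenBy_iff.1 h U s i z).mapU (act σ)).transport (hD.isOpen_preim U)
    (hD.isOpen_preim V) (j := σ i) (t := s'.val) (z' := z') fun u w w' hw hw' => by
      refine hs w w' ?_
      rw [hw', hw, hz]
      ext k
      simp only [Pi.add_apply, Function.comp_apply, Pi.single_apply, Equiv.symm_apply_eq]
  rw [map_add, map_mul, map_mul, mapU_toU, mapU_toU, ← hs z z' hz] at h1
  have h2 : (fun d => act σ ((K i (preimIncl p U z)).seq d)) = (K (σ i) (preimIncl p V z')).seq :=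
    funext fun d => (hK σ i (preimIncl p U z) (preimIncl p V z') hz d).symm
  rw [h2] at h1
  have h3 := hD.form_coeff_eq h (U := V) (s := s')
    (a := ((D.form U s).coeff i (pt p U z)).map (act σ) (hact σ)) h1
  rw [h3]
  rfl

theorem isInduced {m' : Automorphy n L'} {K' : Fin n → dom n τ → Compl gr'}
    (hD : DescentData gr p m K) (hD' : DescentData gr' p m' K')
    {D : Connection gr p m} {D' : Connection gr' p m'}
    (h : D.IsGivenBy (fun i z => (K i z).seq)) (h' : D'.IsGivenBy (fun i z => (K' i z).seq))
    (f : L →ₗ⁅ℂ⁆ L') (hf : ∀ d, ∀ a ∈ gr d, f a ∈ gr' d)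
    (hK : ∀ i z, K' i z = (K i z).map f hf) : IsInduced f D D' := by
  intro U s s' hs i b d
  obtain ⟨z, rfl⟩ := hD.pt_surjective U b
  have h1 := (isGivenBy_iff.1 h U s i z).mapU f
  simp only [map_add, map_mul, mapU_toU, ← hs] at h1
  have h2 : (fun d => f ((K i (preimIncl p U z)).seq d)) = (K' i (preimIncl p U z)).seq := by
    rw [hK]
    rfl
  rw [h2] at h1
  rw [hD'.form_coeff_eq h' (a := ((D.form U s).coeff i (pt p U z)).map f hf) h1]
  rfl

theorem isPullback {B' : Type} [TopologicalSpace B'] {p' : dom n τ → B'} {m' : Automorphy n L}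
    {q : B → B'} (hq : ∀ z, q (p z) = p' z)
    (hD : DescentData gr p m K) (hD' : DescentData gr p' m' K)
    {D : Connection gr p m} {D' : Connection gr p' m'}
    (h : D.IsGivenBy (fun i z => (K i z).seq)) (h' : D'.IsGivenBy (fun i z => (K i z).seq)) :
    IsPullback q D D' := by
  intro U V hUV s s' hs i b
  obtain ⟨z, rfl⟩ := hD.pt_surjective U b
  have hz : z.1 ∈ preim p' V := ⟨z.2.choose, by
    rw [← hq]
    exact hUV _ z.2.choose_spec⟩
  have h1 := (isGivenBy_iff.1 h' V s' i ⟨z.1, hz⟩).transport (hD'.isOpen_preim V)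
    (hD.isOpen_preim U) (j := i) (t := s.val) (z' := z) fun u w w' hw hw' =>
      hs w' w (hw'.trans hw.symm)
  rw [← hs z ⟨z.1, hz⟩ rfl] at h1
  rw [hD.form_coeff_eq h h1]
  exact congrArg _ (Subtype.ext (hq _).symm)

/-- A section over `V` is also a section of the bundle upstairs over `q⁻¹(V)`, where fewer
equivariance conditions are imposed. Its form upstairs determines the one downstairs because `p'` is
surjective. -/
theorem pullback_unique {B' : Type} [TopologicalSpace B'] {p' : dom n τ → B'}
    {m' : Automorphy n L} {q : B → B'} (hq : ∀ z, q (p z) = p' z) (hqc : Continuous q)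
    (hm : ∀ v g, m v g → m' v g) (hD' : DescentData gr p' m' K)
    {D : Connection gr p m} {D₁ D₂ : Connection gr p' m'}
    (h₁ : IsPullback q D D₁) (h₂ : IsPullback q D D₂) : D₁ = D₂ := by
  refine Connection.ext (funext fun V => funext fun s' => Form.ext (funext fun i => funext fun b => ?_))
  let U : TopologicalSpace.Opens B := ⟨q ⁻¹' V, V.2.preimage hqc⟩
  have hsub : ∀ z : preim p U, z.1 ∈ preim p' V := fun z => ⟨z.2.choose, by
    rw [← hq]
    exact z.2.choose_spec⟩
  have hsub' : preim p U ⊆ preim p' V := fun z hz => hsub ⟨z, hz⟩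
  let s : BundleSection gr p m U :=
    { val := fun z => s'.val ⟨z.1, hsub z⟩
      mem_exp := fun z => s'.mem_exp _
      hol := isHol_iff.2 fun d => (isHol_iff.1 s'.hol d).restrict hsub'
      equivariant := fun v g hg z z' hz => s'.equivariant v g (hm v g hg) _ _ hz }
  obtain ⟨z, rfl⟩ := hD'.pt_surjective V b
  have hU : p (preimIncl p' V z) ∈ U := by
    change q _ ∈ V
    rw [hq]
    exact z.2.choose_spec
  have e : ∀ D₀ : Connection gr p' m', IsPullback q D D₀ → (D₀.form V s').coeff i (pt p' V z) =
      (D.form U s).coeff i ⟨_, hU⟩ := by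
    intro D₀ h₀
    rw [h₀ U V (fun b hb => hb) s s' (fun w w' hw => congrArg s'.val (Subtype.ext hw)) i ⟨_, hU⟩]
    exact congrArg _ (Subtype.ext (hq _).symm)
  rw [e D₁ h₁, e D₂ h₂]

end DescentData

end PropertiesOfConnections

/-! ### Quasi-periodicity and zeros of `θ`. -/

section ThetaFunction

open Complex Filter Topology

/-- The infinite product `∏_{m ≥ 1} (1 - q^m w)`. -/
def qProd (q w : ℂ) : ℂ := ∏' m : ℕ, (1 - q ^ (m + 1) * w)

variable {q : ℂ} (hq : ‖q‖ < 1)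
include hq

theorem summable_qProd (w : ℂ) : Summable fun m : ℕ => ‖-(q ^ (m + 1) * w)‖ := by
  simp only [norm_neg, norm_mul, norm_pow]
  exact ((summable_nat_add_iff 1).2 (summable_geometric_of_lt_one (norm_nonneg q) hq)).mul_right _

theorem multipliable_qProd (w : ℂ) : Multipliable fun m : ℕ => 1 - q ^ (m + 1) * w := by
  simpa only [sub_eq_add_neg] using multipliable_one_add_of_summable (summable_qProd hq w)

/-- Splitting off the first factor shifts the index and absorbs `q` into `w`; this is the source of
the behaviour of `θ` under `z ↦ z + τ`. -/
theorem qProd_succ (w : ℂ) : qProd q w = (1 - q * w) * qProd q (q * w) := by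
  rw [qProd, tprod_eq_zero_mul']
  · simp only [zero_add, pow_one, qProd]
    congr 1
    refine tprod_congr fun m => ?_
    ring
  · exact (multipliable_qProd hq (q * w)).congr fun m => by ring

theorem differentiable_qProd : Differentiable ℂ (qProd q) := by
  intro w
  have h := Summable.hasProdLocallyUniformlyOn_nat_one_add (K := Metric.ball (0 : ℂ) (‖w‖ + 1))
    (f := fun m w => -(q ^ (m + 1) * w)) (u := fun m => ‖q‖ ^ (m + 1) * (‖w‖ + 1))
    Metric.isOpen_ball
    (((summable_nat_add_iff 1).2 (summable_geometric_of_lt_one (norm_nonneg q) hq)).mul_right _)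
    (.of_forall fun m x hx => by
      rw [norm_neg, norm_mul, norm_pow]
      gcongr
      exact (mem_ball_zero_iff.1 hx).le)
    (fun m => by fun_prop)
  have h2 : DifferentiableOn ℂ (fun x => ∏' m : ℕ, (1 + -(q ^ (m + 1) * x)))
      (Metric.ball (0 : ℂ) (‖w‖ + 1)) :=
    h.differentiableOn (.of_forall fun s => by
      simpa [Finset.prod_fn] using DifferentiableOn.finsetProd (fun _ _ => by fun_prop))
      Metric.isOpen_ball
  have h3 : qProd q = fun x => ∏' m : ℕ, (1 + -(q ^ (m + 1) * x)) := by
    funext x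
    simp only [qProd, sub_eq_add_neg]
  rw [h3]
  exact h2.differentiableAt (Metric.isOpen_ball.mem_nhds (mem_ball_zero_iff.2 (lt_add_one _)))

theorem exists_of_qProd_eq_zero {w : ℂ} (h : qProd q w = 0) : ∃ m : ℕ, q ^ (m + 1) * w = 1 := by
  by_contra! hne
  refine tprod_one_add_ne_zero_of_summable (f := fun m : ℕ => -(q ^ (m + 1) * w)) (fun m h0 => ?_)
    (summable_qProd hq w) (by simpa only [qProd, sub_eq_add_neg] using h)
  exact hne m (by linear_combination -h0)

theorem qProd_one_ne_zero : qProd q 1 ≠ 0 := fun h => by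
  obtain ⟨m, hm⟩ := exists_of_qProd_eq_zero hq h
  have h1 := congrArg norm hm
  rw [mul_one, norm_pow, norm_one] at h1
  exact (pow_lt_one₀ (norm_nonneg q) hq m.succ_ne_zero).ne h1

omit hq

variable (τ : UpperHalfPlane)

/-- The nome `q = e^{2πiτ}`. -/
def nome : ℂ := exp (2 * Real.pi * I * τ)

theorem norm_nome_lt_one : ‖nome τ‖ < 1 := UpperHalfPlane.norm_exp_two_pi_I_lt_one τ

theorem theta_eq (z : ℂ) : theta τ z = (qProd (nome τ) 1 ^ 2)⁻¹ * (sin (Real.pi * z) / Real.pi *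
    (qProd (nome τ) (exp (2 * Real.pi * I * z)) * qProd (nome τ) (exp (-(2 * Real.pi * I * z))))) := by
  have hq := norm_nome_lt_one τ
  have h1 := ((multipliable_qProd hq (exp (2 * Real.pi * I * z))).hasProd.mul
    (multipliable_qProd hq (exp (-(2 * Real.pi * I * z)))).hasProd).div₀
    ((multipliable_qProd hq 1).hasProd.mul (multipliable_qProd hq 1).hasProd)
    (mul_ne_zero (qProd_one_ne_zero hq) (qProd_one_ne_zero hq))
  have h2 := h1.tprod_eq
  simp only [mul_one, ← pow_two] at h2
  rw [theta]
  change _ * (∏' m : ℕ, (1 - nome τ ^ (m + 1) * _) * (1 - nome τ ^ (m + 1) * _) /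
    (1 - nome τ ^ (m + 1)) ^ 2) = _
  rw [h2]
  simp only [qProd, mul_one]
  ring

theorem differentiable_theta : Differentiable ℂ (theta τ) := by
  have h := differentiable_qProd (norm_nome_lt_one τ)
  have h1 : theta τ = fun z => _ := funext (theta_eq τ)
  rw [h1]
  have h2 : Differentiable ℂ fun z : ℂ => exp (2 * Real.pi * I * z) := by fun_prop
  have h3 : Differentiable ℂ fun z : ℂ => exp (-(2 * Real.pi * I * z)) := by fun_prop
  have h4 : Differentiable ℂ fun z : ℂ => sin (Real.pi * z) / Real.pi := by fun_prop
  exact (h4.mul ((h.comp h2).mul (h.comp h3))).const_mul _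

theorem theta_neg (z : ℂ) : theta τ (-z) = -theta τ z := by
  rw [theta_eq, theta_eq]
  simp only [mul_neg, neg_neg, sin_neg]
  ring

theorem theta_add_one (z : ℂ) : theta τ (z + 1) = -theta τ z := by
  have h1 : exp (2 * Real.pi * I * (z + 1)) = exp (2 * Real.pi * I * z) := by
    rw [mul_add, mul_one, exp_add, exp_two_pi_mul_I, mul_one]
  have h2 : exp (-(2 * Real.pi * I * (z + 1))) = exp (-(2 * Real.pi * I * z)) := by
    rw [exp_neg, h1, exp_neg]
  have h3 : sin (Real.pi * (z + 1)) = -sin (Real.pi * z) := by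
    rw [mul_add, mul_one, sin_add_pi]
  rw [theta_eq, theta_eq, h1, h2, h3]
  ring

theorem theta_add_tau (z : ℂ) :
    theta τ (z + τ) = -exp (-(Real.pi * I * τ) - 2 * Real.pi * I * z) * theta τ z := by
  have hq := norm_nome_lt_one τ
  -- In terms of `e^{πiτ}` and `e^{πiz}` the claim is rational: one of the two products loses a
  -- factor, the other gains one, and the sine factors account for them.
  set p := exp (Real.pi * I * τ) with hp
  set e := exp (Real.pi * I * z) with he
  have hp0 : p ≠ 0 := exp_ne_zero _
  have he0 : e ≠ 0 := exp_ne_zero _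
  have hnome : nome τ = p ^ 2 := by
    rw [nome, hp, ← exp_nat_mul]
    congr 1
    push_cast
    ring
  have h1 : exp (2 * Real.pi * I * z) = e ^ 2 := by
    rw [he, ← exp_nat_mul]
    congr 1
    push_cast
    ring
  have h2 : exp (2 * Real.pi * I * (z + τ)) = nome τ * e ^ 2 := by
    rw [← h1, nome, ← exp_add]
    congr 1
    ring
  have h3 : exp (-(Real.pi * I * τ) - 2 * Real.pi * I * z) = (p * e ^ 2)⁻¹ := by
    rw [← h1, hp, ← exp_add, ← exp_neg]
    congr 1
    ring
  have h4 : sin (Real.pi * z) = (e⁻¹ - e) * I / 2 := by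
    rw [sin, he, ← exp_neg, show -(Real.pi * z) * I = -(Real.pi * I * z) by ring,
      show Real.pi * z * I = Real.pi * I * z by ring]
  have h5 : sin (Real.pi * (z + τ)) = ((e * p)⁻¹ - e * p) * I / 2 := by
    rw [sin, he, hp, ← exp_add, ← exp_neg,
      show -(Real.pi * (z + τ)) * I = -(Real.pi * I * z + Real.pi * I * τ) by ring,
      show Real.pi * (z + τ) * I = Real.pi * I * z + Real.pi * I * τ by ring]
  rw [theta_eq, theta_eq, exp_neg, exp_neg, h1, h2, h3, h4, h5,
    qProd_succ hq (e ^ 2), qProd_succ hq ((nome τ * e ^ 2)⁻¹)]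
  have h6 : nome τ * (nome τ * e ^ 2)⁻¹ = (e ^ 2)⁻¹ := by
    rw [hnome]
    field_simp
  rw [h6, hnome]
  field_simp
  ring

theorem theta_zero : theta τ 0 = 0 := by
  rw [theta_eq]
  simp

/-- As `sin(πz)/π` vanishes at 0 with derivative 1, only the value of the product at 0 matters, and
the denominators normalise it to 1. -/
theorem deriv_theta_zero : deriv (theta τ) 0 = 1 := by
  have hq := norm_nome_lt_one τ
  have hP : DifferentiableAt ℂ (fun z => qProd (nome τ) (exp (2 * Real.pi * I * z)) *
      qProd (nome τ) (exp (-(2 * Real.pi * I * z)))) 0 := by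
    have h := differentiable_qProd hq
    have h2 : Differentiable ℂ fun z : ℂ => exp (2 * Real.pi * I * z) := by fun_prop
    have h3 : Differentiable ℂ fun z : ℂ => exp (-(2 * Real.pi * I * z)) := by fun_prop
    exact ((h.comp h2).mul (h.comp h3)) 0
  have hs : HasDerivAt (fun z : ℂ => sin (Real.pi * z) / Real.pi) 1 0 := by
    have h1 : HasDerivAt (fun z : ℂ => (Real.pi : ℂ) * z) Real.pi 0 := by
      simpa using (hasDerivAt_id (0 : ℂ)).const_mul (Real.pi : ℂ)
    have h2 := h1.csin.div_const (Real.pi : ℂ)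
    have hpi : (Real.pi : ℂ) ≠ 0 := ofReal_ne_zero.2 Real.pi_ne_zero
    simpa [hpi] using h2
  have h := (hs.mul hP.hasDerivAt).const_mul (qProd (nome τ) 1 ^ 2)⁻¹
  have h1 : theta τ = fun z => _ := funext (theta_eq τ)
  rw [h1]
  have h2 := h.deriv
  simp only [mul_zero, neg_zero, exp_zero, sin_zero, zero_div, zero_mul, add_zero, one_mul,
    ← pow_two] at h2
  rw [inv_mul_cancel₀ (pow_ne_zero 2 (qProd_one_ne_zero hq))] at h2
  exact h2

theorem mem_lattice_iff {z : ℂ} : z ∈ lattice τ ↔ ∃ a b : ℤ, a + b * (τ : ℂ) = z := by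
  simp only [lattice, AddSubgroup.mem_closure_pair, zsmul_eq_mul, mul_one]

theorem countable_lattice : (lattice τ : Set ℂ).Countable := by
  have h : (lattice τ : Set ℂ) ⊆ Set.range fun p : ℤ × ℤ => (p.1 : ℂ) + p.2 * (τ : ℂ) := by
    intro z hz
    obtain ⟨a, b, h⟩ := (mem_lattice_iff τ).1 hz
    exact ⟨(a, b), h⟩
  exact (Set.countable_range _).mono h

theorem one_mem_lattice : (1 : ℂ) ∈ lattice τ := AddSubgroup.subset_closure (by simp)

theorem tau_mem_lattice : (τ : ℂ) ∈ lattice τ := AddSubgroup.subset_closure (by simp)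

/-- Functions with common exponential factors for the translations by `1` and `τ` have common
exponential factors for all lattice translations. -/
theorem exists_lattice_factor {ι : Type*} (F : ι → ℂ → ℂ)
    (h1 : ∃ c d : ℂ, ∀ i x, F i (x + 1) = exp (c * x + d) * F i x)
    (hτ : ∃ c d : ℂ, ∀ i x, F i (x + τ) = exp (c * x + d) * F i x) {w : ℂ} (hw : w ∈ lattice τ) :
    ∃ c d : ℂ, ∀ i x, F i (x + w) = exp (c * x + d) * F i x := by
  induction hw using AddSubgroup.closure_induction with
  | mem w hw =>
    rcases hw with rfl | rfl
    · exact h1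
    · exact hτ
  | zero => exact ⟨0, 0, fun i x => by simp⟩
  | add v w _ _ hv hw =>
    obtain ⟨c, d, h⟩ := hv
    obtain ⟨c', d', h'⟩ := hw
    refine ⟨c + c', c' * v + d + d', fun i x => ?_⟩
    rw [← add_assoc, h', h, ← mul_assoc, ← exp_add]
    congr 2
    ring
  | neg v _ hv =>
    obtain ⟨c, d, h⟩ := hv
    refine ⟨-c, c * v - d, fun i x => ?_⟩
    have := h i (x + -v)
    rw [neg_add_cancel_right] at this
    rw [this, ← mul_assoc, ← exp_add]
    convert (one_mul _).symm
    rw [← exp_zero]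
    congr 1
    ring

theorem neg_exp_eq (a : ℂ) : -exp a = exp (a + Real.pi * I) := by
  rw [exp_add, exp_pi_mul_I, mul_neg_one]

theorem theta_lattice_factor {w : ℂ} (hw : w ∈ lattice τ) :
    ∃ c d : ℂ, ∀ x, theta τ (x + w) = exp (c * x + d) * theta τ x := by
  obtain ⟨c, d, h⟩ := exists_lattice_factor τ (fun _ : Unit => theta τ)
    ⟨0, Real.pi * I, fun _ x => by rw [theta_add_one, zero_mul, zero_add, exp_pi_mul_I, neg_one_mul]⟩
    ⟨-(2 * Real.pi * I), -(Real.pi * I * τ) + Real.pi * I, fun _ x => by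
      rw [theta_add_tau, neg_exp_eq]
      congr 2
      ring⟩ hw
  exact ⟨c, d, h ()⟩

/-- A zero of the product is a zero of a factor: the sine gives `ℤ`, the others give `ℤ ± (m + 1)τ`.
Conversely `θ(0) = 0` propagates to the lattice by quasi-periodicity. -/
theorem theta_eq_zero_iff {z : ℂ} : theta τ z = 0 ↔ z ∈ lattice τ := by
  have hq := norm_nome_lt_one τ
  have hpi : (Real.pi : ℂ) ≠ 0 := ofReal_ne_zero.2 Real.pi_ne_zero
  have hpow : ∀ (m : ℕ) (w : ℂ), nome τ ^ (m + 1) * exp (2 * Real.pi * I * w) = 1 →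
      w ∈ lattice τ := by
    intro m w h
    rw [nome, ← exp_nat_mul, ← exp_add, exp_eq_one_iff] at h
    obtain ⟨k, hk⟩ := h
    refine (mem_lattice_iff τ).2 ⟨k, -((m : ℤ) + 1), ?_⟩
    have h0 := two_pi_I_ne_zero
    refine mul_left_cancel₀ h0 ?_
    push_cast at hk ⊢
    linear_combination -hk
  constructor
  · intro h
    rw [theta_eq] at h
    rcases mul_eq_zero.1 h with h | h
    · exact absurd h (inv_ne_zero (pow_ne_zero 2 (qProd_one_ne_zero hq)))
    rcases mul_eq_zero.1 h with h | h
    · rcases div_eq_zero_iff.1 h with h | h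
      · obtain ⟨k, hk⟩ := sin_eq_zero_iff.1 h
        refine (mem_lattice_iff τ).2 ⟨k, 0, ?_⟩
        refine mul_left_cancel₀ hpi ?_
        rw [hk]
        push_cast
        ring
      · exact absurd h hpi
    rcases mul_eq_zero.1 h with h | h
    · obtain ⟨m, hm⟩ := exists_of_qProd_eq_zero hq h
      exact hpow m z hm
    · obtain ⟨m, hm⟩ := exists_of_qProd_eq_zero hq h
      rw [← mul_neg] at hm
      exact neg_mem_iff.1 (hpow m (-z) hm)
  · intro h
    obtain ⟨c, d, hcd⟩ := theta_lattice_factor τ h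
    have := hcd 0
    rwa [zero_add, theta_zero, mul_zero] at this

/-- Quasi-periodicity transports `θ'(0) = 1` to every lattice point, up to an exponential. -/
theorem deriv_theta_ne_zero {w : ℂ} (hw : w ∈ lattice τ) : deriv (theta τ) w ≠ 0 := by
  obtain ⟨c, d, hcd⟩ := theta_lattice_factor τ hw
  have h1 : HasDerivAt (fun x => exp (c * x + d) * theta τ x)
      (exp (c * 0 + d) * (c * 1) * theta τ 0 + exp (c * 0 + d) * 1) 0 := by
    have h2 : HasDerivAt (theta τ) 1 0 := by
      rw [← deriv_theta_zero τ]
      exact (differentiable_theta τ 0).hasDerivAt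
    exact ((((hasDerivAt_id (0 : ℂ)).const_mul c).add_const d).cexp).mul h2
  have h3 : HasDerivAt (fun x => theta τ (x + w)) (deriv (theta τ) w) 0 := by
    have := (differentiable_theta τ (0 + w)).hasDerivAt.comp_add_const 0 w
    rwa [zero_add] at this
  simp only [← hcd] at h1
  rw [h3.unique h1, theta_zero]
  simp

theorem isClosed_lattice : IsClosed (lattice τ : Set ℂ) := by
  have h : (lattice τ : Set ℂ) = theta τ ⁻¹' {0} := by
    ext z
    exact (theta_eq_zero_iff τ).symm
  rw [h]
  exact isClosed_singleton.preimage (differentiable_theta τ).continuous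

end ThetaFunction

/-! ### Liouville's theorem on the torus and Fay's identity. -/

section EllipticFunctions

open Complex Filter Topology

/-- If `h` has only simple zeros, and `f` vanishes at all of them, then `f / h` is entire. -/
theorem exists_entire_quotient {f h : ℂ → ℂ} (hf : Differentiable ℂ f) (hh : Differentiable ℂ h)
    (h0 : ∀ x, h x = 0 → f x = 0 ∧ deriv h x ≠ 0) :
    ∃ g : ℂ → ℂ, Differentiable ℂ g ∧ ∀ x, f x = g x * h x := by
  classical
  -- The value at a zero of `h` is the limit of the quotient. Nearby, the function is the quotient
  -- of the divided differences of `f` and `h`, whose denominator does not vanish there.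
  refine ⟨fun x => if h x = 0 then deriv f x / deriv h x else f x / h x, fun x => ?_, fun x => ?_⟩
  · by_cases hx : h x = 0
    · obtain ⟨hfx, hd⟩ := h0 x hx
      have ds : ∀ {F : ℂ → ℂ}, Differentiable ℂ F → Differentiable ℂ (dslope F x) := fun hF =>
        differentiableOn_univ.1 ((differentiableOn_dslope univ_mem).2 hF.differentiableOn)
      have hne : dslope h x x ≠ 0 := by rwa [dslope_same]
      have hev := (ds hh).continuous.continuousAt.eventually_ne hne
      refine ((ds hf x).div (ds hh x) hne).congr_of_eventuallyEq ?_
      filter_upwards [hev] with w hw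
      by_cases hwx : w = x
      · subst hwx
        simp [hx]
      · have hw0 : h w ≠ 0 := by
          intro h1
          refine hw ?_
          rw [dslope_of_ne _ hwx, slope_def_field, h1, hx, sub_zero, zero_div]
        have hsub : w - x ≠ 0 := sub_ne_zero.2 hwx
        rw [if_neg hw0, Pi.div_apply, dslope_of_ne _ hwx, dslope_of_ne _ hwx, slope_def_field,
          slope_def_field, hx, hfx, sub_zero, sub_zero, div_div_div_cancel_right₀ hsub]
    · refine ((hf x).div (hh x) hx).congr_of_eventuallyEq ?_
      filter_upwards [hh.continuous.continuousAt.eventually_ne hx] with w hw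
      rw [if_neg hw, Pi.div_apply]
  · by_cases hx : h x = 0
    · rw [hx, (h0 x hx).1, mul_zero]
    · simp only [if_neg hx, div_mul_cancel₀ _ hx]

variable (τ : UpperHalfPlane)

/-- An entire function with periods `1` and `τ` is constant. -/
theorem eq_of_doubly_periodic {g : ℂ → ℂ} (hg : Differentiable ℂ g) (h1 : ∀ x, g (x + 1) = g x)
    (hτ : ∀ x, g (x + τ) = g x) (x y : ℂ) : g x = g y := by
  refine hg.apply_eq_apply_of_bounded ?_ x y
  let e : ℝ × ℝ → ℂ := fun p => (p.1 : ℂ) + p.2 * (τ : ℂ)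
  have hc : IsCompact (e '' (Set.Icc 0 1 ×ˢ Set.Icc 0 1)) :=
    (isCompact_Icc.prod isCompact_Icc).image (by fun_prop)
  refine (hc.image hg.continuous).isBounded.subset ?_
  rintro _ ⟨x, rfl⟩
  have him : τ.im ≠ 0 := τ.im_pos.ne'
  -- Real coordinates with `x = s + tτ`; their fractional parts give an equivalent point of the
  -- compact fundamental parallelogram.
  set t := x.im / (τ : ℂ).im with ht
  set s := x.re - t * (τ : ℂ).re with hs
  have hx : x = e (s, t) := by
    apply Complex.ext
    · simp [e, hs]
    · simp [e, ht, div_mul_cancel₀ _ him]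
  have p1 : Function.Periodic g 1 := h1
  have pτ : Function.Periodic g τ := hτ
  refine ⟨e (Int.fract s, Int.fract t), ⟨(Int.fract s, Int.fract t),
    ⟨⟨Int.fract_nonneg s, (Int.fract_lt_one s).le⟩, Int.fract_nonneg t, (Int.fract_lt_one t).le⟩,
    rfl⟩, ?_⟩
  have hfr : e (Int.fract s, Int.fract t) = x - (⌊s⌋ : ℂ) * 1 - (⌊t⌋ : ℂ) * τ := by
    rw [hx]
    simp only [e, Int.fract]
    push_cast
    ring
  rw [hfr, pτ.sub_int_mul_eq, p1.sub_int_mul_eq]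

/-- The factor depends only on `y + w`, so products with the same sum of arguments transform alike.
-/
theorem theta_mul_theta_add_tau (y w : ℂ) : theta τ (y + τ) * theta τ (w + τ) =
    exp (-(2 * Real.pi * I) * (τ + y + w)) * (theta τ y * theta τ w) := by
  rw [theta_add_tau, theta_add_tau, show -(2 * Real.pi * I) * ((τ : ℂ) + y + w) =
    (-(Real.pi * I * τ) - 2 * Real.pi * I * y) + (-(Real.pi * I * τ) - 2 * Real.pi * I * w) by ring,
    exp_add]
  ring

/-- Two entire functions `f`, `h` with the same exponential factors for translations by `1` and `τ`
are proportional as soon as `h` has simple zeros, at which `f` vanishes. -/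
theorem exists_eq_const_mul {f h : ℂ → ℂ} (hf : Differentiable ℂ f) (hh : Differentiable ℂ h)
    (h0 : ∀ x, h x = 0 → f x = 0 ∧ deriv h x ≠ 0) {c d c' d' : ℂ}
    (h1 : ∀ x, f (x + 1) = exp (c * x + d) * f x ∧ h (x + 1) = exp (c * x + d) * h x)
    (hτ : ∀ x, f (x + τ) = exp (c' * x + d') * f x ∧ h (x + τ) = exp (c' * x + d') * h x)
    (hd : Dense {x | h x ≠ 0}) : ∃ C, ∀ x, f x = C * h x := by
  obtain ⟨g, hg, hfg⟩ := exists_entire_quotient hf hh h0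
  have key : ∀ w c d : ℂ, (∀ x, f (x + w) = exp (c * x + d) * f x ∧
      h (x + w) = exp (c * x + d) * h x) → ∀ x, g (x + w) = g x := by
    intro w c d H
    have hcont : Continuous fun x => g (x + w) := hg.continuous.comp (by fun_prop)
    refine congrFun (Continuous.ext_on hd hcont hg.continuous fun x hx => ?_)
    have h2 := hfg (x + w)
    rw [(H x).1, (H x).2, hfg x] at h2
    exact mul_right_cancel₀ (mul_ne_zero (exp_ne_zero (c * x + d)) hx)
      (by linear_combination -h2)
  refine ⟨g 0, fun x => ?_⟩
  rw [hfg x, eq_of_doubly_periodic τ hg (key 1 c d h1) (key τ c' d' hτ) x 0]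

/-- Fay's trisecant identity in genus one. -/
theorem fay_identity {z : ℂ} (hz : z ∉ lattice τ) (z' x x' : ℂ) :
    theta τ (z + x) * theta τ (z' + x') * theta τ (x + x') * theta τ (z - z') +
      theta τ (z + x + x') * theta τ (z' - z + x') * theta τ z' * theta τ x -
      theta τ (z' + x + x') * theta τ (z - z' + x) * theta τ z * theta τ x' = 0 := by
  have hθ := differentiable_theta τ
  have hcont := hθ.continuous
  -- By continuity in `x'` it suffices to avoid the countable set where `θ(x') = 0` or where the
  -- zeros of the comparison function `h` below collide.
  have hdense : Dense ((lattice τ : Set ℂ) ∪ (fun w => z - w) '' (lattice τ : Set ℂ))ᶜ :=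
    ((countable_lattice τ).union ((countable_lattice τ).image _)).dense_compl ℂ
  refine congrFun (Continuous.ext_on hdense (f := fun x' =>
    theta τ (z + x) * theta τ (z' + x') * theta τ (x + x') * theta τ (z - z') +
      theta τ (z + x + x') * theta τ (z' - z + x') * theta τ z' * theta τ x -
      theta τ (z' + x + x') * theta τ (z - z' + x) * theta τ z * theta τ x') (g := fun _ => 0)
    (by fun_prop) continuous_const ?_) x'
  intro x' hx'
  have hx1 : x' ∉ lattice τ := fun h => hx' (Or.inl h)
  have hx2 : z - x' ∉ lattice τ := fun h => hx' (Or.inr ⟨z - x', h, by ring⟩)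
  clear hx'
  -- As functions of `x`, the left side `f` and `h = θ(x + z) θ(x + x')` have the same factors for
  -- translations by `1` and `τ`. As `f` vanishes at `-z` and `-x'`, it vanishes at all the simple
  -- zeros of `h`, so `f = C h`.
  set f : ℂ → ℂ := fun x =>
    theta τ (z + x) * theta τ (z' + x') * theta τ (x + x') * theta τ (z - z') +
      theta τ (z + x + x') * theta τ (z' - z + x') * theta τ z' * theta τ x -
      theta τ (z' + x + x') * theta τ (z - z' + x) * theta τ z * theta τ x' with hf
  set h : ℂ → ℂ := fun x => theta τ (x + z) * theta τ (x + x') with hh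
  have hfd : Differentiable ℂ f := by fun_prop
  have hhd : Differentiable ℂ h := by fun_prop
  have f1 : ∀ x, f (x + 1) = exp (0 * x + 0) * f x := fun x => by
    simp only [hf]
    rw [show z + (x + 1) = z + x + 1 by ring, show x + 1 + x' = x + x' + 1 by ring,
      show z + x + 1 + x' = z + x + x' + 1 by ring, show z' + (x + 1) + x' = z' + x + x' + 1 by ring,
      show z - z' + (x + 1) = z - z' + x + 1 by ring]
    simp only [theta_add_one, zero_mul, add_zero, exp_zero, one_mul]
    ring
  have h1 : ∀ x, h (x + 1) = exp (0 * x + 0) * h x := fun x => by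
    simp only [hh]
    rw [show x + 1 + z = x + z + 1 by ring, show x + 1 + x' = x + x' + 1 by ring]
    simp only [theta_add_one, zero_mul, add_zero, exp_zero, one_mul]
    ring
  have fτ : ∀ x, f (x + τ) = exp (-(4 * Real.pi * I) * x + -(2 * Real.pi * I) * (τ + z + x')) * f x :=
    fun x => by
    have e1 := theta_mul_theta_add_tau τ (z + x) (x + x')
    have e2 := theta_mul_theta_add_tau τ (z + x + x') x
    have e3 := theta_mul_theta_add_tau τ (z' + x + x') (z - z' + x)
    rw [show -(2 * Real.pi * I) * ((τ : ℂ) + (z + x) + (x + x')) =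
      -(4 * Real.pi * I) * x + -(2 * Real.pi * I) * (τ + z + x') by ring] at e1
    rw [show -(2 * Real.pi * I) * ((τ : ℂ) + (z + x + x') + x) =
      -(4 * Real.pi * I) * x + -(2 * Real.pi * I) * (τ + z + x') by ring] at e2
    rw [show -(2 * Real.pi * I) * ((τ : ℂ) + (z' + x + x') + (z - z' + x)) =
      -(4 * Real.pi * I) * x + -(2 * Real.pi * I) * (τ + z + x') by ring] at e3
    simp only [hf]
    rw [show z + (x + (τ : ℂ)) = z + x + τ by ring, show x + (τ : ℂ) + x' = x + x' + τ by ring,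
      show z + x + (τ : ℂ) + x' = z + x + x' + τ by ring,
      show z' + (x + (τ : ℂ)) + x' = z' + x + x' + τ by ring,
      show z - z' + (x + (τ : ℂ)) = z - z' + x + τ by ring]
    linear_combination theta τ (z' + x') * theta τ (z - z') * e1 +
      theta τ (z' - z + x') * theta τ z' * e2 - theta τ z * theta τ x' * e3
  have hτ : ∀ x, h (x + τ) = exp (-(4 * Real.pi * I) * x + -(2 * Real.pi * I) * (τ + z + x')) * h x :=
    fun x => by
    simp only [hh]
    rw [show x + (τ : ℂ) + z = x + z + τ by ring, show x + (τ : ℂ) + x' = x + x' + τ by ring,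
      theta_mul_theta_add_tau]
    congr 2
    ring
  have fz : f (-z) = 0 := by
    simp only [hf]
    rw [show z + -z = 0 by ring, show z - z' + -z = -z' by ring, theta_zero, theta_neg, theta_neg,
      show z' + -z + x' = z' - z + x' by ring, show 0 + x' = x' by ring]
    ring
  have fx' : f (-x') = 0 := by
    simp only [hf]
    rw [show -x' + x' = 0 by ring, show z + -x' + x' = z by ring, show z' + -x' + x' = z' by ring,
      show z - z' + -x' = -(z' - z + x') by ring, theta_zero, theta_neg, theta_neg]
    ring
  have f0 : f 0 = 0 := by
    simp only [hf]
    rw [theta_zero]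
    ring_nf
  have flat : ∀ x w, w ∈ lattice τ → f x = 0 → f (x + w) = 0 := by
    intro x w hw hx
    obtain ⟨c, d, hcd⟩ := exists_lattice_factor τ (fun _ : Unit => f) ⟨_, _, fun _ => f1⟩
      ⟨_, _, fun _ => fτ⟩ hw
    rw [hcd () x, hx, mul_zero]
  have hzero : ∀ x, h x = 0 → x + z ∈ lattice τ ∨ x + x' ∈ lattice τ := fun x hx => by
    simpa only [hh, mul_eq_zero, theta_eq_zero_iff] using hx
  have hderiv : ∀ x, deriv h x = deriv (theta τ) (x + z) * theta τ (x + x') +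
      theta τ (x + z) * deriv (theta τ) (x + x') := fun x =>
    (((hθ (x + z)).hasDerivAt.comp_add_const x z).mul
      ((hθ (x + x')).hasDerivAt.comp_add_const x x')).deriv
  have hnot : ∀ x, x + z ∈ lattice τ → x + x' ∈ lattice τ → False := fun x ha hb =>
    hx2 (by simpa using sub_mem ha hb)
  have h0 : ∀ x, h x = 0 → f x = 0 ∧ deriv h x ≠ 0 := by
    intro x hx
    rw [hderiv]
    rcases hzero x hx with hx | hx
    · refine ⟨by simpa using flat (-z) (x + z) hx fz, ?_⟩
      rw [(theta_eq_zero_iff τ).2 hx, zero_mul, add_zero]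
      exact mul_ne_zero (deriv_theta_ne_zero τ hx)
        fun h2 => hnot x hx ((theta_eq_zero_iff τ).1 h2)
    · refine ⟨by simpa using flat (-x') (x + x') hx fx', ?_⟩
      rw [(theta_eq_zero_iff τ).2 hx, mul_zero, zero_add]
      exact mul_ne_zero (fun h2 => hnot x ((theta_eq_zero_iff τ).1 h2) hx)
        (deriv_theta_ne_zero τ hx)
  have hd : Dense {x | h x ≠ 0} := by
    have hct : {x | h x = 0}.Countable := by
      refine (((countable_lattice τ).image fun w => w - z).union
        ((countable_lattice τ).image fun w => w - x')).mono fun x hx => ?_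
      rcases hzero x hx with hx | hx
      · exact Or.inl ⟨_, hx, by ring⟩
      · exact Or.inr ⟨_, hx, by ring⟩
    exact hct.dense_compl ℂ
  obtain ⟨C, hC⟩ := exists_eq_const_mul τ hfd hhd h0 (fun x => ⟨f1 x, h1 x⟩)
    (fun x => ⟨fτ x, hτ x⟩) hd
  -- At `x = 0` the function `f` vanishes, while `h(0) = θ(z) θ(x')` does not.
  have hC0 : C = 0 := by
    have h2 := hC 0
    rw [f0] at h2
    simp only [hh, zero_add] at h2
    exact (mul_eq_zero.1 h2.symm).resolve_right (mul_ne_zero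
      (fun h3 => hz ((theta_eq_zero_iff τ).1 h3)) fun h3 => hx1 ((theta_eq_zero_iff τ).1 h3))
  have := hC x
  rwa [hC0, zero_mul] at this

end EllipticFunctions

/-! ### Power series expansions of `θ` and of the kernel. -/

section TaylorExpansions

open PowerSeries

/-- The Taylor series of `f` at the origin. -/
def taylorZero (f : ℂ → ℂ) : ℂ⟦X⟧ := mk fun m => iteratedDeriv m f 0 / (m.factorial : ℂ)

theorem taylorZero_mul {f g : ℂ → ℂ} (hf : Differentiable ℂ f) (hg : Differentiable ℂ g) :
    taylorZero (fun t => f t * g t) = taylorZero f * taylorZero g := by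
  ext m
  rw [taylorZero, coeff_mk, coeff_mul, iteratedDeriv_fun_mul hf.contDiff.contDiffAt
    hg.contDiff.contDiffAt, ← Finset.Nat.sum_antidiagonal_eq_sum_range_succ_mk
      (fun p => (m.choose p.1 : ℂ) * iteratedDeriv p.1 f 0 * iteratedDeriv p.2 g 0),
    Finset.sum_div]
  refine Finset.sum_congr rfl fun p hp => ?_
  rw [Finset.HasAntidiagonal.mem_antidiagonal] at hp
  rw [taylorZero, taylorZero, coeff_mk, coeff_mk, ← hp]
  have h : (((p.1 + p.2).choose p.1 * p.1.factorial * p.2.factorial : ℕ) : ℂ) =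
      ((p.1 + p.2).factorial : ℕ) := by
    rw [← Nat.choose_mul_factorial_mul_factorial (Nat.le_add_right p.1 p.2),
      Nat.add_sub_cancel_left]
  have h1 : (p.1.factorial : ℂ) ≠ 0 := Nat.cast_ne_zero.2 p.1.factorial_ne_zero
  have h2 : (p.2.factorial : ℂ) ≠ 0 := Nat.cast_ne_zero.2 p.2.factorial_ne_zero
  have h3 : ((p.1 + p.2).factorial : ℂ) ≠ 0 := Nat.cast_ne_zero.2 (p.1 + p.2).factorial_ne_zero
  push_cast at h
  rw [div_mul_div_comm, div_eq_div_iff h3 (mul_ne_zero h1 h2), ← h]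
  ring

theorem taylorZero_add {f g : ℂ → ℂ} (hf : Differentiable ℂ f) (hg : Differentiable ℂ g) :
    taylorZero (fun t => f t + g t) = taylorZero f + taylorZero g := by
  ext m
  rw [map_add, taylorZero, taylorZero, taylorZero, coeff_mk, coeff_mk, coeff_mk,
    iteratedDeriv_fun_add hf.contDiff.contDiffAt hg.contDiff.contDiffAt, add_div]

theorem taylorZero_const_mul (c : ℂ) (f : ℂ → ℂ) :
    taylorZero (fun t => c * f t) = C c * taylorZero f := by
  ext m
  rw [coeff_C_mul, taylorZero, taylorZero, coeff_mk, coeff_mk, iteratedDeriv_const_mul_field,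
    mul_div_assoc]

theorem taylorZero_exp (c : ℂ) : taylorZero (fun t => Complex.exp (c * t)) = rescale c (exp ℂ) := by
  ext m
  rw [taylorZero, coeff_mk, iteratedDeriv_cexp_const_mul, coeff_rescale, coeff_exp]
  simp [div_eq_mul_inv]

variable (τ : UpperHalfPlane)

/-- Putting `x = at`, `x' = bt` with a single variable `t` replaces two-variable expansions by
rescaled one-variable series. -/
theorem taylorZero_theta (z a : ℂ) :
    taylorZero (fun t => theta τ (z + a * t)) = rescale a (thetaTaylor τ z) := by
  ext m
  have hd : Differentiable ℂ fun w => theta τ (z + w) :=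
    (differentiable_theta τ).comp (by fun_prop)
  rw [taylorZero, coeff_mk, iteratedDeriv_comp_const_mul hd.contDiff a,
    iteratedDeriv_comp_const_add, coeff_rescale, thetaTaylor, coeff_mk]
  simp only [mul_zero, add_zero, mul_div_assoc]

theorem coeff_zero_thetaTaylor (z : ℂ) : coeff 0 (thetaTaylor τ z) = theta τ z := by
  simp [thetaTaylor]

theorem X_mul_thetaDivX : PowerSeries.X * thetaDivX τ = thetaTaylor τ 0 := by
  ext m
  cases m with
  | zero => rw [coeff_zero_X_mul, coeff_zero_thetaTaylor, theta_zero]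
  | succ m => rw [coeff_succ_X_mul, thetaDivX, coeff_mk]

theorem constantCoeff_thetaDivX : constantCoeff (thetaDivX τ) = 1 := by
  rw [← coeff_zero_eq_constantCoeff_apply, thetaDivX, coeff_mk, thetaTaylor, coeff_mk]
  simp [iteratedDeriv_one, deriv_theta_zero]

theorem thetaDivX_mul_inv : thetaDivX τ * (thetaDivX τ)⁻¹ = 1 :=
  PowerSeries.mul_inv_cancel _ (by rw [constantCoeff_thetaDivX]; exact one_ne_zero)

theorem thetaDivX_even : rescale (-1) (thetaDivX τ) = thetaDivX τ := by
  have h : rescale (-1) (thetaTaylor τ 0) = -thetaTaylor τ 0 := by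
    rw [← taylorZero_theta]
    have h1 : (fun t => theta τ (0 + -1 * t)) = fun t => (-1) * theta τ (0 + 1 * t) := by
      funext t
      rw [show 0 + -1 * t = -t by ring, theta_neg]
      ring_nf
    rw [h1, taylorZero_const_mul, taylorZero_theta]
    simp
  rw [← X_mul_thetaDivX, map_mul, rescale_neg_one_X, neg_mul, neg_inj] at h
  exact mul_left_cancel₀ X_ne_zero h

/-- The expansion `x k(z, x|τ) + 1 = θ(z|τ)⁻¹ θ(z + x|τ) (θ(x|τ) / x)⁻¹`. -/
def kernelG (z : ℂ) : ℂ⟦X⟧ := (theta τ z)⁻¹ • (thetaTaylor τ z * (thetaDivX τ)⁻¹)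

theorem theta_ne_zero {z : ℂ} (hz : z ∉ lattice τ) : theta τ z ≠ 0 :=
  fun h => hz ((theta_eq_zero_iff τ).1 h)

theorem kernelG_eq {z : ℂ} (hz : z ∉ lattice τ) : kernelG τ z = 1 + PowerSeries.X * kernelK τ z := by
  ext m
  cases m with
  | zero =>
    rw [map_add, coeff_zero_X_mul, kernelG, coeff_smul, coeff_zero_eq_constantCoeff_apply,
      map_mul, constantCoeff_inv, constantCoeff_thetaDivX, inv_one,
      ← coeff_zero_eq_constantCoeff_apply, coeff_zero_thetaTaylor]
    simp [theta_ne_zero τ hz]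
  | succ m =>
    rw [map_add, coeff_succ_X_mul, kernelK, coeff_mk, coeff_one, if_neg m.succ_ne_zero, zero_add]
    rfl

theorem thetaTaylor_eq {z : ℂ} (hz : z ∉ lattice τ) :
    thetaTaylor τ z = C (theta τ z) * (kernelG τ z * thetaDivX τ) := by
  rw [kernelG, smul_eq_C_mul, mul_assoc, mul_assoc, mul_comm _ (thetaDivX τ), thetaDivX_mul_inv,
    mul_one, ← mul_assoc, ← map_mul, mul_inv_cancel₀ (theta_ne_zero τ hz), map_one, one_mul]

theorem kernelG_neg (z : ℂ) : kernelG τ (-z) = rescale (-1) (kernelG τ z) := by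
  have h : thetaTaylor τ (-z) = -rescale (-1) (thetaTaylor τ z) := by
    have h1 : (fun t => theta τ (-z + 1 * t)) = fun t => (-1) * theta τ (z + -1 * t) := by
      funext t
      rw [show -z + 1 * t = -(z + -1 * t) by ring, theta_neg]
      ring
    have h2 := congrArg taylorZero h1
    rw [taylorZero_const_mul, taylorZero_theta, taylorZero_theta, rescale_one] at h2
    simpa using h2
  have h3 : rescale (-1) ((thetaDivX τ)⁻¹) = (thetaDivX τ)⁻¹ := by
    have h4 := congrArg (rescale (-1 : ℂ)) (thetaDivX_mul_inv τ)
    rw [map_mul, thetaDivX_even, map_one, ← thetaDivX_mul_inv τ] at h4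
    refine mul_left_cancel₀ (fun h0 => ?_) h4
    have := constantCoeff_thetaDivX τ
    rw [h0, map_zero] at this
    exact zero_ne_one this
  have h5 : rescale (-1 : ℂ) (C (theta τ z)⁻¹) = C (theta τ z)⁻¹ := by
    ext m
    rw [coeff_rescale, coeff_C]
    split_ifs with hm <;> simp [hm]
  rw [kernelG, kernelG, theta_neg, h, smul_eq_C_mul, smul_eq_C_mul, map_mul, map_mul, h3,
    show rescale (-1 : ℂ) (C (theta τ z)⁻¹) = C (theta τ z)⁻¹ from h5, inv_neg, map_neg]
  ring

theorem lattice_neg_iff {z : ℂ} : -z ∈ lattice τ ↔ z ∈ lattice τ := neg_mem_iff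

/-- `k(-z, -x) = -k(z, x)`. -/
theorem coeff_kernelK_neg {z : ℂ} (hz : z ∉ lattice τ) (m : ℕ) :
    coeff m (kernelK τ (-z)) = (-1) ^ (m + 1) * coeff m (kernelK τ z) := by
  have h := congrArg (coeff (m + 1)) (kernelG_neg τ z)
  rw [kernelG_eq τ hz, kernelG_eq τ (fun h => hz ((lattice_neg_iff τ).1 h)), coeff_rescale] at h
  simpa [coeff_succ_X_mul, coeff_one] using h

theorem kernelK_add_one (z : ℂ) : kernelK τ (z + 1) = kernelK τ z := by
  have h1 : (fun t => theta τ (z + 1 + 1 * t)) = fun t => (-1) * theta τ (z + 1 * t) := by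
    funext t
    rw [show z + 1 + 1 * t = z + 1 * t + 1 by ring, theta_add_one]
    ring
  have h2 := congrArg taylorZero h1
  rw [taylorZero_const_mul, taylorZero_theta, taylorZero_theta, rescale_one] at h2
  ext m
  rw [kernelK, kernelK, coeff_mk, coeff_mk, theta_add_one]
  simp only [RingHom.id_apply, map_neg, map_one, neg_mul, one_mul] at h2
  rw [h2, inv_neg, neg_mul, smul_neg, neg_smul, neg_neg]

theorem kernelK_sub_one (z : ℂ) : kernelK τ (z - 1) = kernelK τ z := by
  rw [← kernelK_add_one, sub_add_cancel]

/-- The multipliers of `θ(z + x)` and `θ(z)` cancel except for the factor `e^{-2πix}`. -/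
theorem kernelG_add_tau (z : ℂ) :
    kernelG τ (z + τ) = rescale (-(2 * Real.pi * Complex.I)) (exp ℂ) * kernelG τ z := by
  set c : ℂ := -(2 * Real.pi * Complex.I) with hc
  set μ := -Complex.exp (-(Real.pi * Complex.I * τ) - 2 * Real.pi * Complex.I * z) with hμ
  have hμ0 : μ ≠ 0 := neg_ne_zero.2 (Complex.exp_ne_zero _)
  have h1 : (fun t => theta τ (z + τ + 1 * t)) =
      fun t => μ * (Complex.exp (c * t) * theta τ (z + 1 * t)) := by
    funext t
    rw [show z + (τ : ℂ) + 1 * t = z + 1 * t + τ by ring, theta_add_tau, hμ, ← mul_assoc,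
      neg_mul _ (Complex.exp (c * t)), ← Complex.exp_add]
    congr 3
    rw [hc]
    ring
  have h2 := congrArg taylorZero h1
  have hd : Differentiable ℂ fun t => theta τ (z + 1 * t) :=
    (differentiable_theta τ).comp (by fun_prop)
  rw [taylorZero_const_mul, taylorZero_mul (by fun_prop) hd, taylorZero_exp, taylorZero_theta,
    taylorZero_theta, rescale_one] at h2
  simp only [RingHom.id_apply] at h2
  rw [kernelG, kernelG, theta_add_tau, ← hμ, h2, smul_eq_C_mul, smul_eq_C_mul, mul_inv, map_mul]
  have h3 : C μ⁻¹ * C μ = (1 : ℂ⟦X⟧) := by rw [← map_mul, inv_mul_cancel₀ hμ0, map_one]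
  linear_combination (C (theta τ z)⁻¹ * rescale c (exp ℂ) * thetaTaylor τ z * (thetaDivX τ)⁻¹) * h3

theorem rescale_exp_mul_neg (c : ℂ) : rescale (-c) (exp ℂ) * rescale c (exp ℂ) = 1 := by
  have h := exp_mul_exp_eq_exp_add (A := ℂ) (-c) c
  rw [neg_add_cancel, rescale_zero_apply] at h
  simpa using h

theorem kernelG_sub_tau (z : ℂ) :
    kernelG τ (z - τ) = rescale (2 * Real.pi * Complex.I) (exp ℂ) * kernelG τ z := by
  have h := kernelG_add_tau τ (z - τ)
  rw [sub_add_cancel] at h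
  have h2 := rescale_exp_mul_neg (-(2 * Real.pi * Complex.I))
  rw [neg_neg] at h2
  rw [h, ← mul_assoc, h2, one_mul]

/-- The coefficients of `e^{cx} k(z, x) + (e^{cx} - 1) / x`. -/
theorem coeff_kernelK_of_kernelG_eq {z w c : ℂ} (hz : z ∉ lattice τ) (hw : w ∉ lattice τ)
    (h : kernelG τ w = rescale c (exp ℂ) * kernelG τ z) (m : ℕ) :
    coeff m (kernelK τ w) = ∑ p ∈ Finset.HasAntidiagonal.antidiagonal m,
      c ^ p.1 * (p.1.factorial : ℂ)⁻¹ * coeff p.2 (kernelK τ z) +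
        c ^ (m + 1) * ((m + 1).factorial : ℂ)⁻¹ := by
  have h1 := congrArg (coeff (m + 1)) h
  have he : ∀ q, coeff q (rescale c (exp ℂ)) = c ^ q * (q.factorial : ℂ)⁻¹ := fun q => by
    rw [coeff_rescale, coeff_exp]
    simp
  rw [kernelG_eq τ hz, kernelG_eq τ hw, map_add, coeff_succ_X_mul, coeff_one,
    if_neg m.succ_ne_zero, zero_add, mul_add, mul_one, map_add, ← mul_assoc,
    mul_comm _ (PowerSeries.X : ℂ⟦X⟧), mul_assoc, coeff_succ_X_mul, coeff_mul, he] at h1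
  rw [h1, add_comm]
  simp only [he]

end TaylorExpansions

/-! ### The functional equation of `k` in commuting variables. -/

section FayForKernel

open PowerSeries

variable (τ : UpperHalfPlane) {z z' : ℂ}

theorem rescale_thetaTaylor (hz : z ∉ lattice τ) (a : ℂ) : rescale a (thetaTaylor τ z) =
    C (theta τ z) * (rescale a (kernelG τ z) * rescale a (thetaDivX τ)) := by
  have h5 : rescale a (C (theta τ z)) = C (theta τ z) := by
    ext m
    rw [coeff_rescale, coeff_C]
    split_ifs with hm <;> simp [hm]
  rw [thetaTaylor_eq τ hz, map_mul, map_mul, h5]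

theorem rescale_thetaTaylor_zero (a : ℂ) : rescale a (thetaTaylor τ 0) =
    C a * PowerSeries.X * rescale a (thetaDivX τ) := by
  rw [← X_mul_thetaDivX, map_mul, rescale_X]

theorem rescale_thetaDivX_ne_zero (a : ℂ) : rescale a (thetaDivX τ) ≠ 0 := fun h => by
  have h1 := congrArg (coeff 0) h
  rw [coeff_rescale, coeff_zero_eq_constantCoeff_apply, constantCoeff_thetaDivX] at h1
  simp at h1

/-- Fay's identity at `x = at`, `x' = bt`. Write `D(x) = θ(x)/x`. Each `θ(w + ct)` with `w ∉ Λ` is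
`θ(w) G(w, ct) D(ct)`, and `θ(ct) = ct D(ct)`; the three terms share `t D(at) D(bt) D((a+b)t)` and,
up to sign, `θ(z) θ(z') θ(z - z')`, which cancel. -/
theorem kernelG_fay (hz : z ∉ lattice τ) (hz' : z' ∉ lattice τ) (hzz' : z - z' ∉ lattice τ)
    (a b : ℂ) :
    C (a + b) * rescale a (kernelG τ z) * rescale b (kernelG τ z') =
      C a * rescale (a + b) (kernelG τ z) * rescale b (kernelG τ (z' - z)) +
      C b * rescale a (kernelG τ (z - z')) * rescale (a + b) (kernelG τ z') := by
  have h1 : (fun t => theta τ (z - z') * (theta τ (z + a * t) * (theta τ (z' + b * t) *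
        theta τ (0 + (a + b) * t))) +
      theta τ z' * (theta τ (z + (a + b) * t) * (theta τ (z' - z + b * t) * theta τ (0 + a * t)))) =
      fun t => theta τ z * (theta τ (z' + (a + b) * t) * (theta τ (z - z' + a * t) *
        theta τ (0 + b * t))) := by
    funext t
    have := fay_identity τ hz z' (a * t) (b * t)
    rw [show a * t + b * t = 0 + (a + b) * t by ring,
      show z + a * t + b * t = z + (a + b) * t by ring,
      show z' + a * t + b * t = z' + (a + b) * t by ring] at this
    rw [zero_add (a * t), zero_add (b * t)]
    linear_combination this
  have hd : ∀ w c, Differentiable ℂ fun t => theta τ (w + c * t) := fun w c =>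
    (differentiable_theta τ).comp (by fun_prop)
  have h2 := congrArg taylorZero h1
  have hm : ∀ w₁ w₂ w₃ c₁ c₂ c₃ : ℂ, Differentiable ℂ fun t =>
      theta τ (w₁ + c₁ * t) * (theta τ (w₂ + c₂ * t) * theta τ (w₃ + c₃ * t)) := fun _ _ _ _ _ _ =>
    (hd _ _).mul ((hd _ _).mul (hd _ _))
  rw [taylorZero_add ((hm _ _ _ _ _ _).const_mul _) ((hm _ _ _ _ _ _).const_mul _)] at h2
  have ht : ∀ w₁ w₂ w₃ c₁ c₂ c₃ : ℂ, taylorZero (fun t =>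
      theta τ (w₁ + c₁ * t) * (theta τ (w₂ + c₂ * t) * theta τ (w₃ + c₃ * t))) =
      rescale c₁ (thetaTaylor τ w₁) *
        (rescale c₂ (thetaTaylor τ w₂) * rescale c₃ (thetaTaylor τ w₃)) :=
    fun w₁ w₂ w₃ c₁ c₂ c₃ => by
      have h3 : Differentiable ℂ fun t => theta τ (w₂ + c₂ * t) * theta τ (w₃ + c₃ * t) :=
        (hd w₂ c₂).mul (hd w₃ c₃)
      rw [taylorZero_mul (hd w₁ c₁) h3, taylorZero_mul (hd w₂ c₂) (hd w₃ c₃), taylorZero_theta, taylorZero_theta, taylorZero_theta]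
  simp only [taylorZero_const_mul, ht, rescale_thetaTaylor_zero] at h2
  have hz'z : z' - z ∉ lattice τ := fun h => hzz' (by rw [← neg_sub]; exact neg_mem h)
  rw [rescale_thetaTaylor τ hz, rescale_thetaTaylor τ hz, rescale_thetaTaylor τ hz',
    rescale_thetaTaylor τ hz', rescale_thetaTaylor τ hzz', rescale_thetaTaylor τ hz'z,
    ← neg_sub z z', theta_neg, map_neg] at h2
  rw [neg_sub] at h2
  have hC : ∀ {w}, w ∉ lattice τ → (C (theta τ w) : ℂ⟦X⟧) ≠ 0 := fun hw h =>
    theta_ne_zero τ hw (by simpa using congrArg constantCoeff h)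
  have hne := mul_ne_zero (mul_ne_zero (mul_ne_zero (hC hz) (hC hz')) (hC hzz'))
    (mul_ne_zero (mul_ne_zero (mul_ne_zero (X_ne_zero (R := ℂ)) (rescale_thetaDivX_ne_zero τ a))
      (rescale_thetaDivX_ne_zero τ b)) (rescale_thetaDivX_ne_zero τ (a + b)))
  refine mul_left_cancel₀ hne ?_
  linear_combination h2

/-- The component of degree `N` of the identity satisfied by `k` as a consequence of Fay's identity,
with variables `u`, `v`. -/
def fayTerm (z z' : ℂ) (N : ℕ) {A : Type*} [Ring A] [Algebra ℂ A] (u v : A) : A :=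
  coeff (N + 1) (kernelK τ (z - z')) •
      ∑ p ∈ Finset.HasAntidiagonal.antidiagonal N, u ^ p.1 * (-v) ^ p.2 +
    coeff (N + 1) (kernelK τ z) •
      ∑ p ∈ Finset.HasAntidiagonal.antidiagonal N, u ^ p.1 * (u + v) ^ p.2 +
    coeff (N + 1) (kernelK τ z') •
      ∑ p ∈ Finset.HasAntidiagonal.antidiagonal N, v ^ p.1 * (u + v) ^ p.2 +
    ∑ p ∈ Finset.HasAntidiagonal.antidiagonal N,
      (-((coeff p.1 (kernelK τ z) * coeff p.2 (kernelK τ z')) • (u ^ p.1 * v ^ p.2)) +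
        (coeff p.1 (kernelK τ z) * coeff p.2 (kernelK τ (z' - z))) • ((u + v) ^ p.1 * v ^ p.2) +
        (coeff p.1 (kernelK τ (z - z')) * coeff p.2 (kernelK τ z')) • (u ^ p.1 * (u + v) ^ p.2))

theorem map_fayTerm {A B : Type*} [Ring A] [Algebra ℂ A] [Ring B] [Algebra ℂ B] (F : A →ₐ[ℂ] B)
    (N : ℕ) (u v : A) : F (fayTerm τ z z' N u v) = fayTerm τ z z' N (F u) (F v) := by
  simp only [fayTerm, map_add, map_neg, map_smul, map_sum, map_mul, map_pow]

theorem sub_mul_sum_antidiagonal (u v : ℂ) (N : ℕ) :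
    (u - v) * ∑ p ∈ Finset.HasAntidiagonal.antidiagonal N, u ^ p.1 * v ^ p.2 =
      u ^ (N + 1) - v ^ (N + 1) := by
  rw [Finset.Nat.sum_antidiagonal_eq_sum_range_succ_mk]
  exact (Commute.all u v).mul_geom_sum₂ (N + 1)

/-- Substitute `G = 1 + xk`; the constant terms cancel. The terms linear in `k` then occur as
differences such as `a^(N+1) - (a+b)^(N+1)`, and division by `ab(a+b)` turns them into the
homogeneous sums of `fayTerm`. -/
theorem fayTerm_complex (hz : z ∉ lattice τ) (hz' : z' ∉ lattice τ) (hzz' : z - z' ∉ lattice τ)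
    (N : ℕ) {a b : ℂ} (ha : a ≠ 0) (hb : b ≠ 0) (hab : a + b ≠ 0) : fayTerm τ z z' N a b = 0 := by
  have hz'z : z' - z ∉ lattice τ := fun h => hzz' (by rw [← neg_sub]; exact neg_mem h)
  have h := kernelG_fay τ hz hz' hzz' a b
  simp only [kernelG_eq τ hz, kernelG_eq τ hz', kernelG_eq τ hzz', kernelG_eq τ hz'z, map_add,
    map_mul, map_one, rescale_X] at h
  set k := kernelK τ with hk
  have h1 : PowerSeries.X * (C ((a + b) * a) * rescale a (k z) + C ((a + b) * b) * rescale b (k z') -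
      C (a * (a + b)) * rescale (a + b) (k z) - C (a * b) * rescale b (k (z' - z)) -
      C (a * b) * rescale a (k (z - z')) - C (b * (a + b)) * rescale (a + b) (k z') +
      PowerSeries.X * (C (a * b * (a + b)) * (rescale a (k z) * rescale b (k z') -
        rescale (a + b) (k z) * rescale b (k (z' - z)) -
        rescale a (k (z - z')) * rescale (a + b) (k z')))) = 0 := by
    simp only [map_add, map_mul]
    linear_combination h
  have h2 := (mul_eq_zero.1 h1).resolve_left X_ne_zero
  have h3 := congrArg (coeff (N + 1)) h2
  simp only [map_add, map_sub, coeff_C_mul, coeff_succ_X_mul, map_zero] at h3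
  simp only [coeff_rescale, coeff_mul] at h3
  -- The parity of `k` merges the linear terms in `k(z - z')` and `k(z' - z)` into one difference in
  -- `a` and `-b`.
  have hp : coeff (N + 1) (k (z' - z)) = (-1) ^ (N + 2) * coeff (N + 1) (k (z - z')) := by
    rw [← neg_sub z z']
    exact coeff_kernelK_neg τ hzz' (N + 1)
  have g1 := sub_mul_sum_antidiagonal a (-b) N
  have g2 := sub_mul_sum_antidiagonal a (a + b) N
  have g3 := sub_mul_sum_antidiagonal b (a + b) N
  have hs : fayTerm τ z z' N a b =
      coeff (N + 1) (k (z - z')) *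
        ∑ p ∈ Finset.HasAntidiagonal.antidiagonal N, a ^ p.1 * (-b) ^ p.2 +
      coeff (N + 1) (k z) * ∑ p ∈ Finset.HasAntidiagonal.antidiagonal N, a ^ p.1 * (a + b) ^ p.2 +
      coeff (N + 1) (k z') * ∑ p ∈ Finset.HasAntidiagonal.antidiagonal N, b ^ p.1 * (a + b) ^ p.2 -
      (∑ p ∈ Finset.HasAntidiagonal.antidiagonal N,
          a ^ p.1 * coeff p.1 (k z) * (b ^ p.2 * coeff p.2 (k z')) -
        ∑ p ∈ Finset.HasAntidiagonal.antidiagonal N,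
          (a + b) ^ p.1 * coeff p.1 (k z) * (b ^ p.2 * coeff p.2 (k (z' - z))) -
        ∑ p ∈ Finset.HasAntidiagonal.antidiagonal N,
          a ^ p.1 * coeff p.1 (k (z - z')) * ((a + b) ^ p.2 * coeff p.2 (k z'))) := by
    rw [fayTerm, ← Finset.sum_sub_distrib, ← Finset.sum_sub_distrib, sub_eq_add_neg (_ + _ + _),
      ← Finset.sum_neg_distrib]
    simp only [smul_eq_mul]
    congr 1
    refine Finset.sum_congr rfl fun p _ => ?_
    ring
  have hN : (a * b * (a + b)) ≠ 0 := mul_ne_zero (mul_ne_zero ha hb) hab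
  refine (mul_eq_zero.1 ?_).resolve_left hN
  rw [hp] at h3
  rw [hs]
  rw [show (-b) ^ (N + 1) = -((-1) ^ N * b ^ (N + 1)) by rw [neg_pow, pow_succ]; ring] at g1
  rw [pow_add (-1 : ℂ) N 2] at h3
  linear_combination (-1) * h3 + a * b * coeff (N + 1) (k (z - z')) * g1 -
    (a + b) * a * coeff (N + 1) (k z) * g2 - (a + b) * b * coeff (N + 1) (k z') * g3

/-- Multiplying by `ab(a+b)` removes the excluded values: the product vanishes at every point, so it
is zero as a polynomial, and the multiplier cancels in the domain of polynomials. -/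
theorem fayTerm_mvPolynomial (hz : z ∉ lattice τ) (hz' : z' ∉ lattice τ)
    (hzz' : z - z' ∉ lattice τ) (N : ℕ) :
    fayTerm τ z z' N (MvPolynomial.X 0 : MvPolynomial (Fin 2) ℂ) (MvPolynomial.X 1) = 0 := by
  have h : (MvPolynomial.X 0 * MvPolynomial.X 1 * (MvPolynomial.X 0 + MvPolynomial.X 1) :
      MvPolynomial (Fin 2) ℂ) * fayTerm τ z z' N (MvPolynomial.X 0) (MvPolynomial.X 1) = 0 := by
    refine MvPolynomial.funext fun w => ?_
    have h1 := map_fayTerm τ (z := z) (z' := z') (MvPolynomial.aeval w) N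
      (MvPolynomial.X 0 : MvPolynomial (Fin 2) ℂ) (MvPolynomial.X 1)
    rw [MvPolynomial.aeval_X, MvPolynomial.aeval_X, MvPolynomial.aeval_eq_eval] at h1
    rw [map_mul, h1, map_zero]
    simp only [map_mul, map_add, MvPolynomial.eval_X]
    by_cases hw : w 0 * w 1 * (w 0 + w 1) = 0
    · rw [hw, zero_mul]
    · rw [← ne_eq, mul_ne_zero_iff, mul_ne_zero_iff] at hw
      rw [fayTerm_complex τ hz hz' hzz' N hw.1.1 hw.1.2 hw.2, mul_zero]
  refine (mul_eq_zero.1 h).resolve_left (mul_ne_zero (mul_ne_zero (MvPolynomial.X_ne_zero 0)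
    (MvPolynomial.X_ne_zero 1)) fun h0 => ?_)
  have := congrArg (MvPolynomial.eval ![1, 1]) h0
  norm_num at this

-- The subalgebra generated by `u, v` is commutative, so the polynomial identity can be evaluated
-- there. It will be used with `u = ad x_i`, `v = ad x_j`.
open scoped IsMulCommutative in
theorem fayTerm_of_commute (hz : z ∉ lattice τ) (hz' : z' ∉ lattice τ)
    (hzz' : z - z' ∉ lattice τ) (N : ℕ) {A : Type*} [Ring A] [Algebra ℂ A] {u v : A}
    (huv : Commute u v) : fayTerm τ z z' N u v = 0 := by
  have hc : ∀ a ∈ ({u, v} : Set A), ∀ b ∈ ({u, v} : Set A), a * b = b * a := by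
    rintro a (rfl | rfl) b (rfl | rfl)
    exacts [rfl, huv.eq, huv.eq.symm, rfl]
  have := Algebra.isMulCommutative_adjoin ℂ hc
  let U : Algebra.adjoin ℂ ({u, v} : Set A) := ⟨u, Algebra.subset_adjoin (by simp)⟩
  let V : Algebra.adjoin ℂ ({u, v} : Set A) := ⟨v, Algebra.subset_adjoin (by simp)⟩
  have h := congrArg (MvPolynomial.aeval (R := ℂ) (![U, V] : Fin 2 → Algebra.adjoin ℂ ({u, v} : Set A)))
    (fayTerm_mvPolynomial τ hz hz' hzz' N)
  rw [map_fayTerm, MvPolynomial.aeval_X, MvPolynomial.aeval_X, map_zero] at h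
  have h2 := congrArg (Algebra.adjoin ℂ ({u, v} : Set A)).val h
  rw [map_zero, map_fayTerm] at h2
  exact h2

end FayForKernel

/-! ### Relations of `𝔱_{1,n}` and the derivations `ad x_i`. -/

section LieRelations

variable {n : ℕ} {i j k l : Fin n}

theorem tt_self (i : Fin n) : tt i i = (0 : T n) := toT_relator (.t_self i)

theorem tt_symm (i j : Fin n) : tt i j = (tt j i : T n) := by
  rcases eq_or_ne i j with rfl | h
  · rfl
  · have := toT_relator (.t_symm i j h)
    rw [map_sub] at this
    exact sub_eq_zero.1 this

theorem lie_tx_tx (i j : Fin n) : ⁅tx i, tx j⁆ = (0 : T n) := toT_relator (.x_x i j)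

theorem lie_ty_ty (i j : Fin n) : ⁅ty i, ty j⁆ = (0 : T n) := toT_relator (.y_y i j)

theorem lie_tx_ty (h : i ≠ j) : ⁅tx i, ty j⁆ = (tt i j : T n) := by
  have := toT_relator (.x_y i j h)
  rw [map_sub] at this
  exact sub_eq_zero.1 this

theorem lie_tx_ty_self (i : Fin n) :
    ⁅tx i, ty i⁆ = -∑ j ∈ Finset.univ.filter (fun j => j ≠ i), (tt i j : T n) := by
  have := toT_relator (.x_y_self i)
  rw [map_add, map_sum] at this
  exact eq_neg_of_add_eq_zero_left this

theorem lie_tx_tt (hj : i ≠ j) (hk : i ≠ k) : ⁅tx i, tt j k⁆ = (0 : T n) := by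
  rcases eq_or_ne j k with rfl | h
  · rw [tt_self, lie_zero]
  · exact toT_relator (.x_t i j k hj hk h)

theorem lie_ty_tt (hj : i ≠ j) (hk : i ≠ k) : ⁅ty i, tt j k⁆ = (0 : T n) := by
  rcases eq_or_ne j k with rfl | h
  · rw [tt_self, lie_zero]
  · exact toT_relator (.y_t i j k hj hk h)

theorem lie_tx_tt_self (h : i ≠ j) : ⁅tx i, tt i j⁆ = -⁅tx j, (tt i j : T n)⁆ := by
  have := toT_relator (.xx_t i j h)
  rw [LieHom.map_lie, map_add, add_lie] at this
  exact eq_neg_of_add_eq_zero_left this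

theorem lie_ty_tt_self (h : i ≠ j) : ⁅ty i, tt i j⁆ = -⁅ty j, (tt i j : T n)⁆ := by
  have := toT_relator (.yy_t i j h)
  rw [LieHom.map_lie, map_add, add_lie] at this
  exact eq_neg_of_add_eq_zero_left this

theorem lie_tt_add (hij : i ≠ j) (hik : i ≠ k) (hjk : j ≠ k) :
    ⁅tt i j, tt i k⁆ = -⁅tt i j, (tt j k : T n)⁆ := by
  have := toT_relator (.t_add i j k hij hik hjk)
  rw [LieHom.map_lie, map_add, lie_add] at this
  exact eq_neg_of_add_eq_zero_left this

theorem lie_tt_tt (hij : i ≠ j) (hik : i ≠ k) (hil : i ≠ l) (hjk : j ≠ k) (hjl : j ≠ l)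
    (hkl : k ≠ l) : ⁅tt i j, tt k l⁆ = (0 : T n) :=
  toT_relator (.t_t i j k l hij hik hil hjk hjl hkl)

/-- The derivation `ad x_i`. -/
def adx (i : Fin n) : Module.End ℂ (T n) := LieAlgebra.ad ℂ (T n) (tx i)

theorem adx_apply (i : Fin n) (a : T n) : adx i a = ⁅tx i, a⁆ := rfl

theorem adx_commute (i j : Fin n) : Commute (adx i) (adx j : Module.End ℂ (T n)) := by
  refine LinearMap.ext fun a => ?_
  rw [Module.End.mul_apply, Module.End.mul_apply, adx_apply, adx_apply, adx_apply, adx_apply,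
    leibniz_lie, lie_tx_tx, zero_lie, zero_add]

/-- `f` satisfies the Leibniz rule for the bracket. -/
def IsDeriv (f : Module.End ℂ (T n)) : Prop := ∀ A B, f ⁅A, B⁆ = ⁅f A, B⁆ + ⁅A, f B⁆

theorem isDeriv_adx (i : Fin n) : IsDeriv (adx i : Module.End ℂ (T n)) :=
  fun A B => leibniz_lie (tx i) A B

theorem IsDeriv.neg {f : Module.End ℂ (T n)} (h : IsDeriv f) : IsDeriv (-f) := fun A B => by
  rw [LinearMap.neg_apply, LinearMap.neg_apply, LinearMap.neg_apply, h, neg_lie, lie_neg, neg_add]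

theorem IsDeriv.pow_lie_right {f : Module.End ℂ (T n)} (hf : IsDeriv f) {A : T n} (h : f A = 0)
    (q : ℕ) (B : T n) : (f ^ q) ⁅A, B⁆ = ⁅A, (f ^ q) B⁆ := by
  induction q with
  | zero => rfl
  | succ q ih =>
    rw [pow_succ', Module.End.mul_apply, Module.End.mul_apply, ih, hf, h, zero_lie, zero_add]

theorem IsDeriv.pow_lie_left {f : Module.End ℂ (T n)} (hf : IsDeriv f) {B : T n} (h : f B = 0)
    (q : ℕ) (A : T n) : (f ^ q) ⁅A, B⁆ = ⁅(f ^ q) A, B⁆ := by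
  rw [← lie_skew, map_neg, hf.pow_lie_right h, lie_skew]

theorem pow_apply_eq_zero_of_commute {V : Type*} [AddCommGroup V] [Module ℂ V]
    {f g : Module.End ℂ V} (h : Commute f g) {A : V} (hA : f A = 0) (p : ℕ) : f ((g ^ p) A) = 0 := by
  rw [← Module.End.mul_apply, (h.pow_right p).eq, Module.End.mul_apply, hA, map_zero]

theorem pow_apply_congr_of_commute {V : Type*} [AddCommGroup V] [Module ℂ V]
    {f g : Module.End ℂ V} (h : Commute f g) {A : V} (hA : f A = g A) (p : ℕ) :
    (f ^ p) A = (g ^ p) A := by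
  induction p with
  | zero => rfl
  | succ p ih =>
    rw [pow_succ, Module.End.mul_apply, hA, ← Module.End.mul_apply, (h.pow_left p).eq,
      Module.End.mul_apply, ih, ← Module.End.mul_apply, ← pow_succ']

/-- As each derivation kills the entry on which the other one acts, the Leibniz rule lets both be
pulled out of the bracket. -/
theorem lie_pow_pow {f g : Module.End ℂ (T n)} (hf : IsDeriv f) (hg : IsDeriv g)
    (hfg : Commute f g) {A B : T n} (hA : g A = 0) (hB : f B = 0) (p q : ℕ) :
    ⁅(f ^ p) A, (g ^ q) B⁆ = (f ^ p * g ^ q) ⁅A, B⁆ := by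
  rw [Module.End.mul_apply, hg.pow_lie_right hA,
    hf.pow_lie_left (pow_apply_eq_zero_of_commute hfg hB q)]

theorem adx_tt (hj : i ≠ j) (hk : i ≠ k) : adx i (tt j k : T n) = 0 := lie_tx_tt hj hk

theorem adx_pow_tt (h : i ≠ j) (p : ℕ) : (adx i ^ p) (tt i j : T n) = ((-adx j) ^ p) (tt i j) :=
  pow_apply_congr_of_commute (adx_commute i j).neg_right
    (by rw [LinearMap.neg_apply, adx_apply, adx_apply, lie_tx_tt_self h]) p


end LieRelations

/-! ### Three-index brackets as polynomials in `ad x_i`, `ad x_j` on `[t_ij, t_jk]`. -/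

section CommutatorTerms

variable {n : ℕ} {i j k l : Fin n}

theorem lie_adx_pow_succ (a : T n) (i : Fin n) (m : ℕ) (A : T n) :
    ⁅a, (adx i ^ (m + 1)) A⁆ = (adx i ^ (m + 1)) ⁅a, A⁆ +
      ∑ p ∈ Finset.HasAntidiagonal.antidiagonal m,
        (adx i ^ p.1) ⁅⁅a, tx i⁆, (adx i ^ p.2) A⁆ := by
  have h1 : ∀ B : T n, ⁅a, adx i B⁆ = ⁅⁅a, tx i⁆, B⁆ + adx i ⁅a, B⁆ := fun B => leibniz_lie a (tx i) B
  induction m with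
  | zero => simp [h1, add_comm]
  | succ m ih =>
    rw [pow_succ', Module.End.mul_apply, h1, ih, Finset.Nat.sum_antidiagonal_succ]
    simp only [map_add, map_sum, pow_zero, Module.End.one_apply, pow_succ', Module.End.mul_apply]
    abel

/-- On `[t_ij, t_jk]` the derivations `ad x_i + ad x_j` and `-ad x_k` coincide. -/
theorem neg_adx_pow_lie_tt (hij : i ≠ j) (hik : i ≠ k) (hjk : j ≠ k) (p : ℕ) :
    ((-adx k) ^ p) ⁅tt i j, (tt j k : T n)⁆ = ((adx i + adx j) ^ p) ⁅tt i j, tt j k⁆ := by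
  refine pow_apply_congr_of_commute ((adx_commute k i).add_right (adx_commute k j)).neg_left ?_ p
  rw [LinearMap.neg_apply, LinearMap.add_apply, adx_apply, adx_apply, adx_apply,
    leibniz_lie (tx k), leibniz_lie (tx i), leibniz_lie (tx j), lie_tx_tt hik.symm hjk.symm,
    lie_tx_tt hij hik, lie_tx_tt_self hij, tt_symm j k, lie_tx_tt_self hjk.symm]
  simp only [zero_lie, lie_zero, lie_neg, neg_lie]
  abel

theorem lie_tt_tt_ik_jk (hij : i ≠ j) (hik : i ≠ k) (hjk : j ≠ k) :
    ⁅tt i k, tt j k⁆ = -⁅tt i j, (tt j k : T n)⁆ := by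
  have h := lie_tt_add (n := n) hjk hij.symm hik.symm
  rw [tt_symm k i, tt_symm j i] at h
  rw [← lie_skew, ← lie_skew (tt i j), h]
  abel

theorem lie_tt_tt_ik_ij (hij : i ≠ j) (hik : i ≠ k) (hjk : j ≠ k) :
    ⁅tt i k, tt i j⁆ = ⁅tt i j, (tt j k : T n)⁆ := by
  rw [← lie_skew, lie_tt_add hij hik hjk, neg_neg]

section Three

variable (hij : i ≠ j) (hik : i ≠ k) (hjk : j ≠ k)
include hij hik hjk

theorem lie_pow_ik_jk (p q : ℕ) : ⁅(adx i ^ p) (tt i k), (adx j ^ q) (tt j k : T n)⁆ =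
    -(adx i ^ p * adx j ^ q) ⁅tt i j, tt j k⁆ := by
  rw [lie_pow_pow (isDeriv_adx i) (isDeriv_adx j) (adx_commute i j) (adx_tt hij.symm hjk)
    (adx_tt hij hik), lie_tt_tt_ik_jk hij hik hjk, map_neg]

theorem mul_neg_adx_pow_lie_tt (f : Module.End ℂ (T n)) (p : ℕ) :
    (f * (-adx k) ^ p) ⁅tt i j, (tt j k : T n)⁆ =
      (f * (adx i + adx j) ^ p) ⁅tt i j, tt j k⁆ := by
  rw [Module.End.mul_apply, neg_adx_pow_lie_tt hij hik hjk, Module.End.mul_apply]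

/-- As `ad x_j` does not kill `t_ij`, its powers on `t_jk` are traded for powers of `-ad x_k`, which
can be pulled out of the bracket and act on `[t_ij, t_jk]` as `ad x_i + ad x_j`. -/
theorem lie_pow_ij_jk (p q : ℕ) : ⁅(adx i ^ p) (tt i j), (adx j ^ q) (tt j k : T n)⁆ =
    (adx i ^ p * (adx i + adx j) ^ q) ⁅tt i j, tt j k⁆ := by
  rw [adx_pow_tt hjk, lie_pow_pow (isDeriv_adx i) (isDeriv_adx k).neg (adx_commute i k).neg_right
    (by rw [LinearMap.neg_apply, adx_tt hik.symm hjk.symm, neg_zero]) (adx_tt hij hik),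
    mul_neg_adx_pow_lie_tt hij hik hjk]

theorem lie_pow_ik_ji (p q : ℕ) : ⁅(adx i ^ p) (tt i k), (adx j ^ q) (tt j i : T n)⁆ =
    ((adx i + adx j) ^ p * adx j ^ q) ⁅tt i j, tt j k⁆ := by
  have hc : Commute (-adx k) (adx j : Module.End ℂ (T n)) := (adx_commute k j).neg_left
  rw [adx_pow_tt hik, tt_symm j i, lie_pow_pow (isDeriv_adx k).neg (isDeriv_adx j) hc
    (adx_tt hij.symm hjk) (by rw [LinearMap.neg_apply, adx_tt hik.symm hjk.symm, neg_zero]),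
    lie_tt_tt_ik_ij hij hik hjk, (hc.pow_pow p q).eq, mul_neg_adx_pow_lie_tt hij hik hjk,
    (((adx_commute j i).add_right (Commute.refl _)).pow_pow q p).eq]

/-- Since `y_j` commutes with `t_ik`, it only meets the letters `x_i`, and `[y_j, x_i] = -t_ij`;
each place where this happens gives one summand. -/
theorem lie_ty_pow_ik (m : ℕ) : ⁅ty j, (adx i ^ (m + 1)) (tt i k : T n)⁆ =
    (∑ p ∈ Finset.HasAntidiagonal.antidiagonal m, adx i ^ p.1 * (adx i + adx j) ^ p.2)
      ⁅tt i j, tt j k⁆ := by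
  rw [lie_adx_pow_succ, lie_ty_tt hij.symm hjk, map_zero, zero_add, LinearMap.sum_apply]
  refine Finset.sum_congr rfl fun p _ => ?_
  rw [← lie_skew (ty j), lie_tx_ty hij, adx_pow_tt hik, neg_lie,
    ← (isDeriv_adx k).neg.pow_lie_right
      (by rw [LinearMap.neg_apply, adx_tt hik.symm hjk.symm, neg_zero]), ← map_neg,
    lie_tt_add hij hik hjk, neg_neg, neg_adx_pow_lie_tt hij hik hjk, Module.End.mul_apply]

theorem lie_ty_pow_jk (m : ℕ) : ⁅ty i, (adx j ^ (m + 1)) (tt j k : T n)⁆ =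
    -(∑ p ∈ Finset.HasAntidiagonal.antidiagonal m, adx j ^ p.1 * (adx i + adx j) ^ p.2)
      ⁅tt i j, tt j k⁆ := by
  rw [lie_adx_pow_succ, lie_ty_tt hij hik, map_zero, zero_add, LinearMap.sum_apply, ← Finset.sum_neg_distrib]
  refine Finset.sum_congr rfl fun p _ => ?_
  rw [← lie_skew (ty i), lie_tx_ty hij.symm, adx_pow_tt hjk, neg_lie, tt_symm j i,
    ← (isDeriv_adx k).neg.pow_lie_right
      (by rw [LinearMap.neg_apply, adx_tt hik.symm hjk.symm, neg_zero]), map_neg,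
    neg_adx_pow_lie_tt hij hik hjk, Module.End.mul_apply]

theorem lie_ik_pow_ij (m : ℕ) : ⁅tt i k, (adx i ^ m) (tt i j : T n)⁆ =
    ((-adx j) ^ m) ⁅tt i j, tt j k⁆ := by
  rw [adx_pow_tt hij, ← (isDeriv_adx j).neg.pow_lie_right
    (by rw [LinearMap.neg_apply, adx_tt hij.symm hjk, neg_zero]), lie_tt_tt_ik_ij hij hik hjk]

end Three

/-- The indices different from `i` and `j`. -/
def others (i j : Fin n) : Finset (Fin n) := Finset.univ.filter fun k => k ≠ i ∧ k ≠ j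

theorem mem_others : k ∈ others i j ↔ k ≠ i ∧ k ≠ j := by simp [others]

theorem sum_ne_eq {V : Type*} [AddCommGroup V] (hij : i ≠ j) (f : Fin n → V) :
    ∑ l ∈ Finset.univ.filter (fun l => l ≠ i), f l = f j + ∑ k ∈ others i j, f k := by
  have h : Finset.univ.filter (fun l => l ≠ i) = insert j (others i j) := by
    ext l
    simp only [Finset.mem_filter, Finset.mem_univ, true_and, Finset.mem_insert, mem_others]
    constructor
    · intro h
      by_cases hl : l = j
      · exact Or.inl hl
      · exact Or.inr ⟨h, hl⟩
    · rintro (rfl | h)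
      · exact hij.symm
      · exact h.1
  rw [h, Finset.sum_insert (by simp [mem_others])]

theorem others_comm (i j : Fin n) : others i j = others j i := by
  ext k
  simp only [mem_others, and_comm]

/-- The sum `y_i + y_j` commutes with `t_ij`, and in `[y_i + y_j, x_i]` the terms `t_ij` cancel,
leaving `∑ t_ik` over third indices. -/
theorem lie_add_ty_pow_ij (hij : i ≠ j) (m : ℕ) :
    ⁅ty i, (adx i ^ (m + 1)) (tt i j : T n)⁆ + ⁅ty j, (adx i ^ (m + 1)) (tt i j : T n)⁆ =
      ∑ k ∈ others i j, (∑ p ∈ Finset.HasAntidiagonal.antidiagonal m,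
        adx i ^ p.1 * (-adx j) ^ p.2) ⁅tt i j, tt j k⁆ := by
  have h1 : ⁅ty i + ty j, tx i⁆ = ∑ k ∈ others i j, (tt i k : T n) := by
    rw [← lie_skew, lie_add, lie_tx_ty hij, lie_tx_ty_self, sum_ne_eq hij]
    abel
  have h2 : ⁅ty i + ty j, (tt i j : T n)⁆ = 0 := by
    rw [add_lie, lie_ty_tt_self hij, neg_add_cancel]
  rw [← add_lie, lie_adx_pow_succ, h2, map_zero, zero_add, h1]
  simp only [sum_lie, map_sum, LinearMap.sum_apply]
  rw [Finset.sum_comm]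
  refine Finset.sum_congr rfl fun k hk => Finset.sum_congr rfl fun p _ => ?_
  rw [mem_others] at hk
  rw [lie_ik_pow_ij hij hk.1.symm hk.2.symm, Module.End.mul_apply]

/-- Exchanging the two exponents changes the sign of the sum. It disposes of `[K_ij, K_ji]`. -/
theorem sum_antidiagonal_lie_self (c : ℕ → ℂ) (f : Module.End ℂ (T n)) (A : T n) (N : ℕ) :
    ∑ p ∈ Finset.HasAntidiagonal.antidiagonal N, (c p.1 * c p.2) • ⁅(f ^ p.1) A, (f ^ p.2) A⁆ = 0 := by
  set S := ∑ p ∈ Finset.HasAntidiagonal.antidiagonal N,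
    (c p.1 * c p.2) • ⁅(f ^ p.1) A, (f ^ p.2) A⁆ with hS
  have h : S = -S := by
    conv_lhs => rw [hS, ← Finset.Nat.sum_antidiagonal_swap]
    rw [hS, ← Finset.sum_neg_distrib]
    refine Finset.sum_congr rfl fun p _ => ?_
    rw [Prod.fst_swap, Prod.snd_swap, ← lie_skew, smul_neg, mul_comm]
  have h2 : (2 : ℂ) • S = 0 := by
    rw [two_smul]
    nth_rewrite 1 [h]
    exact neg_add_cancel _
  exact (smul_eq_zero.1 h2).resolve_left two_ne_zero

end CommutatorTerms

/-! ### The commutator `[K_i, K_j]` in degrees at least 4. -/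

section Commutator

open PowerSeries

variable {n : ℕ} {i j k l : Fin n} (τ : UpperHalfPlane)

/-- The component of degree `m + 2` of `K_i(z|τ)`. -/
def kComp (i : Fin n) (z : Fin n → ℂ) (m : ℕ) : T n :=
  ∑ l ∈ Finset.univ.filter (fun l => l ≠ i),
    coeff m (kernelK τ (z i - z l)) • (adx i ^ m) (tt i l)

variable {τ} {z : Fin n → ℂ} (hz : z ∈ dom n τ) (hij : i ≠ j)
include hz hij

omit hij in
theorem coeff_kernelK_swap (hij : i ≠ j) (m : ℕ) : coeff m (kernelK τ (z j - z i)) =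
    (-1) ^ (m + 1) * coeff m (kernelK τ (z i - z j)) := by
  rw [← neg_sub, coeff_kernelK_neg τ (hz i j hij)]

omit hz in
theorem adx_pow_tt_swap (m : ℕ) :
    (adx j ^ m) (tt j i : T n) = (-1 : ℂ) ^ m • (adx i ^ m) (tt i j) := by
  rw [adx_pow_tt hij.symm, tt_symm j i, ← neg_one_smul ℂ (adx i), smul_pow, LinearMap.smul_apply]

/-- The component of `K_ij(z) = -K_ji(-z)`: the kernel contributes `(-1)^(m+1)` and exchanging `ad
x_j` for `ad x_i` contributes `(-1)^m`. -/
theorem coeff_smul_adx_pow_swap (m : ℕ) :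
    coeff m (kernelK τ (z j - z i)) • (adx j ^ m) (tt j i : T n) =
      -(coeff m (kernelK τ (z i - z j)) • (adx i ^ m) (tt i j)) := by
  rw [coeff_kernelK_swap hz hij, adx_pow_tt_swap hij, smul_smul, ← neg_smul]
  congr 1
  rw [pow_succ, show (-1 : ℂ) ^ m * -1 * coeff m (kernelK τ (z i - z j)) * (-1) ^ m =
    ((-1) * (-1)) ^ m * -coeff m (kernelK τ (z i - z j)) by rw [mul_pow]; ring]
  simp

omit hz in
theorem lie_ty_kComp_left (N : ℕ) : ⁅ty j, kComp τ i z (N + 1)⁆ =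
    coeff (N + 1) (kernelK τ (z i - z j)) • ⁅ty j, (adx i ^ (N + 1)) (tt i j : T n)⁆ +
      ∑ k ∈ others i j, coeff (N + 1) (kernelK τ (z i - z k)) •
        (∑ p ∈ Finset.HasAntidiagonal.antidiagonal N, adx i ^ p.1 * (adx i + adx j) ^ p.2)
          ⁅tt i j, tt j k⁆ := by
  rw [kComp, sum_ne_eq hij, lie_add, lie_smul, lie_sum]
  congr 1
  refine Finset.sum_congr rfl fun k hk => ?_
  rw [mem_others] at hk
  rw [lie_smul, lie_ty_pow_ik hij hk.1.symm hk.2.symm]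

theorem lie_ty_kComp_right (N : ℕ) : ⁅ty i, kComp τ j z (N + 1)⁆ =
    -(coeff (N + 1) (kernelK τ (z i - z j)) • ⁅ty i, (adx i ^ (N + 1)) (tt i j : T n)⁆ +
      ∑ k ∈ others i j, coeff (N + 1) (kernelK τ (z j - z k)) •
        (∑ p ∈ Finset.HasAntidiagonal.antidiagonal N, adx j ^ p.1 * (adx i + adx j) ^ p.2)
          ⁅tt i j, tt j k⁆) := by
  rw [kComp, sum_ne_eq hij.symm, coeff_smul_adx_pow_swap hz hij, lie_add, lie_neg, lie_smul,
    lie_sum, neg_add, ← Finset.sum_neg_distrib, others_comm]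
  congr 1
  refine Finset.sum_congr rfl fun k hk => ?_
  rw [mem_others] at hk
  rw [lie_smul, lie_ty_pow_jk hij hk.1.symm hk.2.symm, smul_neg]

theorem lie_kComp_kComp (p q : ℕ) : ⁅kComp τ i z p, kComp τ j z q⁆ =
    -((coeff p (kernelK τ (z i - z j)) * coeff q (kernelK τ (z i - z j))) •
      ⁅(adx i ^ p) (tt i j), (adx i ^ q) (tt i j)⁆) +
      ∑ k ∈ others i j,
        (-((coeff p (kernelK τ (z i - z k)) * coeff q (kernelK τ (z j - z k))) •
            (adx i ^ p * adx j ^ q)) +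
          (coeff p (kernelK τ (z i - z k)) * coeff q (kernelK τ (z j - z i))) •
            ((adx i + adx j) ^ p * adx j ^ q) +
          (coeff p (kernelK τ (z i - z j)) * coeff q (kernelK τ (z j - z k))) •
            (adx i ^ p * (adx i + adx j) ^ q)) ⁅tt i j, (tt j k : T n)⁆ := by
  have h1 : ⁅∑ k ∈ others i j, coeff p (kernelK τ (z i - z k)) • (adx i ^ p) (tt i k : T n),
      ∑ k ∈ others i j, coeff q (kernelK τ (z j - z k)) • (adx j ^ q) (tt j k : T n)⁆ =
      ∑ k ∈ others i j, (-((coeff p (kernelK τ (z i - z k)) * coeff q (kernelK τ (z j - z k))) •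
            (adx i ^ p * adx j ^ q))) ⁅tt i j, (tt j k : T n)⁆ := by
    rw [sum_lie]
    refine Finset.sum_congr rfl fun k hk => ?_
    rw [mem_others] at hk
    rw [lie_sum, Finset.sum_eq_single k]
    · rw [smul_lie, lie_smul, lie_pow_ik_jk hij hk.1.symm hk.2.symm, smul_smul]
      simp only [smul_neg, LinearMap.neg_apply, LinearMap.smul_apply]
    -- For distinct third indices the two entries involve `t_ik` and `t_jl` with four distinct
    -- indices, and these commute.
    · intro l hl hlk
      rw [mem_others] at hl
      rw [smul_lie, lie_smul, lie_pow_pow (isDeriv_adx i) (isDeriv_adx j) (adx_commute i j)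
        (adx_tt hij.symm hk.2.symm) (adx_tt hij hl.1.symm),
        lie_tt_tt hk.1.symm hij hl.1.symm hk.2 hlk.symm hl.2.symm, map_zero, smul_zero, smul_zero]
    · intro h
      exact absurd (mem_others.2 hk) h
  have h2 : ⁅∑ k ∈ others i j, coeff p (kernelK τ (z i - z k)) • (adx i ^ p) (tt i k : T n),
      coeff q (kernelK τ (z j - z i)) • (adx j ^ q) (tt j i : T n)⁆ =
      ∑ k ∈ others i j, ((coeff p (kernelK τ (z i - z k)) * coeff q (kernelK τ (z j - z i))) •
            ((adx i + adx j) ^ p * adx j ^ q)) ⁅tt i j, (tt j k : T n)⁆ := by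
    rw [sum_lie]
    refine Finset.sum_congr rfl fun k hk => ?_
    rw [mem_others] at hk
    rw [smul_lie, lie_smul, lie_pow_ik_ji hij hk.1.symm hk.2.symm, smul_smul, LinearMap.smul_apply]
  have h3 : ⁅coeff p (kernelK τ (z i - z j)) • (adx i ^ p) (tt i j : T n),
      ∑ k ∈ others i j, coeff q (kernelK τ (z j - z k)) • (adx j ^ q) (tt j k : T n)⁆ =
      ∑ k ∈ others i j, ((coeff p (kernelK τ (z i - z j)) * coeff q (kernelK τ (z j - z k))) •
            (adx i ^ p * (adx i + adx j) ^ q)) ⁅tt i j, (tt j k : T n)⁆ := by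
    rw [lie_sum]
    refine Finset.sum_congr rfl fun k hk => ?_
    rw [mem_others] at hk
    rw [smul_lie, lie_smul, lie_pow_ij_jk hij hk.1.symm hk.2.symm, smul_smul, LinearMap.smul_apply]
  have h4 : ⁅coeff p (kernelK τ (z i - z j)) • (adx i ^ p) (tt i j : T n),
      coeff q (kernelK τ (z j - z i)) • (adx j ^ q) (tt j i : T n)⁆ =
      -((coeff p (kernelK τ (z i - z j)) * coeff q (kernelK τ (z i - z j))) •
        ⁅(adx i ^ p) (tt i j : T n), (adx i ^ q) (tt i j)⁆) := by
    rw [coeff_smul_adx_pow_swap hz hij, lie_neg, smul_lie, lie_smul, smul_smul]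
  rw [kComp, kComp, sum_ne_eq hij, sum_ne_eq hij.symm, others_comm j i]
  rw [add_lie, lie_add, lie_add, h1, h2, h3, h4]
  simp only [LinearMap.add_apply, Finset.sum_add_distrib]
  abel

/-- The left side is the component of degree `N + 4` of `[K_i, K_j]`. Collected by the third index
`k`, the coefficient of `[t_ij, t_jk]` is `fayTerm` at the points `z_i - z_k`, `z_j - z_k` with
variables `ad x_i`, `ad x_j`. -/
theorem commutator_eq_zero (N : ℕ) :
    ⁅ty j, kComp τ i z (N + 1)⁆ - ⁅ty i, kComp τ j z (N + 1)⁆ +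
      ∑ p ∈ Finset.HasAntidiagonal.antidiagonal N, ⁅kComp τ i z p.1, kComp τ j z p.2⁆ = 0 := by
  simp only [lie_kComp_kComp hz hij]
  rw [Finset.sum_add_distrib, Finset.sum_neg_distrib,
    sum_antidiagonal_lie_self (fun m => coeff m (kernelK τ (z i - z j))), neg_zero, zero_add,
    lie_ty_kComp_left hij, lie_ty_kComp_right hz hij]
  have h1 : ∀ a b c d e : T n, a + b - -(c + d) + e = (c + a) + b + d + e := fun _ _ _ _ _ => by
    abel
  rw [h1, ← smul_add, lie_add_ty_pow_ij hij, Finset.smul_sum, Finset.sum_comm,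
    ← Finset.sum_add_distrib, ← Finset.sum_add_distrib, ← Finset.sum_add_distrib]
  refine Finset.sum_eq_zero fun k hk => ?_
  rw [mem_others] at hk
  have h := fayTerm_of_commute τ (hz i k hk.1.symm) (hz j k hk.2.symm)
    (by rw [sub_sub_sub_cancel_right]; exact hz i j hij) N
    (adx_commute i j : Commute (adx i) (adx j : Module.End ℂ (T n)))
  rw [fayTerm, sub_sub_sub_cancel_right, sub_sub_sub_cancel_right] at h
  have h2 := LinearMap.congr_fun h ⁅tt i j, (tt j k : T n)⁆
  rw [LinearMap.add_apply, LinearMap.add_apply, LinearMap.add_apply, LinearMap.smul_apply,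
    LinearMap.smul_apply, LinearMap.smul_apply] at h2
  exact (congrArg _ (LinearMap.sum_apply _ _ _).symm).trans h2

end Commutator

/-! ### Homogeneous components of `K_i`, and the vanishing of `[K_i, K_j]`. -/

section Components

open PowerSeries

variable {n : ℕ}

theorem Compl.seq_of {L : Type*} [LieRing L] [LieAlgebra ℂ L] {gr : ℕ → Submodule ℂ L} (d : ℕ)
    (a : L) (ha : a ∈ gr d) (e : ℕ) : (Compl.of d a ha).seq e = if e = d then a else 0 := by
  by_cases h : e = d
  · subst h
    simp [Compl.of, Compl.seq]
  · rw [if_neg h]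
    change ((Pi.single d (⟨a, ha⟩ : gr d) : ∀ d, gr d) e : L) = 0
    rw [Pi.single_eq_of_ne h]
    rfl

theorem seq_X (i : Fin n) (e : ℕ) : (X i).seq e = if e = 1 then tx i else 0 :=
  Compl.seq_of _ _ _ e

theorem seq_Y (i : Fin n) (e : ℕ) : (Y i).seq e = if e = 1 then ty i else 0 :=
  Compl.seq_of _ _ _ e

theorem seq_Tij (i j : Fin n) (e : ℕ) : (Tij i j).seq e = if e = 2 then tt i j else 0 :=
  Compl.seq_of _ _ _ e

theorem seq_lie_X_succ (c : ℂ) (j : Fin n) (η : Compl (tGr n)) (d : ℕ) :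
    ⁅c • X j, η⁆.seq (d + 1) = c • adx j (η.seq d) := by
  rw [Compl.seq_lie, Finset.sum_eq_single (1, d)]
  · simp [Compl.seq_smul, seq_X, adx_apply]
  · rintro ⟨p, q⟩ hp hne
    rw [Finset.HasAntidiagonal.mem_antidiagonal] at hp
    have : p ≠ 1 := fun h => hne (Prod.ext h (by simp only at hp ⊢; omega))
    simp [Compl.seq_smul, seq_X, this]
  · intro h
    exact absurd (Finset.HasAntidiagonal.mem_antidiagonal.2 (add_comm 1 d)) h

theorem seq_ad_X_pow (c : ℂ) (j : Fin n) (η : Compl (tGr n)) (m d : ℕ) :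
    ((LieAlgebra.ad ℂ (Compl (tGr n)) (c • X j) ^ m) η).seq (m + d) =
      c ^ m • (adx j ^ m) (η.seq d) := by
  induction m with
  | zero => simp
  | succ m ih =>
    rw [pow_succ', Module.End.mul_apply, LieAlgebra.ad_apply, Nat.add_right_comm, seq_lie_X_succ,
      ih, map_smul, smul_smul, pow_succ' (adx j), Module.End.mul_apply, pow_succ']

theorem seq_evalAd_X (F : ℂ⟦X⟧) (c : ℂ) (j : Fin n) (η : Compl (tGr n)) (d : ℕ) :
    (Compl.evalAd F (c • X j) η).seq d = ∑ p ∈ Finset.HasAntidiagonal.antidiagonal d,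
      (coeff p.1 F * c ^ p.1) • (adx j ^ p.1) (η.seq p.2) := by
  rw [Compl.seq_evalAd, ← Finset.Nat.sum_antidiagonal_eq_sum_range_succ_mk (fun p =>
    coeff p.1 F • ((LieAlgebra.ad ℂ (Compl (tGr n)) (c • X j) ^ p.1) η).seq d)]
  refine Finset.sum_congr rfl fun p hp => ?_
  rw [← Finset.HasAntidiagonal.mem_antidiagonal.1 hp, seq_ad_X_pow, smul_smul]

theorem sum_antidiagonal_add_two {V : Type*} [AddCommMonoid V] (f : ℕ × ℕ → V) (m : ℕ) :
    ∑ p ∈ Finset.HasAntidiagonal.antidiagonal (m + 2), f p = f (m + 2, 0) + (f (m + 1, 1) +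
      ∑ p ∈ Finset.HasAntidiagonal.antidiagonal m, f (p.1, p.2 + 2)) := by
  rw [Finset.Nat.sum_antidiagonal_succ', Finset.Nat.sum_antidiagonal_succ']

theorem seq_evalAd_Tij_zero (F : ℂ⟦X⟧) (i j : Fin n) :
    (Compl.evalAd F (X i) (Tij i j)).seq 0 = 0 := by
  rw [← one_smul ℂ (X i), seq_evalAd_X]
  simp [seq_Tij]

theorem seq_evalAd_Tij_one (F : ℂ⟦X⟧) (i j : Fin n) :
    (Compl.evalAd F (X i) (Tij i j)).seq 1 = 0 := by
  rw [← one_smul ℂ (X i), seq_evalAd_X]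
  simp [Finset.Nat.antidiagonal_succ, seq_Tij]

theorem seq_evalAd_Tij (F : ℂ⟦X⟧) (i j : Fin n) (m : ℕ) :
    (Compl.evalAd F (X i) (Tij i j)).seq (m + 2) = coeff m F • (adx i ^ m) (tt i j) := by
  rw [← one_smul ℂ (X i), seq_evalAd_X, sum_antidiagonal_add_two,
    Finset.sum_eq_single (m, 0)]
  · simp [seq_Tij]
  · rintro ⟨p, q⟩ hp hne
    rw [Finset.HasAntidiagonal.mem_antidiagonal] at hp
    have : q ≠ 0 := fun h => hne (Prod.ext (by simp only at hp ⊢; omega) h)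
    simp [seq_Tij, this]
  · intro h
    exact absurd (Finset.HasAntidiagonal.mem_antidiagonal.2 (add_zero m)) h

variable (τ : UpperHalfPlane)

theorem seq_K_zero (i : Fin n) (z : dom n τ) : (K τ i z).seq 0 = 0 := by
  rw [K, Compl.seq_add, Compl.seq_neg, Compl.seq_sum, seq_Y]
  simp [Kij, seq_evalAd_Tij_zero]

theorem seq_K_one (i : Fin n) (z : dom n τ) : (K τ i z).seq 1 = -ty i := by
  rw [K, Compl.seq_add, Compl.seq_neg, Compl.seq_sum, seq_Y]
  simp [Kij, seq_evalAd_Tij_one]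

theorem seq_K (i : Fin n) (z : dom n τ) (m : ℕ) : (K τ i z).seq (m + 2) = kComp τ i z m := by
  rw [K, Compl.seq_add, Compl.seq_neg, Compl.seq_sum, seq_Y, kComp]
  simp [Kij, seq_evalAd_Tij]

theorem seq_ext_add_two {a b : Compl (tGr n)} (h0 : a.seq 0 = b.seq 0) (h1 : a.seq 1 = b.seq 1)
    (h2 : ∀ m, a.seq (m + 2) = b.seq (m + 2)) : a = b :=
  Compl.ext_seq fun d => match d with
    | 0 => h0
    | 1 => h1
    | m + 2 => h2 m

/-- The terms `K_ij` and `K_ji` cancel in pairs. -/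
theorem sum_K_eq (z : dom n τ) : ∑ i, K τ i z = -∑ i, Y i := by
  refine seq_ext_add_two ?_ ?_ fun m => ?_
  · simp [Compl.seq_sum, Compl.seq_neg, seq_K_zero, seq_Y]
  · simp [Compl.seq_sum, Compl.seq_neg, seq_K_one, seq_Y]
  · have h : (-∑ i, Y i : Compl (tGr n)).seq (m + 2) = 0 := by
      simp [Compl.seq_sum, Compl.seq_neg, seq_Y]
    rw [h, Compl.seq_sum]
    simp only [seq_K, kComp, Finset.sum_filter]
    set f : Fin n → Fin n → T n := fun i l => if l ≠ i then
      coeff m (kernelK τ (z.1 i - z.1 l)) • (adx i ^ m) (tt i l) else 0 with hf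
    change ∑ i, ∑ l, f i l = 0
    have hanti : ∀ i l, f i l = -f l i := by
      intro i l
      simp only [hf]
      by_cases hil : l = i
      · simp [hil]
      · rw [if_pos hil, if_pos (Ne.symm hil), coeff_smul_adx_pow_swap z.2 hil]
    have h3 : ∑ i, ∑ l, f i l = -∑ i, ∑ l, f i l := by
      conv_lhs => rw [Finset.sum_comm]
      rw [← Finset.sum_neg_distrib]
      refine Finset.sum_congr rfl fun i _ => ?_
      rw [← Finset.sum_neg_distrib]
      exact Finset.sum_congr rfl fun l _ => hanti l i
    have h4 : (2 : ℂ) • ∑ i, ∑ l, f i l = 0 := by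
      rw [two_smul]
      nth_rewrite 1 [h3]
      exact neg_add_cancel _
    exact (smul_eq_zero.1 h4).resolve_left two_ne_zero

-- The degree 3 part of `[K_i, K_j] = 0`: the `t_ik` with a third index commute with `y_j`, and the
-- rest is `[y_i + y_j, t_ij] = 0`.
variable {τ} in
theorem lie_ty_kComp_zero {i j : Fin n} {z : Fin n → ℂ} (hz : z ∈ dom n τ) (hij : i ≠ j) :
    ⁅ty j, kComp τ i z 0⁆ = ⁅ty i, kComp τ j z 0⁆ := by
  have h1 : ∀ i j : Fin n, i ≠ j → ⁅ty j, kComp τ i z 0⁆ =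
      ⁅ty j, coeff 0 (kernelK τ (z i - z j)) • (adx i ^ 0) (tt i j : T n)⁆ := by
    intro i j hij
    rw [kComp, sum_ne_eq hij, lie_add, lie_sum, add_eq_left]
    refine Finset.sum_eq_zero fun k hk => ?_
    rw [mem_others] at hk
    rw [lie_smul, pow_zero, Module.End.one_apply, lie_ty_tt hij.symm hk.2.symm, smul_zero]
  rw [h1 i j hij, h1 j i hij.symm, coeff_smul_adx_pow_swap hz hij, lie_neg, lie_smul, lie_smul,
    pow_zero, Module.End.one_apply, lie_ty_tt_self hij, smul_neg, neg_neg]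

theorem lie_K_K (i j : Fin n) (z : dom n τ) : ⁅K τ i z, K τ j z⁆ = 0 := by
  rcases eq_or_ne i j with rfl | hij
  · exact lie_self _
  refine seq_ext_add_two ?_ ?_ fun m => ?_
  · rw [Compl.seq_lie]
    simp [seq_K_zero, Compl.seq_zero]
  · rw [Compl.seq_lie]
    simp [Finset.Nat.antidiagonal_succ, seq_K_zero, Compl.seq_zero]
  rw [Compl.seq_lie, Compl.seq_zero]
  match m with
  | 0 =>
    rw [sum_antidiagonal_add_two]
    simp [seq_K_zero, seq_K_one, lie_ty_ty]
  | 1 =>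
    rw [sum_antidiagonal_add_two]
    simp only [Finset.Nat.antidiagonal_succ, seq_K_zero, seq_K_one, seq_K]
    simp [lie_ty_kComp_zero z.2 hij, seq_K_zero, seq_K_one]
    rw [← lie_skew, neg_add_cancel]
  | N + 2 =>
    rw [sum_antidiagonal_add_two, Finset.Nat.sum_antidiagonal_succ,
      Finset.Nat.sum_antidiagonal_succ]
    simp only [zero_add, Nat.add_right_comm _ 1 1, seq_K_zero, seq_K_one, lie_zero, zero_lie]
    rw [← commutator_eq_zero z.2 hij N, seq_K τ i z (N + 1), seq_K τ j z (N + 1), lie_neg,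
      lie_skew, neg_lie, sub_eq_add_neg, ← add_assoc]
    congr 1
    refine Finset.sum_congr rfl fun p _ => ?_
    rw [← seq_K, ← seq_K]

end Components

/-! ### Holomorphy and partial derivatives of `K_i`. -/

section DerivativesOfK

open PowerSeries Filter Topology

variable {n : ℕ} (τ : UpperHalfPlane)

theorem isOpen_dom : IsOpen (dom n τ) := by
  have h : dom n τ = ⋂ i, ⋂ j, {z : Fin n → ℂ | i ≠ j → z i - z j ∉ lattice τ} := by
    ext z
    simp [dom]
  rw [h]
  refine isOpen_iInter_of_finite fun i => isOpen_iInter_of_finite fun j => ?_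
  by_cases hij : i = j
  · simp [hij]
  · simp only [ne_eq, hij, not_false_eq_true, forall_true_left]
    have hc : Continuous fun z : Fin n → ℂ => z i - z j := by fun_prop
    exact (isClosed_lattice τ).isOpen_compl.preimage hc

theorem differentiableAt_coeff_kernelK {z : ℂ} (hz : z ∉ lattice τ) (m : ℕ) :
    DifferentiableAt ℂ (fun w => coeff m (kernelK τ w)) z := by
  have hθ := differentiable_theta τ
  have h1 : ∀ p, Differentiable ℂ (iteratedDeriv p (theta τ)) := fun p =>
    (hθ.contDiff (n := p + 1)).differentiable_iteratedDeriv p (by exact_mod_cast Nat.lt_succ_self p)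
  have h2 : (fun w => coeff m (kernelK τ w)) = fun w => (theta τ w)⁻¹ *
      ∑ p ∈ Finset.HasAntidiagonal.antidiagonal (m + 1),
        iteratedDeriv p.1 (theta τ) w / (p.1.factorial : ℂ) * coeff p.2 (thetaDivX τ)⁻¹ := by
    funext w
    rw [kernelK, coeff_mk, coeff_smul, coeff_mul, smul_eq_mul]
    simp only [thetaTaylor, coeff_mk]
  rw [h2]
  exact ((hθ z).inv (theta_ne_zero τ hz)).mul (DifferentiableAt.fun_sum fun p _ =>
    ((h1 p.1 z).div_const _).mul_const _)

/-- The derivative of `k(z, x|τ)` with respect to `z`. -/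
def kernelDeriv (z : ℂ) : ℂ⟦X⟧ := mk fun m => deriv (fun w => coeff m (kernelK τ w)) z

theorem hasDerivAt_coeff_kernelK {z : ℂ} (hz : z ∉ lattice τ) (m : ℕ) :
    HasDerivAt (fun w => coeff m (kernelK τ w)) (coeff m (kernelDeriv τ z)) z := by
  rw [kernelDeriv, coeff_mk]
  exact (differentiableAt_coeff_kernelK τ hz m).hasDerivAt

theorem coeff_kernelDeriv_neg {z : ℂ} (hz : z ∉ lattice τ) (m : ℕ) :
    coeff m (kernelDeriv τ (-z)) = (-1) ^ m * coeff m (kernelDeriv τ z) := by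
  have h1 : HasDerivAt (fun w => coeff m (kernelK τ (-w))) (-coeff m (kernelDeriv τ (-z))) z := by
    have := (hasDerivAt_coeff_kernelK τ (fun h => hz ((lattice_neg_iff τ).1 h)) m).comp z
      (hasDerivAt_neg z)
    rwa [mul_neg_one] at this
  have h2 := (hasDerivAt_coeff_kernelK τ hz m).const_mul ((-1 : ℂ) ^ (m + 1))
  have h3 : (fun w => coeff m (kernelK τ (-w))) =ᶠ[𝓝 z]
      fun w => (-1) ^ (m + 1) * coeff m (kernelK τ w) := by
    filter_upwards [(isClosed_lattice τ).isOpen_compl.mem_nhds hz] with w hw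
    exact coeff_kernelK_neg τ hw m
  have h4 := h1.unique (h2.congr_of_eventuallyEq h3)
  rw [pow_succ] at h4
  linear_combination -h4

theorem HasPartialAt.smul_const {V : Type*} [AddCommGroup V] [Module ℂ V] {S : Set (Fin n → ℂ)}
    (hS : IsOpen S) {i : Fin n} {z : S} {g : (Fin n → ℂ) → ℂ} {g' : ℂ}
    (h : HasDerivAt (fun t => g (z.1 + Pi.single i t)) g' 0) (a : V) :
    HasPartialAt i (fun w : S => g w.1 • a) (g' • a) z := by
  have h1 : HasDerivW (fun t => g (z.1 + Pi.single i t) • a) (g' • a) := fun φ => by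
    simpa only [map_smul, smul_eq_mul] using h.mul_const (φ a)
  refine h1.congr ?_
  filter_upwards [eventually_add_single_mem hS z i] with t ht
  rw [zeroExt_apply _ ht]

/-- The partial derivative `∂K_j/∂z_i`. -/
def dK (i j : Fin n) (z : dom n τ) : Compl (tGr n) :=
  if i = j then ∑ l ∈ Finset.univ.filter (fun l => l ≠ i),
    Compl.evalAd (kernelDeriv τ (z.1 i - z.1 l)) (X i) (Tij i l)
  else -Compl.evalAd (kernelDeriv τ (z.1 j - z.1 i)) (X j) (Tij j i)

theorem hasDerivAt_add_single (z : Fin n → ℂ) (i k : Fin n) :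
    HasDerivAt (fun t : ℂ => (z + Pi.single i t : Fin n → ℂ) k) ((Pi.single i 1 : Fin n → ℂ) k) 0 := by
  simp only [Pi.add_apply]
  refine HasDerivAt.const_add _ ?_
  by_cases hk : k = i
  · subst hk
    simpa using hasDerivAt_id' (0 : ℂ)
  · simpa [Pi.single_eq_of_ne hk] using hasDerivAt_const (0 : ℂ) (0 : ℂ)

theorem hasDerivAt_coeff_kernelK_sub (z : dom n τ) {j l : Fin n} (hl : j ≠ l) (i : Fin n) (m : ℕ) :
    HasDerivAt (fun t : ℂ => coeff m (kernelK τ ((z.1 + Pi.single i t : Fin n → ℂ) j - (z.1 + Pi.single i t : Fin n → ℂ) l)))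
      (coeff m (kernelDeriv τ (z.1 j - z.1 l)) *
        ((Pi.single i 1 : Fin n → ℂ) j - (Pi.single i 1 : Fin n → ℂ) l)) 0 := by
  have h1 : HasDerivAt (fun w => coeff m (kernelK τ w)) (coeff m (kernelDeriv τ (z.1 j - z.1 l)))
      ((z.1 + Pi.single i (0 : ℂ) : Fin n → ℂ) j - (z.1 + Pi.single i (0 : ℂ) : Fin n → ℂ) l) := by
    rw [Pi.single_zero, add_zero]
    exact hasDerivAt_coeff_kernelK τ (z.2 j l hl) m
  exact HasDerivAt.comp (0 : ℂ) h1
    ((hasDerivAt_add_single z.1 i j).sub (hasDerivAt_add_single z.1 i l))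

theorem hasPartial_K (i j : Fin n) :
    HasPartial (dom n τ) i (fun z => (K τ j z).seq) (fun z => (dK τ i j z).seq) := by
  refine hasPartial_iff.2 fun d z => ?_
  match d with
  | 0 =>
    have h : (dK τ i j z).seq 0 = 0 := by
      rw [dK]
      split_ifs <;> simp [Compl.seq_sum, Compl.seq_neg, seq_evalAd_Tij_zero]
    simp only [seq_K_zero, h]
    exact hasPartialAt_const (isOpen_dom τ) i z 0
  | 1 =>
    have h : (dK τ i j z).seq 1 = 0 := by
      rw [dK]
      split_ifs <;> simp [Compl.seq_sum, Compl.seq_neg, seq_evalAd_Tij_one]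
    simp only [seq_K_one, h]
    exact hasPartialAt_const (isOpen_dom τ) i z _
  | m + 2 =>
    simp only [seq_K, kComp]
    -- The chain rule factor `∂(z_j - z_l)/∂z_i = δ_ij - δ_il` treats the cases `i = j` and `i ≠ j`
    -- at once.
    have h : (dK τ i j z).seq (m + 2) = ∑ l ∈ Finset.univ.filter (fun l => l ≠ j),
        (coeff m (kernelDeriv τ (z.1 j - z.1 l)) * ((Pi.single i 1 : Fin n → ℂ) j -
          (Pi.single i 1 : Fin n → ℂ) l)) • (adx j ^ m) (tt j l : T n) := by
      rw [dK]
      split_ifs with hij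
      · subst hij
        rw [Compl.seq_sum]
        refine Finset.sum_congr rfl fun l hl => ?_
        have hl' : l ≠ i := (Finset.mem_filter.1 hl).2
        rw [seq_evalAd_Tij, Pi.single_eq_same, Pi.single_eq_of_ne hl', sub_zero, mul_one]
      · rw [Finset.sum_eq_single i]
        · rw [Compl.seq_neg, seq_evalAd_Tij, Pi.single_eq_same, Pi.single_eq_of_ne (Ne.symm hij),
            zero_sub, mul_neg_one, neg_smul]
        · intro l _ hl
          rw [Pi.single_eq_of_ne hl, Pi.single_eq_of_ne (Ne.symm hij), sub_zero, mul_zero, zero_smul]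
        · intro h
          exact absurd (Finset.mem_filter.2 ⟨Finset.mem_univ i, hij⟩) h
    rw [h]
    refine HasPartialAt.sum _ fun l hl => ?_
    have hl' : j ≠ l := (Finset.mem_filter.1 hl).2.symm
    refine HasPartialAt.smul_const (g := fun w => coeff m (kernelK τ (w j - w l))) (isOpen_dom τ) ?_ _
    exact hasDerivAt_coeff_kernelK_sub τ z hl' i m

/-- Only `K_ji` depends on both `z_i` and `z_j`. The parity sign of `∂k/∂z` cancels the one from
exchanging `ad x_j` for `ad x_i` on `t_ij`. -/
theorem dK_symm (i j : Fin n) (z : dom n τ) : dK τ i j z = dK τ j i z := by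
  rcases eq_or_ne i j with rfl | hij
  · rfl
  rw [dK, dK, if_neg hij, if_neg hij.symm]
  congr 1
  refine seq_ext_add_two ?_ ?_ fun m => ?_
  · rw [seq_evalAd_Tij_zero, seq_evalAd_Tij_zero]
  · rw [seq_evalAd_Tij_one, seq_evalAd_Tij_one]
  · rw [seq_evalAd_Tij, seq_evalAd_Tij, adx_pow_tt_swap hij, ← neg_sub,
      coeff_kernelDeriv_neg τ (z.2 i j hij), smul_smul]
    congr 1
    rw [mul_right_comm, ← mul_pow]
    simp

theorem flat_K (i j : Fin n) (z : dom n τ) :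
    -dK τ i j z + dK τ j i z + ⁅K τ i z, K τ j z⁆ = 0 := by
  rw [lie_K_K, dK_symm, add_zero, neg_add_cancel]

theorem isHolW_K (i : Fin n) (d : ℕ) : IsHolW fun z : dom n τ => (K τ i z).seq d := by
  match d with
  | 0 => simpa only [seq_K_zero] using IsHolW.const 0
  | 1 => simpa only [seq_K_one] using IsHolW.const (-ty i)
  | m + 2 =>
    simp only [seq_K, kComp]
    refine IsHolW.sum _ fun l hl => ?_
    refine IsHolW.smul_const (g := fun w => coeff m (kernelK τ (w i - w l))) (fun z hz => ?_) _
    have hl' : i ≠ l := (Finset.mem_filter.1 hl).2.symm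
    refine DifferentiableAt.differentiableWithinAt ?_
    refine DifferentiableAt.comp z (g := fun w => coeff m (kernelK τ w))
      (f := fun w : Fin n → ℂ => w i - w l) (differentiableAt_coeff_kernelK τ (hz i l hl') m) ?_
    fun_prop

end DerivativesOfK

/-! ### Behaviour of `K_i` under lattice translations and permutations. -/

section EquivarianceOfK

open PowerSeries

variable {n : ℕ} (τ : UpperHalfPlane)

theorem K_congr {i : Fin n} {z z' : dom n τ}
    (h : ∀ l, l ≠ i → kernelK τ (z'.1 i - z'.1 l) = kernelK τ (z.1 i - z.1 l)) :
    K τ i z' = K τ i z := by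
  refine seq_ext_add_two ?_ ?_ fun m => ?_
  · rw [seq_K_zero, seq_K_zero]
  · rw [seq_K_one, seq_K_one]
  · rw [seq_K, seq_K, kComp, kComp]
    exact Finset.sum_congr rfl fun l hl => by rw [h l (Finset.mem_filter.1 hl).2]

theorem K_add_one (i j : Fin n) (z z' : dom n τ) (h : z'.1 = z.1 + Pi.single j 1) :
    K τ i z' = K τ i z := by
  refine K_congr τ fun l hl => ?_
  rw [h, Pi.add_apply, Pi.add_apply]
  by_cases hi : i = j
  · subst hi
    rw [Pi.single_eq_same, Pi.single_eq_of_ne hl, add_zero, add_sub_right_comm, kernelK_add_one]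
  rw [Pi.single_eq_of_ne hi, add_zero]
  by_cases hlj : l = j
  · subst hlj
    rw [Pi.single_eq_same, ← sub_sub, kernelK_sub_one]
  · rw [Pi.single_eq_of_ne hlj, add_zero]

theorem K_add_const (i : Fin n) (z z' : dom n τ) (u : ℂ) (h : z'.1 = z.1 + fun _ => u) :
    K τ i z' = K τ i z := by
  refine K_congr τ fun l _ => ?_
  rw [h, Pi.add_apply, Pi.add_apply, add_sub_add_right_eq_sub]

theorem coeff_exp_complex (p : ℕ) : coeff p (exp ℂ) = (p.factorial : ℂ)⁻¹ := by
  rw [coeff_exp]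
  simp

theorem seq_evalAd_exp_K (c : ℂ) (i j : Fin n) (z : dom n τ) (m : ℕ) :
    (Compl.evalAd (exp ℂ) (c • X j) (K τ i z)).seq (m + 2) =
      -((c ^ (m + 1) * ((m + 1).factorial : ℂ)⁻¹) • (adx j ^ m) ⁅tx j, ty i⁆) +
      ∑ p ∈ Finset.HasAntidiagonal.antidiagonal m,
        (c ^ p.1 * (p.1.factorial : ℂ)⁻¹) • (adx j ^ p.1) (kComp τ i z p.2) := by
  rw [seq_evalAd_X, sum_antidiagonal_add_two]
  simp only [seq_K_zero, seq_K_one, seq_K, map_zero, smul_zero, zero_add, coeff_exp_complex,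
    map_neg, smul_neg]
  rw [pow_succ (adx j), Module.End.mul_apply, adx_apply]
  simp only [mul_comm]

/-- The extra `(e^{cx} - 1)/x` acquired by each `k(z_il, x)` matches `e^{c ad x_i}(-y_i) + y_i`,
because `[x_i, y_i] = -∑ t_il`. -/
theorem kComp_add_tau_self (i : Fin n) (z z' : dom n τ) (h : z'.1 = z.1 + Pi.single i (τ : ℂ))
    (m : ℕ) : kComp τ i z'.1 m = (Compl.evalAd (exp ℂ)
      ((-(2 * Real.pi * Complex.I : ℂ)) • X i) (K τ i z)).seq (m + 2) := by
  set c := -(2 * Real.pi * Complex.I : ℂ) with hc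
  rw [seq_evalAd_exp_K, lie_tx_ty_self, map_neg, smul_neg, neg_neg, map_sum, Finset.smul_sum]
  simp only [kComp, map_sum, Finset.smul_sum]
  rw [Finset.sum_comm, ← Finset.sum_add_distrib]
  refine Finset.sum_congr rfl fun l hl => ?_
  have hl' : i ≠ l := (Finset.mem_filter.1 hl).2.symm
  have h1 : z'.1 i - z'.1 l = z.1 i - z.1 l + τ := by
    rw [h, Pi.add_apply, Pi.add_apply, Pi.single_eq_same, Pi.single_eq_of_ne hl'.symm]
    ring
  have h2 : z.1 i - z.1 l + τ ∉ lattice τ := h1 ▸ z'.2 i l hl'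
  rw [h1, coeff_kernelK_of_kernelG_eq τ (z.2 i l hl') h2 (kernelG_add_tau τ _), add_comm, add_smul,
    Finset.sum_smul]
  congr 1
  refine Finset.sum_congr rfl fun p hp => ?_
  rw [map_smul, smul_smul, ← Module.End.mul_apply, ← pow_add,
    Finset.HasAntidiagonal.mem_antidiagonal.1 hp]

theorem adx_pow_adx_pow_tt {i j : Fin n} (hij : i ≠ j) (p q : ℕ) :
    (adx j ^ p) ((adx i ^ q) (tt i j : T n)) = (-1 : ℂ) ^ p • (adx i ^ (p + q)) (tt i j) := by
  rw [← Module.End.mul_apply, ((adx_commute j i).pow_pow p q).eq, Module.End.mul_apply,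
    tt_symm i j, adx_pow_tt_swap hij, map_smul, ← Module.End.mul_apply, ← pow_add, add_comm q p,
    tt_symm i j]

/-- Only `z_ij` moves, by `-τ`, which produces `e^{-c ad x_i}`; on `t_ij` this is `e^{c ad x_j}`.
The remaining terms contain `t_ik` and are fixed, since `ad x_j` kills them. -/
theorem kComp_add_tau_of_ne {i j : Fin n} (hij : i ≠ j) (z z' : dom n τ)
    (h : z'.1 = z.1 + Pi.single j (τ : ℂ)) (m : ℕ) : kComp τ i z'.1 m = (Compl.evalAd (exp ℂ)
      ((-(2 * Real.pi * Complex.I : ℂ)) • X j) (K τ i z)).seq (m + 2) := by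
  set c := -(2 * Real.pi * Complex.I : ℂ) with hc
  have hk : ∀ w : Fin n → ℂ, ∀ q, kComp τ i w q =
      coeff q (kernelK τ (w i - w j)) • (adx i ^ q) (tt i j : T n) +
        ∑ k ∈ others i j, coeff q (kernelK τ (w i - w k)) • (adx i ^ q) (tt i k : T n) :=
    fun w q => by rw [kComp, sum_ne_eq hij]
  have h1 : z'.1 i - z'.1 j = z.1 i - z.1 j - τ := by
    rw [h, Pi.add_apply, Pi.add_apply, Pi.single_eq_same, Pi.single_eq_of_ne hij]
    ring
  have h2 : z.1 i - z.1 j - τ ∉ lattice τ := h1 ▸ z'.2 i j hij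
  have h3 : ∀ k ∈ others i j, z'.1 i - z'.1 k = z.1 i - z.1 k := fun k hk => by
    rw [h, Pi.add_apply, Pi.add_apply, Pi.single_eq_of_ne hij,
      Pi.single_eq_of_ne (mem_others.1 hk).2, add_zero, add_zero]
  have h4 : ∑ p ∈ Finset.HasAntidiagonal.antidiagonal m,
      (c ^ p.1 * (p.1.factorial : ℂ)⁻¹) • (adx j ^ p.1) (∑ k ∈ others i j,
        coeff p.2 (kernelK τ (z.1 i - z.1 k)) • (adx i ^ p.2) (tt i k : T n)) =
      ∑ k ∈ others i j, coeff m (kernelK τ (z.1 i - z.1 k)) • (adx i ^ m) (tt i k : T n) := by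
    rw [Finset.sum_eq_single (0, m)]
    · simp
    · rintro ⟨p, q⟩ hp hne
      have hp0 : p ≠ 0 := by
        rintro rfl
        rw [Finset.HasAntidiagonal.mem_antidiagonal] at hp
        exact hne (Prod.ext rfl (by simpa using hp))
      obtain ⟨p, rfl⟩ := Nat.exists_eq_succ_of_ne_zero hp0
      rw [map_sum, Finset.sum_eq_zero, smul_zero]
      intro k hk
      rw [mem_others] at hk
      rw [map_smul, Nat.succ_eq_add_one, pow_succ, Module.End.mul_apply,
        pow_apply_eq_zero_of_commute (adx_commute j i) (adx_tt hij.symm hk.2.symm), map_zero,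
        smul_zero]
    · intro h
      exact absurd (Finset.HasAntidiagonal.mem_antidiagonal.2 (zero_add m)) h
  rw [seq_evalAd_exp_K, lie_tx_ty hij.symm, adx_pow_tt_swap hij]
  simp only [hk z.1, map_add, smul_add, Finset.sum_add_distrib]
  rw [h4, hk, h1, Finset.sum_congr rfl fun k hk => by rw [h3 k hk], ← add_assoc]
  congr 1
  have hG : kernelG τ (z.1 i - z.1 j - τ) = rescale (-c) (exp ℂ) * kernelG τ (z.1 i - z.1 j) := by
    rw [hc, neg_neg]
    exact kernelG_sub_tau τ _
  rw [coeff_kernelK_of_kernelG_eq τ (z.2 i j hij) h2 hG, add_comm, add_smul, Finset.sum_smul]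
  congr 1
  · rw [smul_smul, ← neg_smul]
    congr 1
    rw [neg_pow, pow_succ]
    ring
  · refine Finset.sum_congr rfl fun p hp => ?_
    rw [map_smul, adx_pow_adx_pow_tt hij, smul_smul, smul_smul,
      Finset.HasAntidiagonal.mem_antidiagonal.1 hp]
    congr 1
    rw [neg_pow]
    ring

theorem K_add_tau (i j : Fin n) (z z' : dom n τ) (h : z'.1 = z.1 + Pi.single j (τ : ℂ)) :
    K τ i z' = Compl.evalAd (exp ℂ) ((-(2 * Real.pi * Complex.I : ℂ)) • X j) (K τ i z) := by
  refine seq_ext_add_two ?_ ?_ fun m => ?_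
  · rw [seq_evalAd_X]
    simp [seq_K_zero]
  · rw [seq_evalAd_X]
    simp [Finset.Nat.antidiagonal_succ, seq_K_zero, seq_K_one]
  · rw [seq_K]
    rcases eq_or_ne i j with rfl | hij
    · exact kComp_add_tau_self τ i z z' h m
    · exact kComp_add_tau_of_ne τ hij z z' h m

theorem permT_tt (σ : Equiv.Perm (Fin n)) (i j : Fin n) :
    permT n σ (tt i j) = tt (σ i) (σ j) :=
  congrArg (fun a => (LieSubmodule.Quotient.mk a : T n)) (freePerm_ft σ i j)

theorem permT_adx_pow (σ : Equiv.Perm (Fin n)) (i : Fin n) (m : ℕ) (a : T n) :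
    permT n σ ((adx i ^ m) a) = (adx (σ i) ^ m) (permT n σ a) := by
  induction m with
  | zero => rfl
  | succ m ih =>
    rw [pow_succ', Module.End.mul_apply, adx_apply, LieHom.map_lie, permT_tx, ih, pow_succ',
      Module.End.mul_apply, adx_apply]

theorem seq_K_perm (σ : Equiv.Perm (Fin n)) (i : Fin n) (z z' : dom n τ)
    (h : z'.1 = z.1 ∘ σ.symm) (d : ℕ) : (K τ (σ i) z').seq d = permT n σ ((K τ i z).seq d) := by
  match d with
  | 0 => rw [seq_K_zero, seq_K_zero, map_zero]
  | 1 => rw [seq_K_one, seq_K_one, map_neg, permT_ty]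
  | m + 2 =>
    rw [seq_K, seq_K, kComp, kComp, map_sum, Finset.sum_filter, Finset.sum_filter,
      ← Equiv.sum_comp σ]
    refine Finset.sum_congr rfl fun l _ => ?_
    simp only [ne_eq, σ.injective.eq_iff]
    split_ifs
    · rfl
    · rw [map_smul, permT_adx_pow, permT_tt, h]
      simp

theorem permT_mem (σ : Equiv.Perm (Fin n)) {d : ℕ} {a : T n} (h : a ∈ tGr n d) :
    permT n σ a ∈ tGr n d := by
  change Homog n d a at h
  change Homog n d (permT n σ a)
  induction h with
  | x i => rw [permT_tx]; exact Homog.x _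
  | y i => rw [permT_ty]; exact Homog.y _
  | t i j => rw [permT_tt]; exact Homog.t _ _
  | zero d => rw [map_zero]; exact Homog.zero d
  | add _ _ iha ihb => rw [map_add]; exact iha.add ihb
  | smul c _ ih => rw [map_smul]; exact ih.smul c
  | lie _ _ iha ihb => rw [LieHom.map_lie]; exact iha.lie ihb

theorem permTBar_mem (σ : Equiv.Perm (Fin n)) {d : ℕ} {a : TBar n} (h : a ∈ barGr n d) :
    permTBar n σ a ∈ barGr n d := by
  obtain ⟨b, hb, rfl⟩ := h
  exact ⟨permT n σ b, permT_mem σ hb, rfl⟩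

theorem toBar_mem {d : ℕ} {a : T n} (h : a ∈ tGr n d) : toBar n a ∈ barGr n d := ⟨a, h, rfl⟩

end EquivarianceOfK

/-! ### The projections to the configuration spaces and their fibres. -/

section CoveringMaps

variable {n : ℕ} {τ : UpperHalfPlane}

theorem intCast_of_ofReal_mem_lattice {r : ℝ} (h : (r : ℂ) ∈ lattice τ) : ∃ a : ℤ, (a : ℝ) = r := by
  obtain ⟨a, b, hab⟩ := (mem_lattice_iff τ).1 h
  have him := congrArg Complex.im hab
  have hre := congrArg Complex.re hab
  simp only [Complex.add_im, Complex.mul_im, Complex.intCast_im, Complex.intCast_re, zero_mul,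
    add_zero, zero_add, Complex.ofReal_im, mul_eq_zero] at him
  have hb : (b : ℝ) = 0 := him.resolve_right τ.im_pos.ne'
  simp only [Complex.add_re, Complex.mul_re, Complex.intCast_im, Complex.intCast_re, zero_mul,
    sub_zero, Complex.ofReal_re, hb, add_zero] at hre
  exact ⟨a, hre⟩

/-- A lattice contains no complex line: the choice `u = 1/(2w)` would put `1/2` in `Λ_τ`. It
identifies the vectors tangent to the fibres. -/
theorem eq_zero_of_forall_mul_mem_lattice {w : ℂ} (h : ∀ u : ℂ, u * w ∈ lattice τ) : w = 0 := by
  by_contra hw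
  have h1 := h (((1 / 2 : ℝ) : ℂ) * w⁻¹)
  rw [mul_assoc, inv_mul_cancel₀ hw, mul_one] at h1
  obtain ⟨a, ha⟩ := intCast_of_ofReal_mem_lattice h1
  have h2 : ((2 * a : ℤ) : ℝ) = (1 : ℤ) := by
    push_cast
    rw [ha]
    norm_num
  have h3 : 2 * a = 1 := Int.cast_injective h2
  omega

/-- The points `i/n` have real differences of absolute value `< 1`, and the real lattice points are
the integers. -/
theorem dom_nonempty (n : ℕ) (τ : UpperHalfPlane) : (dom n τ).Nonempty := by
  refine ⟨fun i => (((i : ℕ) / n : ℝ) : ℂ), fun i j hij h => hij ?_⟩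
  rw [← Complex.ofReal_sub] at h
  obtain ⟨a, ha⟩ := intCast_of_ofReal_mem_lattice h
  have hn : (n : ℝ) ≠ 0 := Nat.cast_ne_zero.2 (by have := i.2; omega)
  have h1 : (((i : ℕ) : ℤ) - ((j : ℕ) : ℤ) : ℤ) = a * n := by
    have h2 : (((i : ℕ) : ℝ) - ((j : ℕ) : ℝ)) = a * n := by
      rw [ha]
      field_simp
    exact_mod_cast h2
  have hi := i.2
  have hj := j.2
  have ha0 : a = 0 := by
    by_contra h0
    rcases lt_or_gt_of_ne h0 with h0 | h0
    · nlinarith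
    · nlinarith
  rw [ha0, zero_mul] at h1
  exact Fin.ext (by omega)

theorem add_mem_dom_iff {v : Fin n → ℂ} (hv : ∀ i j, v i - v j ∈ lattice τ) (z : Fin n → ℂ) :
    z + v ∈ dom n τ ↔ z ∈ dom n τ := by
  refine forall_congr' fun i => forall_congr' fun j => imp_congr_right fun _ => not_congr ?_
  rw [Pi.add_apply, Pi.add_apply, add_sub_add_comm]
  exact (lattice τ).add_mem_cancel_right (hv i j)

theorem single_apply_mem_lattice {w : ℂ} (hw : w ∈ lattice τ) (i j : Fin n) :
    (Pi.single i w : Fin n → ℂ) j ∈ lattice τ := by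
  rw [Pi.single_apply]
  split_ifs
  exacts [hw, zero_mem _]

theorem toConf_eq_iff {z z' : dom n τ} :
    toConf n τ z = toConf n τ z' ↔ ∀ i, z'.1 i - z.1 i ∈ lattice τ := by
  rw [Subtype.ext_iff, funext_iff]
  refine forall_congr' fun i => ?_
  change (QuotientAddGroup.mk (z.1 i) : EllCurve τ) = QuotientAddGroup.mk (z'.1 i) ↔ _
  rw [QuotientAddGroup.eq, neg_add_eq_sub]

theorem toRedConf_eq_iff {z z' : dom n τ} :
    toRedConf n τ z = toRedConf n τ z' ↔ ∃ u : ℂ, ∀ i, z'.1 i - z.1 i + u ∈ lattice τ := by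
  have h1 : toRedConf n τ z = toRedConf n τ z' ↔
      ∃ e : EllCurve τ, e +ᵥ toConf n τ z' = toConf n τ z := by
    rw [toRedConf, toRedConf, confToRed, confToRed, Quotient.eq, AddAction.orbitRel_apply]
    rfl
  rw [h1, (QuotientAddGroup.mk_surjective (s := lattice τ)).exists]
  refine exists_congr fun u => ?_
  rw [Subtype.ext_iff, funext_iff]
  refine forall_congr' fun i => ?_
  change (QuotientAddGroup.mk u : EllCurve τ) + QuotientAddGroup.mk (z'.1 i) =
    QuotientAddGroup.mk (z.1 i) ↔ _
  rw [← QuotientAddGroup.mk_add, eq_comm, QuotientAddGroup.eq, neg_add_eq_sub,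
    show u + z'.1 i - z.1 i = z'.1 i - z.1 i + u by ring]

theorem continuous_toConf : Continuous (toConf n τ) := by
  have h : Continuous fun (z : dom n τ) i => (QuotientAddGroup.mk (z.1 i) : EllCurve τ) :=
    continuous_pi fun i => QuotientAddGroup.continuous_mk.comp
      ((continuous_apply i).comp continuous_subtype_val)
  exact h.subtype_mk _

theorem surjective_toConf : Function.Surjective (toConf n τ) := by
  rintro ⟨p, hp⟩
  choose z hz using fun i => QuotientAddGroup.mk_surjective (s := lattice τ) (p i)
  have hzd : z ∈ dom n τ := fun i j hij h => hij (hp (by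
    rw [← hz, ← hz]
    refine (QuotientAddGroup.eq.2 ?_).symm
    rwa [neg_add_eq_sub]))
  exact ⟨⟨z, hzd⟩, Subtype.ext (funext hz)⟩

theorem continuous_confToRed : Continuous (confToRed n τ) := continuous_quot_mk

theorem surjective_toRedConf : Function.Surjective (toRedConf n τ) :=
  Quotient.mk_surjective.comp surjective_toConf

theorem mem_closure_of_forall_mem_lattice {S : Set (Fin n → ℂ)}
    (h1 : ∀ i, (Pi.single i 1 : Fin n → ℂ) ∈ S) (hτ : ∀ i, (Pi.single i (τ : ℂ) : Fin n → ℂ) ∈ S)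
    {w : Fin n → ℂ} (hw : ∀ i, w i ∈ lattice τ) : w ∈ AddSubgroup.closure S := by
  rw [← Finset.univ_sum_single w]
  refine sum_mem fun i _ => ?_
  have h : lattice τ ≤ (AddSubgroup.closure S).comap
      (AddMonoidHom.single (fun _ : Fin n => ℂ) i) := by
    refine (AddSubgroup.closure_le _).2 ?_
    rintro x (rfl | rfl)
    · exact AddSubgroup.subset_closure (h1 i)
    · exact AddSubgroup.subset_closure (hτ i)
  exact h (hw i)

end CoveringMaps

/-! ### The descent conditions for the three bundles. -/

section DescentOfK

open PowerSeries

variable (n : ℕ) (τ : UpperHalfPlane)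

theorem toU_K_add_tau {i j : Fin n} {z z' : dom n τ} (h : z'.1 = z.1 + Pi.single j (τ : ℂ)) :
    toU (K τ i z').seq * expU ((-(2 * Real.pi * Complex.I : ℂ)) • (X j).seq) =
      expU ((-(2 * Real.pi * Complex.I : ℂ)) • (X j).seq) * toU (K τ i z).seq := by
  have h1 : (-(2 * Real.pi * Complex.I : ℂ)) • (X j).seq =
    ((-(2 * Real.pi * Complex.I : ℂ)) • X j : Compl (tGr n)).seq := rfl
  rw [K_add_tau τ i j z z' h, toU_evalAd, expU_eq, h1]
  simp only [coeff_exp_complex]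
  exact adP_mul_expP ((goodGrading_tGr n).vanishesBelow _) _

theorem descentData_toConf : DescentData (tGr n) (toConf n τ) (mP n τ) (K τ) where
  good := goodGrading_tGr n
  isOpen_dom := isOpen_dom τ
  continuous := continuous_toConf
  surjective := surjective_toConf
  hol := isHolW_K τ
  mem_dom := by
    rintro v g ⟨i, ⟨rfl, -⟩ | ⟨rfl, -⟩⟩ z
    · exact add_mem_dom_iff (fun j k => sub_mem (single_apply_mem_lattice (one_mem_lattice τ) i j)
        (single_apply_mem_lattice (one_mem_lattice τ) i k)) z
    · exact add_mem_dom_iff (fun j k => sub_mem (single_apply_mem_lattice (tau_mem_lattice τ) i j)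
        (single_apply_mem_lattice (tau_mem_lattice τ) i k)) z
  invariant := by
    rintro v g ⟨i, ⟨rfl, -⟩ | ⟨rfl, -⟩⟩ z z' h
    all_goals
      refine (toConf_eq_iff.2 fun j => ?_).symm
      rw [h, Pi.add_apply, add_sub_cancel_left]
      exact single_apply_mem_lattice (by first | exact one_mem_lattice τ | exact tau_mem_lattice τ)
        i j
  equivariant := by
    rintro v g ⟨j, ⟨rfl, rfl⟩ | ⟨rfl, rfl⟩⟩ z z' h i
    · rw [mul_one, one_mul, K_add_one τ i j z z' h]
    · exact toU_K_add_tau n τ h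
  fibre z z' h := by
    refine mem_closure_of_forall_mem_lattice ?_ ?_ (toConf_eq_iff.1 h)
    · exact fun i => ⟨1, i, Or.inl ⟨rfl, rfl⟩⟩
    · exact fun i => ⟨_, i, Or.inr ⟨rfl, rfl⟩⟩
  tangent v hv := by
    obtain ⟨z, hz⟩ := dom_nonempty n τ
    refine Or.inl (funext fun i => eq_zero_of_forall_mul_mem_lattice (τ := τ) fun u => ?_)
    obtain ⟨h, h1⟩ := hv ⟨z, hz⟩ u
    simpa using toConf_eq_iff.1 h1.symm i

/-- The image of `K_i(z|τ)` in the completion of `𝔱̄_{1,n}`. -/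
def KBarCompl (i : Fin n) (z : dom n τ) : Compl (barGr n) :=
  (K τ i z).map (toBar n) fun _ _ ha => toBar_mem ha

theorem sum_KBarCompl (z : dom n τ) : ∑ i, KBarCompl n τ i z = 0 := by
  refine Compl.ext_seq fun d => ?_
  have h1 := congrArg (fun a => toBar n (a.seq d)) (sum_K_eq τ z)
  simp only [Compl.seq_sum, map_sum, Compl.seq_neg, map_neg, seq_Y] at h1
  rw [Compl.seq_sum, Compl.seq_zero]
  refine h1.trans ?_
  split_ifs
  · rw [← map_sum, toBar_eq_zero.2 (LieSubmodule.subset_lieSpan (Or.inr rfl)), neg_zero]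
  · simp

theorem isHolW_KBarCompl (i : Fin n) (d : ℕ) : IsHolW fun z : dom n τ => (KBarCompl n τ i z).seq d :=
  (isHolW_K τ i d).map (toBar n : T n →ₗ[ℂ] TBar n)

theorem mPTilde_equivariant {v : Fin n → ℂ} {g : UHat (TBar n)} (h : mPTilde n τ v g)
    {z z' : dom n τ} (hz : z'.1 = z.1 + v) (i : Fin n) :
    toU (KBarCompl n τ i z').seq * g = g * toU (KBarCompl n τ i z).seq := by
  obtain ⟨j, ⟨rfl, rfl⟩ | ⟨rfl, rfl⟩⟩ := h
  · rw [mul_one, one_mul, KBarCompl, KBarCompl, K_add_one τ i j z z' hz]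
  · have h1 := congrArg (mapU (toBar n)) (toU_K_add_tau n τ (i := i) hz)
    rw [map_mul, map_mul, mapU_toU, mapU_toU, mapU_expU] at h1
    simp only [Pi.smul_apply, map_smul] at h1
    exact h1

theorem mPTilde_sub_mem {v : Fin n → ℂ} {g : UHat (TBar n)} (h : mPTilde n τ v g) (j : Fin n) :
    v j ∈ lattice τ := by
  obtain ⟨i, ⟨rfl, -⟩ | ⟨rfl, -⟩⟩ := h
  · exact single_apply_mem_lattice (one_mem_lattice τ) i j
  · exact single_apply_mem_lattice (tau_mem_lattice τ) i j

theorem descentData_toConf_bar :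
    DescentData (barGr n) (toConf n τ) (mPTilde n τ) (KBarCompl n τ) where
  good := goodGrading_barGr n
  isOpen_dom := isOpen_dom τ
  continuous := continuous_toConf
  surjective := surjective_toConf
  hol := isHolW_KBarCompl n τ
  mem_dom _ _ h z := add_mem_dom_iff
    (fun j k => sub_mem (mPTilde_sub_mem n τ h j) (mPTilde_sub_mem n τ h k)) z
  invariant _ _ h z z' hz := (toConf_eq_iff.2 fun j => by
    rw [hz, Pi.add_apply, add_sub_cancel_left]
    exact mPTilde_sub_mem n τ h j).symm
  equivariant _ _ h _ _ hz := mPTilde_equivariant n τ h hz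
  fibre z z' h := by
    refine mem_closure_of_forall_mem_lattice ?_ ?_ (toConf_eq_iff.1 h)
    · exact fun i => ⟨1, i, Or.inl ⟨rfl, rfl⟩⟩
    · exact fun i => ⟨_, i, Or.inr ⟨rfl, rfl⟩⟩
  tangent v hv := by
    obtain ⟨z, hz⟩ := dom_nonempty n τ
    refine Or.inl (funext fun i => eq_zero_of_forall_mul_mem_lattice (τ := τ) fun u => ?_)
    obtain ⟨h, h1⟩ := hv ⟨z, hz⟩ u
    simpa using toConf_eq_iff.1 h1.symm i

theorem descentData_toRedConf :
    DescentData (barGr n) (toRedConf n τ) (mPBar n τ) (KBarCompl n τ) where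
  good := goodGrading_barGr n
  isOpen_dom := isOpen_dom τ
  continuous := continuous_confToRed.comp continuous_toConf
  surjective := surjective_toRedConf
  hol := isHolW_KBarCompl n τ
  mem_dom := by
    rintro v g (h | ⟨u, rfl, rfl⟩) z
    · exact (descentData_toConf_bar n τ).mem_dom v g h z
    · exact add_mem_dom_iff (fun j k => by rw [sub_self]; exact zero_mem _) z
  invariant := by
    rintro v g (h | ⟨u, rfl, rfl⟩) z z' hz
    · exact congrArg (confToRed n τ) ((descentData_toConf_bar n τ).invariant v g h z z' hz)
    · refine (toRedConf_eq_iff.2 ⟨-u, fun j => ?_⟩).symm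
      rw [hz, Pi.add_apply, add_sub_cancel_left, add_neg_cancel]
      exact zero_mem _
  equivariant := by
    rintro v g (h | ⟨u, rfl, rfl⟩) z z' hz i
    · exact mPTilde_equivariant n τ h hz i
    · rw [mul_one, one_mul, KBarCompl, KBarCompl, K_add_const τ i z z' u hz]
  fibre z z' h := by
    obtain ⟨u, hu⟩ := toRedConf_eq_iff.1 h
    have h1 : (z'.1 - z.1 + fun _ => u) ∈ AddSubgroup.closure {v | ∃ g, mPBar n τ v g} := by
      refine mem_closure_of_forall_mem_lattice ?_ ?_ hu
      · exact fun i => ⟨1, Or.inl ⟨i, Or.inl ⟨rfl, rfl⟩⟩⟩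
      · exact fun i => ⟨_, Or.inl ⟨i, Or.inr ⟨rfl, rfl⟩⟩⟩
    -- Two points of a fibre differ by a vector of `Λ_τ^n` and a diagonal translation; the latter is
    -- itself among the generators.
    have h2 : (fun _ => u) ∈ AddSubgroup.closure {v | ∃ g, mPBar n τ v g} :=
      AddSubgroup.subset_closure ⟨1, Or.inr ⟨u, rfl, rfl⟩⟩
    simpa using sub_mem h1 h2
  tangent v hv := by
    refine Or.inr ⟨?_, sum_KBarCompl n τ, fun u => Or.inr ⟨u, rfl, rfl⟩⟩
    obtain ⟨z, hz⟩ := dom_nonempty n τ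
    -- For every `u` the differences `u(v_i - v_j)` lie in the lattice, whatever diagonal
    -- translation is involved; so tangent vectors are diagonal.
    have h : ∀ i j, v i = v j := fun i j => sub_eq_zero.1
      (eq_zero_of_forall_mul_mem_lattice (τ := τ) fun u => by
        obtain ⟨h, h1⟩ := hv ⟨z, hz⟩ u
        obtain ⟨w, hw⟩ := toRedConf_eq_iff.1 h1.symm
        have h2 := sub_mem (hw i) (hw j)
        simpa [mul_sub] using h2)
    rcases isEmpty_or_nonempty (Fin n) with he | ⟨⟨i⟩⟩
    · exact ⟨0, funext fun i => he.elim i⟩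
    · exact ⟨v i, funext fun j => h j i⟩

/-- The partial derivative `∂K̄_j/∂z_i`. -/
def dKBar (i j : Fin n) (z : dom n τ) : Compl (barGr n) :=
  (dK τ i j z).map (toBar n) fun _ _ ha => toBar_mem ha

theorem hasPartial_KBarCompl (i j : Fin n) :
    HasPartial (dom n τ) i (fun z => (KBarCompl n τ j z).seq) (fun z => (dKBar n τ i j z).seq) :=
  hasPartial_iff.2 fun d z =>
    (hasPartial_iff.1 (hasPartial_K τ i j) d z).map (toBar n : T n →ₗ[ℂ] TBar n)

theorem flat_KBarCompl (i j : Fin n) (z : dom n τ) :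
    -dKBar n τ i j z + dKBar n τ j i z + ⁅KBarCompl n τ i z, KBarCompl n τ j z⁆ = 0 := by
  rw [KBarCompl, KBarCompl, ← Compl.map_lie, lie_K_K, dKBar, dKBar, dK_symm, neg_add_cancel, zero_add]
  exact Compl.ext_seq fun d => map_zero (toBar n)

theorem seq_KBarCompl_perm (σ : Equiv.Perm (Fin n)) (i : Fin n) (z z' : dom n τ)
    (h : z'.1 = z.1 ∘ σ.symm) (d : ℕ) :
    (KBarCompl n τ (σ i) z').seq d = permTBar n σ ((KBarCompl n τ i z).seq d) :=
  congrArg (toBar n) (seq_K_perm τ σ i z z' h d)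

end DescentOfK

end KZB

end

/-! ### The universal KZB connection: assembly of the theorem. -/

theorem mainTheorem1 (n : ℕ) (hn : 1 ≤ n) (τ : UpperHalfPlane) :
    -- `K_i` is holomorphic on `ℂ^n - Diag` with values in the completion of `𝔱_{1,n}`
    (∀ i : Fin n, KZB.IsHol (KZB.dom n τ) (fun z => (KZB.K τ i z).seq)) ∧
    -- equivariance
    (∀ (i j : Fin n) (z z' : KZB.dom n τ), z'.1 = z.1 + Pi.single j 1 →
      KZB.K τ i z' = KZB.K τ i z) ∧
    (∀ (i j : Fin n) (z z' : KZB.dom n τ), z'.1 = z.1 + Pi.single j (τ : ℂ) →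
      KZB.K τ i z' = KZB.Compl.evalAd (PowerSeries.exp ℂ)
        ((-(2 * Real.pi * Complex.I : ℂ)) • KZB.X j) (KZB.K τ i z)) ∧
    -- flatness: `[∂_i - K_i, ∂_j - K_j] = 0`
    (∃ dK : Fin n → Fin n → KZB.dom n τ → KZB.Compl (KZB.tGr n),
      (∀ i j, KZB.HasPartial (KZB.dom n τ) i (fun z => (KZB.K τ j z).seq)
        (fun z => (dK i j z).seq)) ∧
      ∀ i j z, -dK i j z + dK j i z + ⁅KZB.K τ i z, KZB.K τ j z⁆ = 0) ∧
    -- the connection `∇` on `P_{τ,n}` over `C(E_τ,n)`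
    ∃ D : KZB.Connection (KZB.tGr n) (KZB.toConf n τ) (KZB.mP n τ),
      D.IsGivenBy (fun i z => (KZB.K τ i z).seq) ∧
      (∀ D' : KZB.Connection (KZB.tGr n) (KZB.toConf n τ) (KZB.mP n τ),
        D'.IsGivenBy (fun i z => (KZB.K τ i z).seq) → D' = D) ∧
      D.IsFlat ∧ D.IsSymmInvariant (KZB.permT n) ∧
      -- the induced connection on `P̃_{τ,n}` over `C(E_τ,n)`
      ∃ DTilde : KZB.Connection (KZB.barGr n) (KZB.toConf n τ) (KZB.mPTilde n τ),
        KZB.IsInduced (KZB.toBar n) D DTilde ∧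
        DTilde.IsGivenBy (KZB.KBar τ) ∧
        DTilde.IsFlat ∧ DTilde.IsSymmInvariant (KZB.permTBar n) ∧
        -- its unique descent to `P̄_{τ,n}` over `C̄(E_τ,n)`
        ∃ DBar : KZB.Connection (KZB.barGr n) (KZB.toRedConf n τ) (KZB.mPBar n τ),
          KZB.IsPullback (KZB.confToRed n τ) DTilde DBar ∧
          (∀ D' : KZB.Connection (KZB.barGr n) (KZB.toRedConf n τ) (KZB.mPBar n τ),
            KZB.IsPullback (KZB.confToRed n τ) DTilde D' → D' = DBar) ∧
          DBar.IsFlat ∧ DBar.IsSymmInvariant (KZB.permTBar n) := by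
  have hD := KZB.descentData_toConf n τ
  have hT := KZB.descentData_toConf_bar n τ
  have hB := KZB.descentData_toRedConf n τ
  refine ⟨fun i => KZB.isHol_iff.2 (KZB.isHolW_K τ i), KZB.K_add_one τ, KZB.K_add_tau τ,
    ⟨KZB.dK τ, KZB.hasPartial_K τ, KZB.flat_K τ⟩, ?_⟩
  obtain ⟨D, h⟩ := hD.exists_connection
  obtain ⟨DT, hDT⟩ := hT.exists_connection
  obtain ⟨DB, hDB⟩ := hB.exists_connection
  -- Both connections are given by the same functions `K̄_i` on `ℂ^n - Diag`, so one is the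
  -- pull-back of the other.
  have hpb := hT.isPullback (q := KZB.confToRed n τ) (fun _ => rfl) hB hDT hDB
  exact ⟨D, h, fun D' h' => hD.connection_unique h h',
    hD.isFlat h (KZB.hasPartial_K τ) (KZB.flat_K τ),
    hD.isSymmInvariant h (KZB.permT n) (fun σ _ _ ha => KZB.permT_mem σ ha) (KZB.seq_K_perm τ),
    DT, hD.isInduced hT h hDT (KZB.toBar n) (fun _ _ ha => KZB.toBar_mem ha) (fun _ _ => rfl), hDT,
    hT.isFlat hDT (KZB.hasPartial_KBarCompl n τ) (KZB.flat_KBarCompl n τ),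
    hT.isSymmInvariant hDT (KZB.permTBar n) (fun σ _ _ ha => KZB.permTBar_mem σ ha)
      (KZB.seq_KBarCompl_perm n τ),
    DB, hpb, fun D' h' => KZB.DescentData.pullback_unique (q := KZB.confToRed n τ) (fun _ => rfl)
      KZB.continuous_confToRed (fun _ _ => Or.inl) hB h' hpb,
    hB.isFlat hDB (KZB.hasPartial_KBarCompl n τ) (KZB.flat_KBarCompl n τ),
    hB.isSymmInvariant hDB (KZB.permTBar n) (fun σ _ _ ha => KZB.permTBar_mem σ ha)
      (KZB.seq_KBarCompl_perm n τ)⟩
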